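/- Setting. Let $k\ge 1$, $m\ge 0$, $n=k+m$ and $p\ge 2$ be integers. Let $D\subset\mathbb C^n$ be a bounded pseudoconvex domain, $S\subset D$ a (relatively) closed complex submanifold of codimension $k$, and $\phi:D\to\mathbb R$ a continuous plurisubharmonic function. Let $G:D\to[-\infty,0)$ be plurisubharmonic, real-valued and continuous on $D\setminus S$, and such that near every point of $S$ there are holomorphic coordinates $z=(z',z'')\in\mathbb C^k\times\mathbb C^m$, called *adapted*, in which $S=\{z'=0\}$ and $G=\log|z'|^2+\gamma$ with $\gamma$ a continuous real function. Let $\mathcal I_S$ be the ideal sheaf of $S$ and $J^{(p-1)}=\mathcal I_S^{p-1}/\mathcal I_S^{p}$, a vector bundle on $S$ whose fibre at $x$ is $J^{(p-1)}_x=\mathcal I_{S,x}^{p-1}/(\mathcal I_{S,x}^{p}+\mathfrak m_x\mathcal I_{S,x}^{p-1})$. Let $dV_S$ be the volume measure on $S$ induced by the Euclidean metric. For $x\in S$, adapted coordinates $z$ around $x$, and an open neighbourhood $U$ of $x$ that is relatively compact in the domain of $z$, put $U_x=\{q\in U: z''(q)=z''(x)\}$ and let $dV_{U_x}$ be the measure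 on $U_x$ determined by $dV_{U_x}(z')\cdot dV_S(z'')=dV_{\mathbb C^n}$; that is, $dV_{U_x}$ has density with respect to $d\lambda(z')$ equal to the density of $dV_{\mathbb C^n}$ with respect to $d\lambda(z')\,d\lambda(z'')$ at $(z',z''(x))$ divided by the density of $dV_S$ with respect to $d\lambda(z'')$ at $x$. Every $f_x\in J_x^{(p-1)}$ is the class of exactly one homogeneous polynomial of degree $p-1$ in $z_1,\dots,z_k$, denoted by the same symbol. For $f_x,g_x\in J^{(p-1)}_x$ consider $$\langle f_x,g_x\rangle_{J^{(p-1)}_x}:=\lim_{t\to-\infty}\int_{U_x\cap\{t<G<t+1\}}f_x\,\overline{g_x}\,e^{-\phi-(p+k-1)G}\,dV_{U_x}.\qquad(*)$$ Proposition. In $(*)$, and in the limits in (2) and (4), the integrals converge absolutely for all $t$ sufficiently close to $-\infty$, and: (1) The limit $(*)$ exists. (2) If $\widetilde f_x,\widetilde g_x$ are measurable functions on $U_x$ with $\widetilde f_x=f_x+o(|z'|^{p-1})$ and $\widetilde g_x=g_x+o(|z'|^{p-1})$ as $z'\to0$, $z'\neq 0$, then replacing $f_x,g_x$ in $(*)$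 by $\widetilde f_x,\widetilde g_x$ does not change the limit. (3) The value $\langle f_x,g_x\rangle_{J_x^{(p-1)}}$ does not depend on the adapted coordinates $z$ and the neighbourhood $U$. (4) Let $f,g$ be smooth sections of $J^{(p-1)}$ over $S$, and let $\widetilde f,\widetilde g\in C^\infty(D)$ be smooth extensions of them (at each $x\in S$, $\widetilde f$ agrees with a holomorphic germ in $\mathcal I_{S,x}^{p-1}$ representing $f_x$ up to $o(|y-x|^{p-1})$ as $y\to x$, and likewise for $\widetilde g$) such that $\widetilde f\,\overline{\widetilde g}$ vanishes outside a compact subset of $D$ (for instance, $f$ and $g$ have compact support and the extensions are chosen with compact support in $D$). Then $x\mapsto\langle f_x,g_x\rangle_{J^{(p-1)}_x}$ is integrable with respect to $dV_S$ and $$\int_S\langle f,g\rangle_{J^{(p-1)}}\,dV_S=\lim_{t\to-\infty}\int_{D\cap\{t<G<t+1\}}\widetilde f\,\overline{\widetilde g}\,e^{-\phi-(p+k-1)G}\,dV_{\mathbb C^n}.$$ -/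

import Mathlib

open Filter Topology MeasureTheory Asymptotics
open scoped ENNReal ContDiff ComplexConjugate

noncomputable section

namespace JetMetric

/-- `ℂⁿ` with its Euclidean norm; its `volume` is the Lebesgue measure. -/
abbrev Cn (n : ℕ) : Type := EuclideanSpace ℂ (Fin n)

/-! ### Plurisubharmonic functions and pseudoconvex domains -/

/-- `u : D → [-∞, ∞)` is plurisubharmonic: upper semicontinuous, and on every closed affine complex
disc in `D` the value at the centre is at most the mean of `u` over the boundary circle. Since `u`
is upper semicontinuous, that mean (possibly `-∞`) is the infimum of the means of the continuous
real functions `h ≥ u` on the circle. -/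
def IsPSHOn {n : ℕ} (u : Cn n → EReal) (D : Set (Cn n)) : Prop :=
  UpperSemicontinuousOn u D ∧ (∀ z ∈ D, u z < ⊤) ∧
    ∀ a b : Cn n, (∀ ζ : ℂ, ‖ζ‖ ≤ 1 → a + ζ • b ∈ D) →
      ∀ h : ℂ → ℝ, Continuous h → (∀ ζ : ℂ, ‖ζ‖ = 1 → u (a + ζ • b) ≤ (h ζ : EReal)) →
        u a ≤ ((Real.circleAverage h 0 1 : ℝ) : EReal)

/-- A pseudoconvex domain: a connected non-empty open set with a continuous plurisubharmonic
exhaustion function. -/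
def IsPseudoconvexDomain {n : ℕ} (D : Set (Cn n)) : Prop :=
  IsOpen D ∧ IsConnected D ∧
    ∃ u : Cn n → ℝ, ContinuousOn u D ∧ IsPSHOn (fun z => (u z : EReal)) D ∧
      ∀ c : ℝ, IsCompact {z ∈ D | u z ≤ c}

/-! ### Coordinates adapted to a submanifold -/

/-- Local holomorphic coordinates `z = (z', z'')` on `ℂⁿ`, with `z' ∈ ℂᵏ` and `z'' ∈ ℂᵐ`. -/
abbrev Coord (n k m : ℕ) : Type := OpenPartialHomeomorph (Cn n) (Cn k × Cn m)

/-- The coordinates are biholomorphic and `S` is `{z' = 0}` on their domain. -/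
structure IsSubmanifoldCoord {n k m : ℕ} (S : Set (Cn n)) (e : Coord n k m) : Prop where
  holo : DifferentiableOn ℂ e e.source
  holo_symm : DifferentiableOn ℂ e.symm e.target
  mem_iff : ∀ y ∈ e.source, y ∈ S ↔ (e y).1 = 0

/-- Adapted coordinates: their domain lies in `D`, there `S = {z' = 0}` and
`G = log |z'|² + γ` with `γ` continuous (so `G = -∞` exactly on `S`). -/
structure IsAdaptedCoord {n k m : ℕ} (D S : Set (Cn n)) (G : Cn n → EReal) (e : Coord n k m) :
    Prop extends IsSubmanifoldCoord S e where
  source_subset : e.source ⊆ D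
  green : ∃ γ : Cn n → ℝ, ContinuousOn γ e.source ∧ ∀ y ∈ e.source,
    G y = ENNReal.log (ENNReal.ofReal (‖(e y).1‖ ^ 2)) + (γ y : EReal)

/-- `G` is a Green-type function on `D` with poles along `S`; in particular `S` is a complex
submanifold of dimension `m` and codimension `k`. -/
structure IsGreenType {n : ℕ} (k m : ℕ) (D S : Set (Cn n)) (G : Cn n → EReal) : Prop where
  neg : ∀ z ∈ D, G z < 0
  psh : IsPSHOn G D
  finite : ∀ z ∈ D \ S, G z ≠ ⊥
  cont : ContinuousOn G (D \ S)
  coord : ∀ x ∈ S, ∃ e : Coord n k m, x ∈ e.source ∧ IsAdaptedCoord D S G e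

/-- `U` is a coordinate neighbourhood of the point `x` of `S`, relatively compact in the domain of
the adapted coordinates `e`. -/
structure IsAdaptedNhd {n k m : ℕ} (D S : Set (Cn n)) (G : Cn n → EReal) (e : Coord n k m)
    (U : Set (Cn n)) (x : Cn n) : Prop where
  adapted : IsAdaptedCoord D S G e
  isOpen : IsOpen U
  compact_closure : IsCompact (closure U)
  closure_subset : closure U ⊆ e.source
  mem : x ∈ U
  mem_S : x ∈ S

/-- The slice `U_x = {q ∈ U : z''(q) = z''(x)}`. -/
def slice {n k m : ℕ} (e : Coord n k m) (U : Set (Cn n)) (x : Cn n) : Set (Cn n) :=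
  {q ∈ U | (e q).2 = (e x).2}

/-! ### Volume forms -/

/-- The Gram determinant of a family of vectors of `ℂⁿ`; for `n` vectors it is `|det|²`. -/
def gramDet {n : ℕ} {ι : Type} [Fintype ι] [DecidableEq ι] (v : ι → Cn n) : ℝ :=
  (Matrix.gram ℂ v).det.re

/-- The density of `dV_{ℂⁿ}` with respect to `dλ(z') dλ(z'')` at the point with coordinates `w`:
the squared modulus of the complex Jacobian determinant of the inverse of `e`. -/
def ambientDensity {n k m : ℕ} (e : Coord n k m) (w : Cn k × Cn m) : ℝ :=
  gramDet (fun s : Fin k ⊕ Fin m => fderiv ℂ e.symm w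
    (Sum.elim (fun i => (EuclideanSpace.single i (1 : ℂ), (0 : Cn m)))
      (fun j => ((0 : Cn k), EuclideanSpace.single j (1 : ℂ))) s))

/-- The density of `dV_S` with respect to `dλ(z'')` at the point `(0, w)` of `S`. The square root
of the Gram determinant of the `2m` real coordinate vectors is the complex Gram determinant. -/
def subDensity {n k m : ℕ} (e : Coord n k m) (w : Cn m) : ℝ :=
  gramDet (fun j : Fin m => fderiv ℂ e.symm ((0 : Cn k), w)
    ((0 : Cn k), EuclideanSpace.single j (1 : ℂ)))

/-- The volume measure of `S` on the part of `S` in the domain of the coordinates `e`. -/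
def chartVolume {n k m : ℕ} (e : Coord n k m) : Measure (Cn n) :=
  Measure.map (fun w : Cn m => e.symm (0, w))
    ((volume.restrict {w : Cn m | ((0 : Cn k), w) ∈ e.target}).withDensity
      (fun w => ENNReal.ofReal (subDensity e w)))

/-- `dV_S`, the volume measure on `S` of the metric induced by `ℂⁿ`, as a measure on `ℂⁿ`
carried by `S`. The measures `chartVolume e` are its restrictions to the coordinate patches of `S`,
which cover `S`, so it is the least measure above all of them. -/
def subVolume {n : ℕ} (k m : ℕ) (S : Set (Cn n)) : Measure (Cn n) :=
  ⨆ (e : Coord n k m) (_ : IsSubmanifoldCoord S e), chartVolume e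

/-- `dV_{U_x}`, as a measure on `ℂⁿ` carried by the slice `U_x`: the measure `A dλ(z')` for which
`dV_{U_x}(z') · dV_S(z'') = dV_{ℂⁿ}`. -/
def sliceVolume {n k m : ℕ} (e : Coord n k m) (U : Set (Cn n)) (x : Cn n) : Measure (Cn n) :=
  Measure.map (fun w : Cn k => e.symm (w, (e x).2))
    ((volume.restrict {w : Cn k | (w, (e x).2) ∈ e.target ∧ e.symm (w, (e x).2) ∈ U}).withDensity
      (fun w => ENNReal.ofReal (ambientDensity e (w, (e x).2) / subDensity e (e x).2)))

/-! ### The bundle `J^{(p-1)}` -/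

/-- The ring `𝒪_x` of germs of holomorphic functions at `x`. -/
def holGerm {n : ℕ} (x : Cn n) : Subring (Germ (𝓝 x) ℂ) where
  carrier := {a | ∃ F : Cn n → ℂ, AnalyticAt ℂ F x ∧ (F : Germ (𝓝 x) ℂ) = a}
  mul_mem' := by
    rintro _ _ ⟨F, hF, rfl⟩ ⟨H, hH, rfl⟩
    exact ⟨F * H, hF.mul hH, rfl⟩
  one_mem' := ⟨1, analyticAt_const, rfl⟩
  add_mem' := by
    rintro _ _ ⟨F, hF, rfl⟩ ⟨H, hH, rfl⟩
    exact ⟨F + H, hF.add hH, rfl⟩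
  zero_mem' := ⟨0, analyticAt_const, rfl⟩
  neg_mem' := by
    rintro _ ⟨F, hF, rfl⟩
    exact ⟨-F, hF.neg, rfl⟩

/-- The stalk at `x` of the ideal sheaf of holomorphic functions vanishing on `S`. -/
def idealStalk {n : ℕ} (S : Set (Cn n)) (x : Cn n) : Ideal (holGerm x) where
  carrier := {a | ∃ F : Cn n → ℂ, (F : Germ (𝓝 x) ℂ) = a.1 ∧ ∀ᶠ y in 𝓝 x, y ∈ S → F y = 0}
  add_mem' := by
    rintro a b ⟨F, hF, hF'⟩ ⟨H, hH, hH'⟩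
    refine ⟨F + H, by simp [← hF, ← hH], ?_⟩
    filter_upwards [hF', hH'] with y h1 h2 hy
    simp [h1 hy, h2 hy]
  zero_mem' := ⟨0, rfl, Eventually.of_forall fun _ _ => rfl⟩
  smul_mem' := by
    rintro ⟨_, F, hF, rfl⟩ b ⟨H, hH, hH'⟩
    refine ⟨F * H, by simp [← hH], ?_⟩
    filter_upwards [hH'] with y h hy
    simp [h hy]

/-- The fibre at `x` of `J^{(p-1)} = I_S^{p-1} / I_S^p`, i.e. its stalk modulo the maximal ideal
`𝔪_x` (the germs vanishing at `x`): `I_{S,x}^{p-1} / (I_{S,x}^p + 𝔪_x I_{S,x}^{p-1})`. -/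
abbrev JetFibre {n : ℕ} (S : Set (Cn n)) (p : ℕ) (x : Cn n) : Type :=
  ↥(idealStalk S x ^ (p - 1)) ⧸
    Submodule.comap (Submodule.subtype (idealStalk S x ^ (p - 1)))
      (idealStalk S x ^ p ⊔ idealStalk {x} x * idealStalk S x ^ (p - 1))

/-- The germ of `F` at `x` is holomorphic, belongs to `I_S^{p-1}`, and its class in the fibre of
`J^{(p-1)}` at `x` is `f`. -/
def Represents {n : ℕ} (S : Set (Cn n)) (p : ℕ) (x : Cn n) (F : Cn n → ℂ) (f : JetFibre S p x) :
    Prop :=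
  ∃ a : ↥(idealStalk S x ^ (p - 1)), (F : Germ (𝓝 x) ℂ) = a.1.1 ∧ Submodule.Quotient.mk a = f

/-- The function `P(z₁, …, z_k)`, for a polynomial `P`. -/
def coordPoly {n k m : ℕ} (e : Coord n k m) (P : MvPolynomial (Fin k) ℂ) (y : Cn n) : ℂ :=
  MvPolynomial.eval (fun i => (e y).1 i) P

/-- `f ∈ J_x^{(p-1)}` corresponds to the homogeneous polynomial `P` of degree `p - 1` in
`z₁, …, z_k`. -/
def CorrespondsTo {n k m : ℕ} (S : Set (Cn n)) (p : ℕ) (e : Coord n k m) (x : Cn n)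
    (f : JetFibre S p x) (P : MvPolynomial (Fin k) ℂ) : Prop :=
  P.IsHomogeneous (p - 1) ∧ Represents S p x (coordPoly e P) f

/-- A smooth section of `J^{(p-1)}` over `S` (the values off `S` play no role): in the local
frames given by the monomials of degree `p - 1` in `z'`, its coefficients are smooth. -/
def IsSmoothSection {n : ℕ} (k m : ℕ) (S : Set (Cn n)) (p : ℕ) (f : ∀ x, JetFibre S p x) : Prop :=
  ∀ x₀ ∈ S, ∃ e : Coord n k m, x₀ ∈ e.source ∧ IsSubmanifoldCoord S e ∧
    ∃ P : Cn n → MvPolynomial (Fin k) ℂ,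
      (∀ x ∈ e.source ∩ S, CorrespondsTo S p e x (f x) (P x)) ∧
      ∀ α : Fin k →₀ ℕ, ContDiffOn ℝ ∞ (fun w : Cn m => (P (e.symm (0, w))).coeff α)
        {w : Cn m | ((0 : Cn k), w) ∈ e.target}

/-- `F` is a smooth function on `D` extending the section `f`: at each `x ∈ S` it agrees with a
representative of `f x` up to `o(|y - x|^{p-1})`. -/
def IsSmoothExtension {n : ℕ} (D S : Set (Cn n)) (p : ℕ) (f : ∀ x, JetFibre S p x)
    (F : Cn n → ℂ) : Prop :=
  ContDiffOn ℝ ∞ F D ∧ ∀ x ∈ S, ∃ H : Cn n → ℂ, Represents S p x H (f x) ∧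
    (fun y => F y - H y) =o[𝓝 x] fun y => ‖y - x‖ ^ (p - 1)

/-! ### The metric -/

/-- `f ḡ e^{-φ-(p+k-1)G}`. -/
def integrand {n : ℕ} (k p : ℕ) (G : Cn n → EReal) (φ : Cn n → ℝ) (f g : Cn n → ℂ)
    (y : Cn n) : ℂ :=
  f y * conj (g y) * (Real.exp (-φ y - ((p : ℝ) + k - 1) * (G y).toReal) : ℂ)

/-- The shell `{t < G < t + 1}`. -/
def shell {n : ℕ} (G : Cn n → EReal) (t : ℝ) : Set (Cn n) :=
  {y | (t : EReal) < G y ∧ G y < ((t + 1 : ℝ) : EReal)}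

/-- `∫_{t < G < t+1} f ḡ e^{-φ-(p+k-1)G} dμ` converges absolutely for `t` near `-∞` and tends to
`c` as `t → -∞`. -/
def HasShellLimit {n : ℕ} (k p : ℕ) (G : Cn n → EReal) (φ : Cn n → ℝ) (μ : Measure (Cn n))
    (f g : Cn n → ℂ) (c : ℂ) : Prop :=
  (∀ᶠ t : ℝ in atBot, IntegrableOn (integrand k p G φ f g) (shell G t) μ) ∧
    Tendsto (fun t : ℝ => ∫ y in shell G t, integrand k p G φ f g y ∂μ) atBot (𝓝 c)

/-- `⟨f, g⟩` for `f, g ∈ J_x^{(p-1)}`: the limit computed in some adapted coordinates at `x`. -/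
def jetInner {n : ℕ} (k m : ℕ) (D S : Set (Cn n)) (G : Cn n → EReal) (φ : Cn n → ℝ) (p : ℕ)
    (x : Cn n) (f g : JetFibre S p x) : ℂ :=
  Classical.epsilon fun c : ℂ =>
    ∃ (e : Coord n k m) (U : Set (Cn n)) (P Q : MvPolynomial (Fin k) ℂ),
      IsAdaptedNhd D S G e U x ∧ CorrespondsTo S p e x f P ∧ CorrespondsTo S p e x g Q ∧
      HasShellLimit k p G φ (sliceVolume e U x) (coordPoly e P) (coordPoly e Q) c

end JetMetric

end

/-!
On a slice, `e^G = e^γ |z'|²`. The dilation `u ↦ e^{t/2} u` of `ℂᵏ` turns the shell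
`{t < G < t + 1}` into a set that converges to `{1 < N < e}`, where `N(u) = e^{γ(x)} |u|²`. The
integrand is `|z'|^{-2k}` times a bounded function, so its integrals over the shells are uniformly
bounded, `o(1)` relative errors disappear in the limit, and the limit is the density of `dV_{U_x}`
at `x` times `e^{-φ(x)} ∫_{1 < N < e} P Q̄ N^{-(p+k-1)} dλ`. This is (1) and (2).

For (3), the transverse derivative `L` at `x` of a change of adapted coordinates carries one
function `N` to the other, because both sides compute `e^G` to leading order, and `|det L|²` is the
ratio of the two densities; the linear substitution `L` therefore identifies the two limits.

In a box of adapted coordinates, (4) follows from (2) on each slice by Fubini's theorem and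
dominated convergence, the uniform bound being the dominating constant; a partition of unity sums
the boxes.
-/

noncomputable section

namespace JetMetric

/-! ### Osgood's lemma -/

section Osgood

variable {F : Type*} [NormedAddCommGroup F] [NormedSpace ℂ F]

theorem dist_torusMap {N : ℕ} (c : Fin N → ℂ) (R θ : Fin N → ℝ) (i : Fin N) :
    dist (torusMap c R θ i) (c i) = |R i| :=
  circleMap_mem_sphere' (c i) (R i) (θ i)

theorem continuous_torusMap {N : ℕ} (c : Fin N → ℂ) (R : Fin N → ℝ) : Continuous (torusMap c R) :=
  continuous_pi fun i => (continuous_circleMap (c i) (R i)).comp (continuous_apply i)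

theorem torusMap_mem_closedBall {N : ℕ} {r : ℝ} (hr : 0 ≤ r) (c : Fin N → ℂ) (θ : Fin N → ℝ) :
    torusMap c (fun _ => r) θ ∈ Metric.closedBall c r :=
  (dist_pi_le_iff hr).2 fun i => (dist_torusMap c _ θ i).trans_le (abs_of_nonneg hr).le

theorem torusMap_sub_ne_zero {N : ℕ} {r : ℝ} {c z : Fin N → ℂ} (hz : z ∈ Metric.ball c r)
    (θ : Fin N → ℝ) (i : Fin N) : torusMap c (fun _ => r) θ i - z i ≠ 0 := by
  intro h
  have hlt : dist (z i) (c i) < r := (dist_le_pi_dist z c i).trans_lt hz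
  rw [← sub_eq_zero.1 h, dist_torusMap] at hlt
  exact (le_abs_self r).not_gt hlt

theorem torusIntegrable_prod_sub_inv_smul {N : ℕ} {r : ℝ} (hr : 0 ≤ r) {c z : Fin N → ℂ}
    {f : (Fin N → ℂ) → F} (hf : ContinuousOn f (Metric.closedBall c r))
    (hz : z ∈ Metric.ball c r) :
    TorusIntegrable (fun ζ => (∏ i, (ζ i - z i))⁻¹ • f ζ) c (fun _ => r) := by
  have hcm := continuous_torusMap c (fun _ => r)
  refine ContinuousOn.integrableOn_compact isCompact_Icc (Continuous.continuousOn ?_)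
  refine (Continuous.inv₀ (by fun_prop) fun θ => ?_).smul
    (hf.comp_continuous hcm (torusMap_mem_closedBall hr c))
  exact Finset.prod_ne_zero_iff.2 fun i _ => torusMap_sub_ne_zero hz θ i

theorem finCons_mem_closedBall {N : ℕ} {r : ℝ} (hr : 0 ≤ r) {c : Fin (N + 1) → ℂ} {x : ℂ}
    {y : Fin N → ℂ} : (Fin.cons x y : Fin (N + 1) → ℂ) ∈ Metric.closedBall c r ↔
      x ∈ Metric.closedBall (c 0) r ∧ y ∈ Metric.closedBall (c ∘ Fin.succ) r := by
  simp only [Metric.mem_closedBall, dist_pi_le_iff hr, Fin.forall_fin_succ, Fin.cons_zero,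
    Fin.cons_succ, Function.comp]

theorem torusIntegral_prod_sub_inv_smul [CompleteSpace F] {r : ℝ} (hr : 0 < r) {N : ℕ}
    {c z : Fin N → ℂ} {f : (Fin N → ℂ) → F} (hf : DifferentiableOn ℂ f (Metric.closedBall c r))
    (hz : z ∈ Metric.ball c r) :
    (∯ ζ in T(c, fun _ => r), (∏ i, (ζ i - z i))⁻¹ • f ζ) =
      (2 * Real.pi * Complex.I : ℂ) ^ N • f z := by
  induction N with
  | zero => simp [torusIntegral_dim0, Subsingleton.elim c z]
  | succ N ih =>
    have hz₀ : z 0 ∈ Metric.ball (c 0) r := (dist_le_pi_dist z c 0).trans_lt hz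
    have hz' : z ∘ Fin.succ ∈ Metric.ball (c ∘ Fin.succ) r :=
      (dist_pi_lt_iff hr).2 fun i => (dist_le_pi_dist z c i.succ).trans_lt hz
    have inner_integral : ∀ x ∈ Metric.sphere (c 0) r,
        (∯ y in T(c ∘ Fin.succ, fun _ => r),
          (∏ i, ((Fin.cons x y : Fin (N + 1) → ℂ) i - z i))⁻¹ • f (Fin.cons x y)) =
        (x - z 0)⁻¹ • ((2 * Real.pi * Complex.I : ℂ) ^ N • f (Fin.cons x (z ∘ Fin.succ))) := by
      intro x hx
      have hfx : DifferentiableOn ℂ (fun y : Fin N → ℂ => f (Fin.cons x y))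
          (Metric.closedBall (c ∘ Fin.succ) r) :=
        hf.comp (by fun_prop) fun y hy =>
          (finCons_mem_closedBall hr.le).2 ⟨Metric.sphere_subset_closedBall hx, hy⟩
      rw [← ih hfx hz', ← torusIntegral_smul]
      simp only [Fin.prod_univ_succ, Fin.cons_zero, Fin.cons_succ, mul_inv, mul_smul,
        Function.comp]
    have outer_differentiable : DifferentiableOn ℂ
        (fun x => (2 * Real.pi * Complex.I : ℂ) ^ N • f (Fin.cons x (z ∘ Fin.succ)))
        (Metric.closedBall (c 0) r) := by
      refine DifferentiableOn.const_smul (hf.comp (by fun_prop) fun x hx => ?_) _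
      exact (finCons_mem_closedBall hr.le).2 ⟨hx, Metric.ball_subset_closedBall hz'⟩
    rw [torusIntegral_succ (torusIntegrable_prod_sub_inv_smul hr.le hf.continuousOn hz)]
    refine (circleIntegral.integral_congr hr.le inner_integral).trans ?_
    rw [(outer_differentiable.diffContOnCl_ball subset_rfl).circleIntegral_sub_inv_smul hz₀,
      smul_smul, ← pow_succ']
    exact congrArg _ (congrArg f (Fin.cons_self_tail z))

/-- Integration against a fixed continuous function on a compact space, as a continuous linear map
on scalar functions. -/
def integralSMulCLM {K : Type*} [TopologicalSpace K] [CompactSpace K] [MeasurableSpace K]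
    [BorelSpace K] (μ : Measure K) [IsFiniteMeasure μ] (h : C(K, F)) : C(K, ℂ) →L[ℂ] F :=
  have hint (g : C(K, ℂ)) : Integrable (fun θ => g θ • h θ) μ :=
    (g.continuous.smul h.continuous).integrable_of_hasCompactSupport (.of_compactSpace _)
  LinearMap.mkContinuous
    { toFun g := ∫ θ, g θ • h θ ∂μ
      map_add' g g' := by
        simp only [ContinuousMap.add_apply, add_smul]
        exact integral_add (hint g) (hint g')
      map_smul' a g := by
        simp only [ContinuousMap.smul_apply, smul_assoc, RingHom.id_apply, integral_smul] }
    (‖h‖ * μ.real Set.univ) fun g => by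
      refine (norm_integral_le_of_norm_le_const (C := ‖g‖ * ‖h‖) ?_).trans (le_of_eq (by ring))
      refine Eventually.of_forall fun θ => ?_
      rw [norm_smul]
      exact mul_le_mul (g.norm_coe_le_norm θ) (h.norm_coe_le_norm θ) (norm_nonneg _) (norm_nonneg _)

/-- The parameter domain of the torus integrals. -/
abbrev TorusAngles (N : ℕ) : Type := Set.Icc (0 : Fin N → ℝ) (fun _ => 2 * Real.pi)

/-- The `i`-th coordinate on the torus of centre `c` and radius `r`. -/
def torusCoord {N : ℕ} (c : Fin N → ℂ) (r : ℝ) (i : Fin N) : C(TorusAngles N, ℂ) :=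
  ⟨fun θ => torusMap c (fun _ => r) θ i, by
    have := continuous_torusMap c (fun _ => r)
    fun_prop⟩

/-- The Cauchy kernel `z ↦ ∏ (ζᵢ - zᵢ)⁻¹` of a polydisc, as a map into the Banach algebra of
continuous functions on the torus: there it is analytic in `z`, since inversion is. -/
def cauchyKernel {N : ℕ} (c : Fin N → ℂ) (r : ℝ) (z : Fin N → ℂ) : C(TorusAngles N, ℂ) :=
  ∏ i, Ring.inverse (torusCoord c r i - algebraMap ℂ C(TorusAngles N, ℂ) (z i))

theorem isUnit_torusCoord_sub {N : ℕ} {r : ℝ} {c z : Fin N → ℂ} (hz : z ∈ Metric.ball c r)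
    (i : Fin N) : IsUnit (torusCoord c r i - algebraMap ℂ C(TorusAngles N, ℂ) (z i)) :=
  (ContinuousMap.isUnit_iff_forall_ne_zero _).2 fun θ => torusMap_sub_ne_zero hz θ i

theorem cauchyKernel_apply {N : ℕ} {r : ℝ} {c z : Fin N → ℂ} (hz : z ∈ Metric.ball c r)
    (θ : TorusAngles N) :
    cauchyKernel c r z θ = (∏ i, (torusMap c (fun _ => r) θ i - z i))⁻¹ := by
  rw [cauchyKernel, ContinuousMap.prod_apply, ← Finset.prod_inv_distrib]
  refine Finset.prod_congr rfl fun i _ => eq_inv_of_mul_eq_one_right ?_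
  exact congrArg (fun u : C(TorusAngles N, ℂ) => u θ)
    (Ring.mul_inverse_cancel _ (isUnit_torusCoord_sub hz i))

theorem analyticAt_cauchyKernel {N : ℕ} {r : ℝ} {c z : Fin N → ℂ} (hz : z ∈ Metric.ball c r) :
    AnalyticAt ℂ (cauchyKernel c r) z := by
  refine Finset.analyticAt_fun_prod _ fun i _ => ?_
  obtain ⟨u, hu⟩ := isUnit_torusCoord_sub hz i
  have inverse_analytic : AnalyticAt ℂ Ring.inverse
      (torusCoord c r i - algebraMap ℂ C(TorusAngles N, ℂ) (z i)) := hu ▸ analyticAt_inverse u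
  have constant_analytic : AnalyticAt ℂ
      (fun z : Fin N → ℂ => algebraMap ℂ C(TorusAngles N, ℂ) (z i)) z :=
    ((Algebra.linearMap ℂ C(TorusAngles N, ℂ)).toContinuousLinearMap.comp
      (ContinuousLinearMap.proj (R := ℂ) (φ := fun _ : Fin N => ℂ) i)).analyticAt z
  exact inverse_analytic.comp (f := fun z : Fin N → ℂ => torusCoord c r i -
    algebraMap ℂ C(TorusAngles N, ℂ) (z i)) (analyticAt_const.sub constant_analytic)

theorem analyticAt_pi_of_differentiableOn [CompleteSpace F] {N : ℕ} {f : (Fin N → ℂ) → F}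
    {s : Set (Fin N → ℂ)} {c : Fin N → ℂ} (hf : DifferentiableOn ℂ f s) (hs : s ∈ 𝓝 c) :
    AnalyticAt ℂ f c := by
  obtain ⟨r, hr, hrs⟩ := Metric.nhds_basis_closedBall.mem_iff.1 hs
  have hfr := hf.mono hrs
  let μ : Measure (TorusAngles N) := volume.comap Subtype.val
  have : IsFiniteMeasure μ := ⟨by
    rw [comap_subtype_coe_apply measurableSet_Icc, Subtype.coe_image_univ]
    exact isCompact_Icc.measure_lt_top⟩
  let h : C(TorusAngles N, F) :=
    ⟨fun θ => (∏ i, r * Complex.exp (θ.1 i * Complex.I) * Complex.I) •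
      f (torusMap c (fun _ => r) θ.1),
      ((by fun_prop : Continuous fun θ : Fin N → ℝ =>
        ∏ i, (r : ℂ) * Complex.exp (θ i * Complex.I) * Complex.I).comp
          continuous_subtype_val).smul (hfr.continuousOn.comp_continuous
        ((continuous_torusMap c fun _ => r).comp continuous_subtype_val)
        fun θ => torusMap_mem_closedBall hr.le c θ.1)⟩
  have cauchy_integral_analytic : AnalyticAt ℂ (fun z => ((2 * Real.pi * Complex.I : ℂ) ^ N)⁻¹ •
      integralSMulCLM μ h (cauchyKernel c r z)) c :=
    ((integralSMulCLM μ h).analyticAt _ |>.comp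
      (analyticAt_cauchyKernel (Metric.mem_ball_self hr))).const_smul
  refine cauchy_integral_analytic.congr ?_
  filter_upwards [Metric.ball_mem_nhds c hr] with z hz
  rw [inv_smul_eq_iff₀ (pow_ne_zero _ Complex.two_pi_I_ne_zero),
    ← torusIntegral_prod_sub_inv_smul hr hfr hz, torusIntegral,
    ← integral_subtype_comap measurableSet_Icc]
  refine integral_congr_ae (Eventually.of_forall fun θ => ?_)
  exact (congrArg (· • h θ) (cauchyKernel_apply hz θ)).trans (smul_comm _ _ _)

theorem analyticAt_of_differentiableOn [CompleteSpace F] {E : Type*} [NormedAddCommGroup E]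
    [NormedSpace ℂ E] [FiniteDimensional ℂ E] {f : E → F} {s : Set E} {c : E}
    (hf : DifferentiableOn ℂ f s) (hs : s ∈ 𝓝 c) : AnalyticAt ℂ f c := by
  let L : E ≃L[ℂ] (Fin (Module.finrank ℂ E) → ℂ) :=
    ContinuousLinearEquiv.ofFinrankEq (by simp)
  have coord_analytic : AnalyticAt ℂ (f ∘ L.symm) (L c) :=
    analyticAt_pi_of_differentiableOn (hf.comp L.symm.differentiableOn (Set.mapsTo_preimage _ _))
      (L.symm.continuous.continuousAt.preimage_mem_nhds (by simpa using hs))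
  simpa [Function.comp_def] using coord_analytic.comp (L.analyticAt c)

end Osgood

/-! ### Integrals over thin shells around the origin -/

section Shell

variable {E : Type*} [NormedAddCommGroup E]

/-- The shell `{t < g < t + 1}` in the punctured region `W \ {0}` of a vector space. -/
def vshell (W : Set E) (g : E → ℝ) (t : ℝ) : Set E :=
  {w | w ∈ W ∧ w ≠ 0 ∧ t < g w ∧ g w < t + 1}

theorem measurableSet_vshell_log [MeasurableSpace E] [BorelSpace E] (γ t : ℝ) :
    MeasurableSet (vshell Set.univ (fun w : E => 2 * Real.log ‖w‖ + γ) t) := by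
  have hm : Measurable fun w : E => 2 * Real.log ‖w‖ + γ := by fun_prop
  have shell_eq : vshell Set.univ (fun w : E => 2 * Real.log ‖w‖ + γ) t =
      {0}ᶜ ∩ ((fun w : E => 2 * Real.log ‖w‖ + γ) ⁻¹' Set.Ioo t (t + 1)) := by
    ext w
    simp [vshell]
  rw [shell_eq]
  exact (measurableSet_singleton _).compl.inter (hm measurableSet_Ioo)

theorem norm_mem_Icc_of_mem_vshell {W : Set E} {g : E → ℝ} {γ C t : ℝ} {w : E}
    (hw : w ∈ vshell W g t) (hC : |g w - 2 * Real.log ‖w‖ - γ| ≤ C) :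
    ‖w‖ ∈ Set.Icc (Real.exp ((t - γ - C) / 2)) (Real.exp ((t + 1 - γ + C) / 2)) := by
  obtain ⟨-, hw0, hlow, hupp⟩ := hw
  have hn : 0 < ‖w‖ := norm_pos_iff.2 hw0
  rw [abs_le] at hC
  constructor
  · rw [← Real.le_log_iff_exp_le hn]
    linarith
  · rw [← Real.log_le_iff_le_exp hn]
    linarith

theorem tendsto_vshell_smallSets {W : Set E} {g : E → ℝ} {C : ℝ}
    (hlow : ∀ w ∈ W, w ≠ 0 → 2 * Real.log ‖w‖ - C ≤ g w) :
    Tendsto (vshell W g) atBot (𝓝[≠] 0).smallSets := by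
  refine tendsto_smallSets_iff.2 fun s hs => ?_
  obtain ⟨δ, hδ, hs⟩ := Metric.mem_nhdsWithin_iff.1 hs
  filter_upwards [eventually_le_atBot (2 * Real.log δ - 1 - C)] with t ht w hw
  refine hs ⟨?_, hw.2.1⟩
  have := hlow w hw.1 hw.2.1
  rw [mem_ball_zero_iff, ← Real.log_lt_log_iff (norm_pos_iff.2 hw.2.1) hδ]
  linarith [hw.2.2.2]

variable [NormedSpace ℝ E]

theorem two_mul_log_norm_exp_smul (t : ℝ) {u : E} (hu : u ≠ 0) :
    2 * Real.log ‖Real.exp (t / 2) • u‖ = t + 2 * Real.log ‖u‖ := by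
  rw [norm_smul, Real.norm_eq_abs, Real.abs_exp, Real.log_mul (Real.exp_ne_zero _)
    (norm_ne_zero_iff.2 hu), Real.log_exp]
  ring

theorem tendsto_exp_smul_atBot {u : E} (hu : u ≠ 0) :
    Tendsto (fun t : ℝ => Real.exp (t / 2) • u) atBot (𝓝[≠] 0) := by
  refine tendsto_nhdsWithin_iff.2 ⟨?_, Eventually.of_forall fun t => by simp [hu]⟩
  have exp_tendsto : Tendsto (fun t : ℝ => Real.exp (t / 2)) atBot (𝓝 0) :=
    Real.tendsto_exp_atBot.comp (tendsto_id.atBot_div_const two_pos)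
  simpa using exp_tendsto.smul_const u

theorem tendsto_comp_exp_smul_sub {g : E → ℝ} {γ : ℝ}
    (hg : Tendsto (fun w => g w - 2 * Real.log ‖w‖) (𝓝[≠] 0) (𝓝 γ)) {u : E} (hu : u ≠ 0) :
    Tendsto (fun t : ℝ => g (Real.exp (t / 2) • u) - t) atBot (𝓝 (2 * Real.log ‖u‖ + γ)) := by
  have hlim := (hg.comp (tendsto_exp_smul_atBot hu)).add_const (2 * Real.log ‖u‖)
  rw [add_comm γ] at hlim
  refine hlim.congr fun t => ?_
  simp only [Function.comp, two_mul_log_norm_exp_smul t hu]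
  ring

section Rescaling

variable {W : Set E} {g : E → ℝ} {Θ Θ₀ : E → ℂ} {γ : ℝ} {d : ℕ}

/-- The integrand `1_{t < g < t + 1} Θ` pulled back by the dilation `u ↦ e^{t/2} u` together with
the Jacobian of the latter in real dimension `d`; the dilation turns the shell
`{t < log |w|² < t + 1}` into a fixed one. -/
def rescaledShell (W : Set E) (g : E → ℝ) (Θ : E → ℂ) (d : ℕ) (t : ℝ) (u : E) : ℂ :=
  (Real.exp (t / 2) ^ d : ℝ) • (vshell W g t).indicator Θ (Real.exp (t / 2) • u)

theorem norm_rescaledShell_le {M C t : ℝ}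
    (hC : ∀ w ∈ vshell W g t, |g w - 2 * Real.log ‖w‖ - γ| ≤ C)
    (hM : ∀ w ∈ vshell W g t, ‖w‖ ^ d * ‖Θ w‖ ≤ M) (hM0 : 0 ≤ M) (u : E) :
    ‖rescaledShell W g Θ d t u‖ ≤ (Metric.closedBall (0 : E) (Real.exp ((1 - γ + C) / 2))).indicator
      (fun _ => M / Real.exp ((-γ - C) / 2) ^ d) u := by
  by_cases hu : Real.exp (t / 2) • u ∈ vshell W g t
  · have exp_split (s : ℝ) : Real.exp ((t + s) / 2) = Real.exp (t / 2) * Real.exp (s / 2) := by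
      rw [add_div, Real.exp_add]
    obtain ⟨hlow, hupp⟩ := norm_mem_Icc_of_mem_vshell hu (hC _ hu)
    rw [norm_smul, Real.norm_eq_abs, Real.abs_exp] at hlow hupp
    rw [show t - γ - C = t + (-γ - C) by ring, exp_split] at hlow
    rw [show t + 1 - γ + C = t + (1 - γ + C) by ring, exp_split] at hupp
    have hlow := le_of_mul_le_mul_left hlow (Real.exp_pos _)
    have hupp := le_of_mul_le_mul_left hupp (Real.exp_pos _)
    have hMu := hM _ hu
    rw [norm_smul, Real.norm_eq_abs, Real.abs_exp, mul_pow, mul_right_comm] at hMu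
    rw [Set.indicator_of_mem (mem_closedBall_zero_iff.2 hupp), rescaledShell,
      Set.indicator_of_mem hu, norm_smul, norm_pow, Real.norm_eq_abs, Real.abs_exp,
      le_div_iff₀ (by positivity)]
    exact le_trans (by gcongr) hMu
  · rw [rescaledShell, Set.indicator_of_notMem hu, smul_zero, norm_zero]
    exact Set.indicator_nonneg (fun _ _ => by positivity) _

theorem tendsto_rescaledShell_of_mem (hW : W ∈ 𝓝 0)
    (hg : Tendsto (fun w => g w - 2 * Real.log ‖w‖) (𝓝[≠] 0) (𝓝 γ))
    (hom : ∀ s : ℝ, 0 < s → ∀ w, w ≠ 0 → (s ^ d : ℝ) • Θ₀ (s • w) = Θ₀ w)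
    (hdiff : Tendsto (fun w => (‖w‖ ^ d : ℝ) • (Θ w - Θ₀ w)) (𝓝[≠] 0) (𝓝 0)) {u : E}
    (hu : u ∈ vshell Set.univ (fun w : E => 2 * Real.log ‖w‖ + γ) 0) :
    Tendsto (fun t => rescaledShell W g Θ d t u) atBot (𝓝 (Θ₀ u)) := by
  obtain ⟨-, hu0, hlow, hupp⟩ := hu
  have hscale := tendsto_exp_smul_atBot hu0
  have hlevel := tendsto_comp_exp_smul_sub hg hu0
  have eventually_mem : ∀ᶠ t : ℝ in atBot, Real.exp (t / 2) • u ∈ vshell W g t := by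
    filter_upwards [hlevel.eventually (eventually_gt_nhds hlow),
      hlevel.eventually (eventually_lt_nhds hupp), hscale.eventually (nhdsWithin_le_nhds hW)]
      with t h_low h_upp h_mem
    exact ⟨h_mem, by simp [hu0], by linarith, by linarith⟩
  have error_tendsto : Tendsto (fun t : ℝ => ((‖u‖ ^ d)⁻¹ : ℝ) • ((‖Real.exp (t / 2) • u‖ ^ d : ℝ) •
      (Θ (Real.exp (t / 2) • u) - Θ₀ (Real.exp (t / 2) • u))) + Θ₀ u) atBot (𝓝 (Θ₀ u)) := by
    simpa using ((hdiff.comp hscale).const_smul ((‖u‖ ^ d)⁻¹ : ℝ)).add_const (Θ₀ u)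
  refine error_tendsto.congr' ?_
  filter_upwards [eventually_mem] with t ht
  rw [rescaledShell, Set.indicator_of_mem ht, smul_smul, norm_smul, mul_pow, Real.norm_eq_abs,
    Real.abs_exp, mul_comm (Real.exp (t / 2) ^ d),
    inv_mul_cancel_left₀ (pow_ne_zero _ (norm_ne_zero_iff.2 hu0)), smul_sub,
    hom _ (Real.exp_pos _) u hu0, sub_add_cancel]

theorem tendsto_rescaledShell_of_notMem
    (hg : Tendsto (fun w => g w - 2 * Real.log ‖w‖) (𝓝[≠] 0) (𝓝 γ)) {u : E} (hu0 : u ≠ 0)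
    (hu : 2 * Real.log ‖u‖ + γ ∉ Set.Icc 0 1) :
    Tendsto (fun t => rescaledShell W g Θ d t u) atBot (𝓝 0) := by
  have hlevel := tendsto_comp_exp_smul_sub hg hu0
  have eventually_notMem : ∀ᶠ t : ℝ in atBot, Real.exp (t / 2) • u ∉ vshell W g t := by
    rcases not_and_or.1 hu with hlt | hgt
    · filter_upwards [hlevel.eventually (eventually_lt_nhds (not_le.1 hlt))] with t ht hmem
      linarith [hmem.2.2.1]
    · filter_upwards [hlevel.eventually (eventually_gt_nhds (not_le.1 hgt))] with t ht hmem
      linarith [hmem.2.2.2]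
  refine tendsto_const_nhds.congr' ?_
  filter_upwards [eventually_notMem] with t ht
  rw [rescaledShell, Set.indicator_of_notMem ht, smul_zero]

end Rescaling

variable [FiniteDimensional ℝ E]

theorem exists_norm_pow_mul_le_of_homogeneous {d : ℕ} {Θ : E → ℂ} (hc : ContinuousOn Θ {0}ᶜ)
    (hom : ∀ s : ℝ, 0 < s → ∀ w, w ≠ 0 → (s ^ d : ℝ) • Θ (s • w) = Θ w) :
    ∃ M, ∀ w, w ≠ 0 → ‖w‖ ^ d * ‖Θ w‖ ≤ M := by
  have : ProperSpace E := FiniteDimensional.proper_real E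
  obtain ⟨M, hM⟩ := (isCompact_sphere (0 : E) 1).exists_bound_of_continuousOn
    (hc.mono fun w hw => ne_zero_of_mem_unit_sphere ⟨w, hw⟩)
  refine ⟨M, fun w hw => ?_⟩
  have hn : 0 < ‖w‖ := norm_pos_iff.2 hw
  have hMw := hM (‖w‖⁻¹ • w) (by simp [norm_smul, hn.ne'])
  rwa [← hom ‖w‖⁻¹ (inv_pos.2 hn) w hw, norm_smul, norm_pow, norm_inv, norm_norm, ← mul_assoc,
    ← mul_pow, mul_inv_cancel₀ hn.ne', one_pow, one_mul]

theorem eventually_norm_pow_mul_le {d : ℕ} {Θ Θ₀ : E → ℂ} (hc : ContinuousOn Θ₀ {0}ᶜ)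
    (hom : ∀ s : ℝ, 0 < s → ∀ w, w ≠ 0 → (s ^ d : ℝ) • Θ₀ (s • w) = Θ₀ w)
    (hdiff : Tendsto (fun w => (‖w‖ ^ d : ℝ) • (Θ w - Θ₀ w)) (𝓝[≠] 0) (𝓝 0)) :
    ∃ M ≥ 0, ∀ᶠ w in 𝓝[≠] (0 : E), ‖w‖ ^ d * ‖Θ w‖ ≤ M := by
  obtain ⟨M, hM⟩ := exists_norm_pow_mul_le_of_homogeneous hc hom
  refine ⟨max (1 + M) 0, le_max_right _ _, ?_⟩
  filter_upwards [Metric.tendsto_nhds.1 hdiff 1 one_pos, self_mem_nhdsWithin] with w hdist hw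
  rw [dist_zero_right, norm_smul, norm_pow, norm_norm] at hdist
  calc ‖w‖ ^ d * ‖Θ w‖ ≤ ‖w‖ ^ d * (‖Θ w - Θ₀ w‖ + ‖Θ₀ w‖) := by
        gcongr
        simpa using norm_add_le (Θ w - Θ₀ w) (Θ₀ w)
    _ = ‖w‖ ^ d * ‖Θ w - Θ₀ w‖ + ‖w‖ ^ d * ‖Θ₀ w‖ := mul_add _ _ _
    _ ≤ 1 + M := add_le_add hdist.le (hM w hw)
    _ ≤ max (1 + M) 0 := le_max_left _ _

variable [MeasurableSpace E] [BorelSpace E] (μ : Measure E) [μ.IsAddHaarMeasure]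

theorem ae_two_mul_log_norm_add_ne [Nontrivial E] (γ s : ℝ) :
    ∀ᵐ u ∂μ, 2 * Real.log ‖u‖ + γ ≠ s := by
  have ae_ne_zero : ∀ᵐ u ∂μ, u ≠ 0 := by simp [ae_iff]
  have ae_notMem_sphere : ∀ᵐ u ∂μ, u ∉ Metric.sphere (0 : E) (Real.exp ((s - γ) / 2)) :=
    measure_eq_zero_iff_ae_notMem.1 (Measure.addHaar_sphere μ _ _)
  filter_upwards [ae_ne_zero, ae_notMem_sphere] with u hu0 hu h
  refine hu (mem_sphere_zero_iff_norm.2 ?_)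
  rw [← Real.exp_log (norm_pos_iff.2 hu0)]
  congr 1
  linarith

section RescaledIntegral

variable {W : Set E} {g : E → ℝ} {Θ : E → ℂ} {t : ℝ}

theorem aestronglyMeasurable_rescaledShell (hmeas : MeasurableSet (vshell W g t))
    (hΘ : AEStronglyMeasurable Θ (μ.restrict (vshell W g t))) (d : ℕ) :
    AEStronglyMeasurable (rescaledShell W g Θ d t) μ := by
  have dilation_qmp :
      Measure.QuasiMeasurePreserving (fun u : E => Real.exp (t / 2) • u) μ μ := by
    refine ⟨measurable_const_smul _, ?_⟩
    rw [Measure.map_addHaar_smul μ (Real.exp_ne_zero _)]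
    exact Measure.smul_absolutelyContinuous
  exact (((aestronglyMeasurable_indicator_iff hmeas).2 hΘ).comp_quasiMeasurePreserving
    dilation_qmp).const_smul (Real.exp (t / 2) ^ d)

theorem integral_rescaledShell (hmeas : MeasurableSet (vshell W g t)) :
    ∫ u, rescaledShell W g Θ (Module.finrank ℝ E) t u ∂μ = ∫ w in vshell W g t, Θ w ∂μ := by
  simp only [rescaledShell]
  rw [integral_smul, Measure.integral_comp_smul, ← integral_indicator hmeas, smul_smul,
    abs_of_pos (by positivity), mul_inv_cancel₀ (by positivity), one_smul]

theorem integrable_rescaledShell_iff (hmeas : MeasurableSet (vshell W g t)) {d : ℕ} :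
    Integrable (rescaledShell W g Θ d t) μ ↔ IntegrableOn Θ (vshell W g t) μ := by
  rw [← integrable_indicator_iff hmeas, ← integrable_comp_smul_iff μ
    ((vshell W g t).indicator Θ) (Real.exp_ne_zero (t / 2))]
  exact integrable_fun_smul_iff (c := Real.exp (t / 2) ^ d) (by positivity)
    fun u => (vshell W g t).indicator Θ (Real.exp (t / 2) • u)

theorem norm_integral_vshell_le (hmeas : MeasurableSet (vshell W g t)) {C M : ℝ} (hM0 : 0 ≤ M)
    (hC : ∀ w ∈ vshell W g t, |g w - 2 * Real.log ‖w‖| ≤ C)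
    (hM : ∀ w ∈ vshell W g t, ‖w‖ ^ Module.finrank ℝ E * ‖Θ w‖ ≤ M) :
    ‖∫ w in vshell W g t, Θ w ∂μ‖ ≤
      M * Real.exp (C + 1 / 2) ^ Module.finrank ℝ E * μ.real (Metric.closedBall 0 1) := by
  have : ProperSpace E := FiniteDimensional.proper_real E
  have exp_ratio : Real.exp (C + 1 / 2) = Real.exp ((1 - 0 + C) / 2) / Real.exp ((-0 - C) / 2) := by
    rw [← Real.exp_sub]
    congr 1
    ring
  rw [← integral_rescaledShell μ hmeas]
  refine (norm_integral_le_of_norm_le ((integrable_indicator_iff measurableSet_closedBall).2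
    (integrableOn_const (isCompact_closedBall _ _).measure_lt_top.ne)) (Eventually.of_forall
      (norm_rescaledShell_le (γ := 0) (C := C) (by simpa using hC) hM hM0))).trans_eq ?_
  rw [integral_indicator measurableSet_closedBall, setIntegral_const,
    Measure.addHaar_real_closedBall' μ 0 (Real.exp_pos _).le, exp_ratio, smul_eq_mul]
  ring

end RescaledIntegral

theorem tendsto_integral_vshell [Nontrivial E] {Θ Θ₀ : E → ℂ} {g : E → ℝ} {γ C : ℝ} {W : Set E}
    (hW : W ∈ 𝓝 0) (hmeas : ∀ t, MeasurableSet (vshell W g t))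
    (hΘ : ∀ t, AEStronglyMeasurable Θ (μ.restrict (vshell W g t)))
    (hlow : ∀ w ∈ W, w ≠ 0 → 2 * Real.log ‖w‖ - C ≤ g w)
    (hg : Tendsto (fun w => g w - 2 * Real.log ‖w‖) (𝓝[≠] 0) (𝓝 γ))
    (hc : ContinuousOn Θ₀ {0}ᶜ)
    (hom : ∀ s : ℝ, 0 < s → ∀ w, w ≠ 0 → (s ^ Module.finrank ℝ E : ℝ) • Θ₀ (s • w) = Θ₀ w)
    (hdiff : Tendsto (fun w => (‖w‖ ^ Module.finrank ℝ E : ℝ) • (Θ w - Θ₀ w)) (𝓝[≠] 0) (𝓝 0)) :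
    (∀ᶠ t in atBot, IntegrableOn Θ (vshell W g t) μ) ∧
    Tendsto (fun t => ∫ w in vshell W g t, Θ w ∂μ) atBot
      (𝓝 (∫ w in vshell Set.univ (fun w => 2 * Real.log ‖w‖ + γ) 0, Θ₀ w ∂μ)) := by
  have : ProperSpace E := FiniteDimensional.proper_real E
  set Ψ := rescaledShell W g Θ (Module.finrank ℝ E)
  obtain ⟨M, hM0, hM⟩ := eventually_norm_pow_mul_le hc hom hdiff
  have hnear := ((Metric.tendsto_nhds.1 hg 1 one_pos).and hM)
  set bound : E → ℝ := (Metric.closedBall (0 : E) (Real.exp ((1 - γ + 1) / 2))).indicator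
    (fun _ => M / Real.exp ((-γ - 1) / 2) ^ Module.finrank ℝ E)
  have bound_integrable : Integrable bound μ :=
    (integrable_indicator_iff measurableSet_closedBall).2
      (integrableOn_const (isCompact_closedBall _ _).measure_lt_top.ne)
  have norm_le_bound : ∀ᶠ t in atBot, ∀ᵐ u ∂μ, ‖Ψ t u‖ ≤ bound u := by
    filter_upwards [tendsto_smallSets_iff.1 (tendsto_vshell_smallSets hlow) _ hnear] with t ht
    exact Eventually.of_forall
      (norm_rescaledShell_le (fun w hw => (ht hw).1.le) (fun w hw => (ht hw).2) hM0)
  have Ψ_measurable : ∀ t, AEStronglyMeasurable (Ψ t) μ := fun t =>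
    aestronglyMeasurable_rescaledShell μ (hmeas t) (hΘ t) _
  have Ψ_tendsto : ∀ᵐ u ∂μ, Tendsto (fun t => Ψ t u) atBot
      (𝓝 ((vshell Set.univ (fun w => 2 * Real.log ‖w‖ + γ) 0).indicator Θ₀ u)) := by
    have ae_ne_zero : ∀ᵐ u ∂μ, u ≠ 0 := by simp [ae_iff]
    filter_upwards [ae_ne_zero, ae_two_mul_log_norm_add_ne μ γ 0,
      ae_two_mul_log_norm_add_ne μ γ 1] with u hu0 h_ne_zero h_ne_one
    by_cases hu : u ∈ vshell Set.univ (fun w : E => 2 * Real.log ‖w‖ + γ) 0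
    · rw [Set.indicator_of_mem hu]
      exact tendsto_rescaledShell_of_mem hW hg hom hdiff hu
    · rw [Set.indicator_of_notMem hu]
      refine tendsto_rescaledShell_of_notMem hg hu0 fun hIcc => hu ⟨trivial, hu0, ?_, ?_⟩
      · exact lt_of_le_of_ne hIcc.1 h_ne_zero.symm
      · exact (zero_add (1 : ℝ)).symm ▸ lt_of_le_of_ne hIcc.2 h_ne_one
  constructor
  · filter_upwards [norm_le_bound] with t ht
    exact (integrable_rescaledShell_iff μ (hmeas t)).1 (bound_integrable.mono' (Ψ_measurable t) ht)
  · rw [← integral_indicator (measurableSet_vshell_log γ 0)]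
    simp only [← integral_rescaledShell μ (hmeas _)]
    exact tendsto_integral_filter_of_dominated_convergence bound
      (Eventually.of_forall Ψ_measurable) norm_le_bound bound_integrable Ψ_tendsto

end Shell

/-! ### Hadamard's lemma -/

section Contractions

variable {E : Type*} [NormedAddCommGroup E] [NormedSpace ℂ E] {c : E}

theorem clm_apply_mem_ball {L : E →L[ℂ] E} (hL : ‖L‖ ≤ 1) (hc : L c = c) {z : E} {r : ℝ}
    (hz : z ∈ Metric.ball c r) : L z ∈ Metric.ball c r := by
  rw [mem_ball_iff_norm] at hz ⊢
  calc ‖L z - c‖ = ‖L (z - c)‖ := by rw [map_sub, hc]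
    _ ≤ 1 * ‖z - c‖ := L.le_of_opNorm_le hL _
    _ < r := by rwa [one_mul]

variable {F : Type*} [NormedAddCommGroup F] {T : ℝ → E →L[ℂ] E}

theorem continuousOn_comp_clm_apply {Φ : E → F} {r : ℝ} (hΦ : ContinuousOn Φ (Metric.ball c r))
    (hT : Continuous T) (hTn : ∀ s ∈ Set.uIcc (0 : ℝ) 1, ‖T s‖ ≤ 1) (hTc : ∀ s, T s c = c) {z : E}
    (hz : z ∈ Metric.ball c r) : ContinuousOn (fun s => Φ (T s z)) (Set.uIcc (0 : ℝ) 1) :=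
  hΦ.comp (hT.clm_apply continuous_const).continuousOn fun s hs =>
    clm_apply_mem_ball (hTn s hs) (hTc s) hz

theorem analyticAt_integral_comp_clm [FiniteDimensional ℂ E] [NormedSpace ℂ F] [CompleteSpace F]
    {Φ : E → F} (hΦ : AnalyticAt ℂ Φ c) (hT : Continuous T)
    (hTn : ∀ s ∈ Set.uIcc (0 : ℝ) 1, ‖T s‖ ≤ 1) (hTc : ∀ s, T s c = c) :
    AnalyticAt ℂ (fun z => ∫ s in (0 : ℝ)..1, Φ (T s z)) c := by
  have fderiv_bounded : ∀ᶠ z in 𝓝 c, ‖fderiv ℂ Φ z‖ < ‖fderiv ℂ Φ c‖ + 1 :=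
    hΦ.fderiv.continuousAt.norm.tendsto.eventually_lt_const (lt_add_one _)
  obtain ⟨r, hr, hball⟩ :=
    Metric.eventually_nhds_iff_ball.1 (hΦ.eventually_analyticAt.and fderiv_bounded)
  have path_mem_ball : ∀ s ∈ Set.uIoc (0 : ℝ) 1, ∀ z ∈ Metric.ball c r, T s z ∈ Metric.ball c r :=
    fun s hs z hz => clm_apply_mem_ball (hTn s (Set.uIoc_subset_uIcc hs)) (hTc s) hz
  have path_continuous : ∀ z ∈ Metric.ball c r,
      ContinuousOn (fun s => Φ (T s z)) (Set.uIcc (0 : ℝ) 1) := fun z =>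
    continuousOn_comp_clm_apply (fun w hw => (hball w hw).1.continuousAt.continuousWithinAt)
      hT hTn hTc
  refine analyticAt_of_differentiableOn (fun z₀ hz₀ => ?_) (Metric.ball_mem_nhds c hr)
  have ball_nhds := Metric.isOpen_ball.mem_nhds hz₀
  refine (intervalIntegral.hasFDerivAt_integral_of_dominated_of_fderiv_le (𝕜 := ℂ)
    (μ := volume) (bound := fun _ => ‖fderiv ℂ Φ c‖ + 1)
    (F' := fun z s => (fderiv ℂ Φ (T s z)).comp (T s)) ball_nhds
    ?_ (path_continuous z₀ hz₀).intervalIntegrable ?_ ?_ intervalIntegrable_const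
    ?_).differentiableAt.differentiableWithinAt
  · filter_upwards [ball_nhds] with z hz
    exact ((path_continuous z hz).mono Set.uIoc_subset_uIcc).aestronglyMeasurable measurableSet_uIoc
  · refine ContinuousOn.aestronglyMeasurable (ContinuousOn.clm_comp ?_ hT.continuousOn)
      measurableSet_uIoc
    exact (continuousOn_comp_clm_apply (fun w hw => (hball w hw).1.fderiv.continuousAt
      |>.continuousWithinAt) hT hTn hTc hz₀).mono Set.uIoc_subset_uIcc
  · refine Eventually.of_forall fun s hs z hz => ?_
    refine (ContinuousLinearMap.opNorm_comp_le _ _).trans ?_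
    exact (mul_le_of_le_one_right (norm_nonneg _) (hTn s (Set.uIoc_subset_uIcc hs))).trans
      (hball _ (path_mem_ball s hs z hz)).2.le
  · refine Eventually.of_forall fun s hs z hz => ?_
    exact (hball _ (path_mem_ball s hs z hz)).1.differentiableAt.hasFDerivAt.comp z
      (T s).hasFDerivAt

end Contractions

/-- The contraction `(w, v) ↦ (s w, v)` along which functions are integrated in Hadamard's
lemma. -/
def fstScale (k m : ℕ) (s : ℝ) : (Cn k × Cn m) →L[ℂ] (Cn k × Cn m) :=
  (s : ℂ) • (ContinuousLinearMap.inl ℂ (Cn k) (Cn m)).comp (ContinuousLinearMap.fst ℂ _ _) +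
    (ContinuousLinearMap.inr ℂ (Cn k) (Cn m)).comp (ContinuousLinearMap.snd ℂ _ _)

section Hadamard

variable {k m : ℕ}

theorem fstScale_apply (s : ℝ) (z : Cn k × Cn m) : fstScale k m s z = ((s : ℂ) • z.1, z.2) := by
  simp [fstScale]

theorem fstScale_zero_left (s : ℝ) (v : Cn m) : fstScale k m s (0, v) = (0, v) := by
  simp [fstScale_apply]

theorem continuous_fstScale : Continuous (fstScale k m) := by
  unfold fstScale
  fun_prop

theorem norm_fstScale_le {s : ℝ} (hs : s ∈ Set.uIcc (0 : ℝ) 1) : ‖fstScale k m s‖ ≤ 1 := by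
  rw [Set.uIcc_of_le zero_le_one] at hs
  refine ContinuousLinearMap.opNorm_le_bound _ zero_le_one fun z => ?_
  rw [fstScale_apply, one_mul]
  refine max_le_max ?_ le_rfl
  rw [norm_smul, Complex.norm_real, Real.norm_eq_abs, abs_of_nonneg hs.1]
  exact mul_le_of_le_one_left (norm_nonneg _) hs.2

theorem prod_zero_eq_sum (w : Cn k) :
    ((w, 0) : Cn k × Cn m) = ∑ i, w i • (EuclideanSpace.single i (1 : ℂ), (0 : Cn m)) := by
  simpa [map_sum] using (congrArg (ContinuousLinearMap.inl ℂ (Cn k) (Cn m))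
    ((EuclideanSpace.basisFun (Fin k) ℂ).sum_repr w)).symm

theorem sub_eq_integral_fderiv_fstScale {F : Cn k × Cn m → ℂ} {v₀ : Cn m} {r : ℝ}
    (hF : ∀ z ∈ Metric.ball (0, v₀) r, AnalyticAt ℂ F z) {z : Cn k × Cn m}
    (hz : z ∈ Metric.ball (0, v₀) r) :
    F z - F (0, z.2) = (∫ s in (0 : ℝ)..1, fderiv ℂ F (fstScale k m s z)) (z.1, 0) := by
  have fderiv_continuous : ContinuousOn (fun s => fderiv ℂ F (fstScale k m s z))
      (Set.uIcc (0 : ℝ) 1) :=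
    continuousOn_comp_clm_apply (fun w hw => (hF w hw).fderiv.continuousAt.continuousWithinAt)
      continuous_fstScale (fun s => norm_fstScale_le) (fstScale_zero_left · v₀) hz
  have path_deriv : ∀ s ∈ Set.uIcc (0 : ℝ) 1, HasDerivAt (fun s : ℝ => F (fstScale k m s z))
      (fderiv ℂ F (fstScale k m s z) (z.1, 0)) s := by
    intro s hs
    have hFs := hF _ (clm_apply_mem_ball (norm_fstScale_le hs) (fstScale_zero_left s v₀) hz)
    have hline : HasDerivAt (fun s : ℝ => fstScale k m s z) (z.1, 0) s := by
      have := (Complex.ofRealCLM.hasDerivAt (x := s)).smul_const z.1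
      rw [Complex.ofRealCLM_apply, Complex.ofReal_one, one_smul] at this
      simpa only [fstScale_apply, Complex.ofRealCLM_apply] using
        this.prodMk (hasDerivAt_const s z.2)
    exact (hFs.differentiableAt.hasFDerivAt.restrictScalars ℝ).comp_hasDerivAt s hline
  have hFTC := intervalIntegral.integral_eq_sub_of_hasDerivAt path_deriv
    (fderiv_continuous.clm_apply continuousOn_const).intervalIntegrable
  rw [ContinuousLinearMap.intervalIntegral_apply fderiv_continuous.intervalIntegrable, hFTC]
  simp only [fstScale_apply, Complex.ofReal_one, one_smul, Complex.ofReal_zero, zero_smul]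

theorem exists_eq_sum_coord_mul {F : Cn k × Cn m → ℂ} {v₀ : Cn m}
    (hF : AnalyticAt ℂ F (0, v₀)) (h0 : ∀ᶠ v in 𝓝 v₀, F (0, v) = 0) :
    ∃ h : Fin k → Cn k × Cn m → ℂ, (∀ i, AnalyticAt ℂ (h i) (0, v₀)) ∧
      ∀ᶠ z in 𝓝 ((0, v₀) : Cn k × Cn m), F z = ∑ i, z.1 i * h i z := by
  obtain ⟨r, hr, hball⟩ := Metric.eventually_nhds_iff_ball.1 hF.eventually_analyticAt
  have mean_analytic : AnalyticAt ℂ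
      (fun z => ∫ s in (0 : ℝ)..1, fderiv ℂ F (fstScale k m s z)) (0, v₀) :=
    analyticAt_integral_comp_clm hF.fderiv continuous_fstScale (fun s => norm_fstScale_le)
      (fstScale_zero_left · v₀)
  refine ⟨fun i z => (∫ s in (0 : ℝ)..1, fderiv ℂ F (fstScale k m s z))
      (EuclideanSpace.single i 1, 0), fun i =>
    ((ContinuousLinearMap.apply ℂ ℂ ((EuclideanSpace.single i 1, 0) : Cn k × Cn m)).analyticAt
      _).comp mean_analytic, ?_⟩
  have vanishing : ∀ᶠ z in 𝓝 ((0, v₀) : Cn k × Cn m), F (0, z.2) = 0 :=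
    (continuous_snd.tendsto ((0, v₀) : Cn k × Cn m)).eventually h0
  filter_upwards [vanishing, Metric.ball_mem_nhds _ hr] with z hz0 hz
  rw [← sub_zero (F z), ← hz0, sub_eq_integral_fderiv_fstScale hball hz, prod_zero_eq_sum, map_sum]
  simp only [map_smul, smul_eq_mul]

end Hadamard

/-! ### Submanifold coordinates -/

section Coord

variable {n k m : ℕ} {S : Set (Cn n)} {e : Coord n k m}

theorem IsSubmanifoldCoord.analyticAt (he : IsSubmanifoldCoord S e) {y : Cn n}
    (hy : y ∈ e.source) : AnalyticAt ℂ e y :=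
  analyticAt_of_differentiableOn he.holo (e.open_source.mem_nhds hy)

theorem IsSubmanifoldCoord.analyticAt_symm (he : IsSubmanifoldCoord S e) {z : Cn k × Cn m}
    (hz : z ∈ e.target) : AnalyticAt ℂ e.symm z :=
  analyticAt_of_differentiableOn he.holo_symm (e.open_target.mem_nhds hz)

theorem IsSubmanifoldCoord.apply_eq (he : IsSubmanifoldCoord S e) {x : Cn n}
    (hx : x ∈ e.source) (hxS : x ∈ S) : e x = (0, (e x).2) :=
  Prod.ext ((he.mem_iff x hx).1 hxS) rfl

theorem IsSubmanifoldCoord.zero_mem_target (he : IsSubmanifoldCoord S e) {x : Cn n}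
    (hx : x ∈ e.source) (hxS : x ∈ S) : ((0 : Cn k), (e x).2) ∈ e.target := by
  rw [← he.apply_eq hx hxS]
  exact e.map_source hx

theorem IsSubmanifoldCoord.symm_zero (he : IsSubmanifoldCoord S e) {x : Cn n}
    (hx : x ∈ e.source) (hxS : x ∈ S) : e.symm (0, (e x).2) = x := by
  rw [← he.apply_eq hx hxS]
  exact e.left_inv hx

theorem IsSubmanifoldCoord.symm_mem_iff (he : IsSubmanifoldCoord S e) {z : Cn k × Cn m}
    (hz : z ∈ e.target) : e.symm z ∈ S ↔ z.1 = 0 := by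
  rw [he.mem_iff _ (e.map_target hz), e.right_inv hz]

theorem IsSubmanifoldCoord.analyticAt_coord (he : IsSubmanifoldCoord S e) {y : Cn n}
    (hy : y ∈ e.source) (i : Fin k) : AnalyticAt ℂ (fun y => (e y).1 i) y := by
  exact (((EuclideanSpace.proj (𝕜 := ℂ) i).comp
    (ContinuousLinearMap.fst ℂ (Cn k) (Cn m))).analyticAt (e y)).comp (he.analyticAt hy)

end Coord

/-! ### Germs and their order of vanishing -/

section Germs

variable {n : ℕ} {x : Cn n}

/-- The germ at `x` of a holomorphic function. -/
def germOf (F : Cn n → ℂ) (hF : AnalyticAt ℂ F x) : holGerm x := ⟨F, F, hF, rfl⟩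

/-- The ideal of germs that are `O(|y - x|^q)`. -/
def ordIdeal (x : Cn n) (q : ℕ) : Ideal (holGerm x) where
  carrier := {a | ∃ F : Cn n → ℂ, (F : Germ (𝓝 x) ℂ) = a.1 ∧ F =O[𝓝 x] fun y => ‖y - x‖ ^ q}
  add_mem' := by
    rintro a b ⟨F, hF, hF'⟩ ⟨H, hH, hH'⟩
    exact ⟨F + H, by simp [← hF, ← hH], hF'.add hH'⟩
  zero_mem' := ⟨0, rfl, isBigO_zero _ _⟩
  smul_mem' := by
    rintro ⟨_, F, hF, rfl⟩ b ⟨H, hH, hH'⟩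
    refine ⟨F * H, by simp [← hH], ?_⟩
    have bounded : F =O[𝓝 x] fun _ => (1 : ℝ) := hF.continuousAt.tendsto.isBigO_one ℝ
    exact (bounded.mul hH').congr_right fun _ => one_mul _

theorem isBigO_of_mem_ordIdeal {q : ℕ} {a : holGerm x} (ha : a ∈ ordIdeal x q) {F : Cn n → ℂ}
    (hF : (F : Germ (𝓝 x) ℂ) = a.1) : F =O[𝓝 x] fun y => ‖y - x‖ ^ q := by
  obtain ⟨H, hH, hH'⟩ := ha
  exact hH'.congr' (Germ.coe_eq.1 (hH.trans hF.symm)) EventuallyEq.rfl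

theorem ordIdeal_mul_le (q r : ℕ) : ordIdeal x q * ordIdeal x r ≤ ordIdeal x (q + r) := by
  rw [Ideal.mul_le]
  rintro a ⟨F, hF, hF'⟩ b ⟨H, hH, hH'⟩
  refine ⟨F * H, by simp [← hF, ← hH], ?_⟩
  simp only [pow_add]
  exact hF'.mul hH'

theorem idealStalk_singleton_le_ordIdeal : idealStalk {x} x ≤ ordIdeal x 1 := by
  rintro ⟨_, F, hF, rfl⟩ ⟨H, hH, hH'⟩
  have hFx : F x = 0 := (Germ.coe_eq.1 hH).self_of_nhds.symm.trans (hH'.self_of_nhds rfl)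
  exact ⟨F, rfl, by simpa [hFx] using hF.differentiableAt.isBigO_sub.norm_right⟩

theorem idealStalk_le_idealStalk_singleton {S : Set (Cn n)} (hx : x ∈ S) :
    idealStalk S x ≤ idealStalk {x} x := fun _ ⟨H, hH, hH'⟩ =>
  ⟨H, hH, hH'.mono fun _ hy hyx => hy (Set.mem_singleton_iff.1 hyx ▸ hx)⟩

theorem idealStalk_pow_le_ordIdeal {S : Set (Cn n)} (hx : x ∈ S) (q : ℕ) :
    idealStalk S x ^ q ≤ ordIdeal x q := by
  induction q with
  | zero =>
    rintro ⟨_, F, hF, rfl⟩ -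
    exact ⟨F, rfl, by simpa using hF.continuousAt.tendsto.isBigO_one ℝ⟩
  | succ q ih =>
    rw [pow_succ]
    refine (Ideal.mul_mono ih ?_).trans (ordIdeal_mul_le q 1)
    exact (idealStalk_le_idealStalk_singleton hx).trans idealStalk_singleton_le_ordIdeal

theorem idealStalk_singleton_mul_pow_le_ordIdeal {S : Set (Cn n)} (hx : x ∈ S) (q : ℕ) :
    idealStalk {x} x * idealStalk S x ^ q ≤ ordIdeal x (q + 1) := by
  rw [add_comm]
  exact (Ideal.mul_mono idealStalk_singleton_le_ordIdeal
    (idealStalk_pow_le_ordIdeal hx q)).trans (ordIdeal_mul_le 1 q)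

theorem Represents.sub_isBigO {S : Set (Cn n)} (hx : x ∈ S) {p : ℕ} (hp : 1 ≤ p)
    {F H : Cn n → ℂ} {f : JetFibre S p x} (hF : Represents S p x F f)
    (hH : Represents S p x H f) : (fun y => F y - H y) =O[𝓝 x] fun y => ‖y - x‖ ^ p := by
  obtain ⟨a, ha, ha'⟩ := hF
  obtain ⟨b, hb, hb'⟩ := hH
  have sub_mem := (Submodule.Quotient.eq _).1 (ha'.trans hb'.symm)
  rw [Submodule.mem_comap] at sub_mem
  have relations_le : idealStalk S x ^ p ⊔ idealStalk {x} x * idealStalk S x ^ (p - 1) ≤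
      ordIdeal x p := by
    refine sup_le (idealStalk_pow_le_ordIdeal hx p) ?_
    simpa only [Nat.sub_add_cancel hp] using idealStalk_singleton_mul_pow_le_ordIdeal hx (p - 1)
  refine isBigO_of_mem_ordIdeal (relations_le sub_mem) ?_
  change ((F - H : Cn n → ℂ) : Germ (𝓝 x) ℂ) = a.1.1 - b.1.1
  rw [← ha, ← hb]
  rfl

end Germs

/-! ### Leading homogeneous polynomials -/

section Leading

variable {n k m : ℕ} {S : Set (Cn n)} {e : Coord n k m} {x : Cn n}

/-- The constants, as a subfield of the ring of germs at `x`. -/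
def constGerm (x : Cn n) : ℂ →+* holGerm x where
  toFun c := germOf (fun _ => c) analyticAt_const
  map_one' := rfl
  map_mul' _ _ := rfl
  map_zero' := rfl
  map_add' _ _ := rfl

/-- The germ of the coordinate `z_i` of `z'`. -/
def coordGerm (he : IsSubmanifoldCoord S e) (hx : x ∈ e.source) (i : Fin k) : holGerm x :=
  germOf (fun y => (e y).1 i) (he.analyticAt_coord hx i)

/-- The germ of a polynomial in `z₁, …, z_k`, as a ring homomorphism in the polynomial. -/
def polyGerm (he : IsSubmanifoldCoord S e) (hx : x ∈ e.source) :
    MvPolynomial (Fin k) ℂ →+* holGerm x :=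
  MvPolynomial.eval₂Hom (constGerm x) (coordGerm he hx)

theorem polyGerm_val (he : IsSubmanifoldCoord S e) (hx : x ∈ e.source)
    (P : MvPolynomial (Fin k) ℂ) : (polyGerm he hx P).1 = (coordPoly e P : Germ (𝓝 x) ℂ) := by
  induction P using MvPolynomial.induction_on with
  | C a =>
    have const_apply : coordPoly e (MvPolynomial.C a) = fun _ => a := by
      funext y
      simp [coordPoly]
    rw [const_apply, polyGerm, MvPolynomial.eval₂Hom_C]
    rfl
  | add P Q hP hQ =>
    have add_apply : coordPoly e (P + Q) = coordPoly e P + coordPoly e Q := by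
      funext y
      simp [coordPoly]
    rw [add_apply, map_add, Subring.coe_add, hP, hQ]
    rfl
  | mul_X P i hP =>
    have mul_X_apply :
        coordPoly e (P * MvPolynomial.X i) = coordPoly e P * fun y => (e y).1 i := by
      funext y
      simp [coordPoly]
    rw [mul_X_apply, map_mul, Subring.coe_mul, hP, polyGerm, MvPolynomial.eval₂Hom_X']
    rfl

theorem coordGerm_mem (he : IsSubmanifoldCoord S e) (hx : x ∈ e.source) (i : Fin k) :
    coordGerm he hx i ∈ idealStalk S x := by
  refine ⟨_, rfl, ?_⟩
  filter_upwards [e.open_source.mem_nhds hx] with y hy hyS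
  simp [(he.mem_iff y hy).1 hyS]

theorem polyGerm_mem_pow (he : IsSubmanifoldCoord S e) (hx : x ∈ e.source) {q : ℕ}
    {P : MvPolynomial (Fin k) ℂ} (hP : P.IsHomogeneous q) :
    polyGerm he hx P ∈ idealStalk S x ^ q := by
  rw [P.as_sum, map_sum]
  refine Ideal.sum_mem _ fun α hα => ?_
  have degree_eq : ∑ i ∈ α.support, α i = q := by
    have := hP (MvPolynomial.mem_support_iff.1 hα)
    rwa [Pi.one_def, ← Finsupp.degree_eq_weight_one] at this
  rw [polyGerm, MvPolynomial.coe_eval₂Hom, MvPolynomial.eval₂_monomial, ← degree_eq, Finsupp.prod,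
    ← Finset.prod_pow_eq_pow_sum]
  refine Ideal.mul_mem_left _ _ (Ideal.prod_mem_prod fun i _ => ?_)
  exact Ideal.pow_mem_pow (coordGerm_mem he hx i) _

theorem eventually_comp_symm_eq_zero {E : Type*} [Zero E] (he : IsSubmanifoldCoord S e)
    (hx : x ∈ e.source) (hxS : x ∈ S) {F : Cn n → E} (hF : ∀ᶠ y in 𝓝 x, y ∈ S → F y = 0) :
    ∀ᶠ v in 𝓝 (e x).2, F (e.symm ((0 : Cn k), v)) = 0 := by
  have htarget := he.zero_mem_target hx hxS
  have incl_tendsto : Tendsto (fun v : Cn m => ((0 : Cn k), v)) (𝓝 (e x).2) (𝓝 (0, (e x).2)) :=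
    (Continuous.prodMk_right (0 : Cn k)).tendsto _
  have symm_tendsto : Tendsto (fun v : Cn m => e.symm ((0 : Cn k), v)) (𝓝 (e x).2) (𝓝 x) := by
    have := (e.continuousAt_symm htarget).tendsto.comp incl_tendsto
    rwa [he.symm_zero hx hxS] at this
  filter_upwards [incl_tendsto.eventually (e.open_target.mem_nhds htarget),
    symm_tendsto.eventually hF] with v hv hFv
  exact hFv ((he.symm_mem_iff hv).2 rfl)

theorem exists_eq_sum_coordGerm (he : IsSubmanifoldCoord S e) (hx : x ∈ e.source) (hxS : x ∈ S)
    {a : holGerm x} (ha : a ∈ idealStalk S x) :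
    ∃ h : Fin k → holGerm x, a = ∑ i, coordGerm he hx i * h i := by
  obtain ⟨_, F, hF, rfl⟩ := a
  obtain ⟨H, hH, hH'⟩ := ha
  have hF0 : ∀ᶠ y in 𝓝 x, y ∈ S → F y = 0 := by
    filter_upwards [Germ.coe_eq.1 hH, hH'] with y hHF hy hyS
    rw [← hHF, hy hyS]
  have hFe : AnalyticAt ℂ (F ∘ e.symm) (0, (e x).2) :=
    AnalyticAt.comp (by rwa [he.symm_zero hx hxS])
      (he.analyticAt_symm (he.zero_mem_target hx hxS))
  obtain ⟨h, hh, hsum⟩ :=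
    exists_eq_sum_coord_mul hFe (eventually_comp_symm_eq_zero he hx hxS hF0)
  rw [← he.apply_eq hx hxS] at hh hsum
  refine ⟨fun i => germOf (h i ∘ e) ((hh i).comp (he.analyticAt hx)), Subtype.ext ?_⟩
  have product_germ : ∀ i,
      (coordGerm he hx i * germOf (h i ∘ e) ((hh i).comp (he.analyticAt hx))).1 =
        Germ.coeRingHom (𝓝 x) (fun y => (e y).1 i * h i (e y)) := fun i => rfl
  rw [AddSubmonoidClass.coe_finsetSum]
  simp only [product_germ, ← map_sum]
  refine Germ.coe_eq.2 ?_
  filter_upwards [(he.analyticAt hx).continuousAt.tendsto.eventually hsum,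
    e.open_source.mem_nhds hx] with y hy hy_source
  simp only [Function.comp, e.left_inv hy_source] at hy
  rw [hy, Finset.sum_apply]

theorem exists_sub_constGerm_mem (h : holGerm x) :
    ∃ c : ℂ, h - constGerm x c ∈ idealStalk {x} x := by
  obtain ⟨_, F, hF, rfl⟩ := h
  refine ⟨F x, F - fun _ => F x, rfl, Eventually.of_forall fun y hy => ?_⟩
  rw [Set.mem_singleton_iff.1 hy]
  simp

theorem exists_linear_sub_polyGerm_mem (he : IsSubmanifoldCoord S e) (hx : x ∈ e.source)
    (hxS : x ∈ S) {a : holGerm x} (ha : a ∈ idealStalk S x) :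
    ∃ L : MvPolynomial (Fin k) ℂ, L.IsHomogeneous 1 ∧
      a - polyGerm he hx L ∈ idealStalk {x} x * idealStalk S x := by
  obtain ⟨h, rfl⟩ := exists_eq_sum_coordGerm he hx hxS ha
  choose c hc using fun i => exists_sub_constGerm_mem (h i)
  refine ⟨∑ i, MvPolynomial.C (c i) * MvPolynomial.X i,
    MvPolynomial.IsHomogeneous.sum _ _ _ fun i _ =>
      (zero_add 1) ▸ (MvPolynomial.isHomogeneous_C _ _).mul (MvPolynomial.isHomogeneous_X _ i), ?_⟩
  rw [map_sum, ← Finset.sum_sub_distrib]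
  refine Ideal.sum_mem _ fun i _ => ?_
  rw [map_mul, polyGerm, MvPolynomial.eval₂Hom_C, MvPolynomial.eval₂Hom_X',
    mul_comm (coordGerm he hx i), ← sub_mul]
  exact Ideal.mul_mem_mul (hc i) (coordGerm_mem he hx i)

theorem exists_sub_polyGerm_mem (he : IsSubmanifoldCoord S e) (hx : x ∈ e.source) (hxS : x ∈ S)
    (q : ℕ) : ∀ a ∈ idealStalk S x ^ q, ∃ P : MvPolynomial (Fin k) ℂ, P.IsHomogeneous q ∧
      a - polyGerm he hx P ∈ idealStalk {x} x * idealStalk S x ^ q := by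
  induction q with
  | zero =>
    intro a _
    obtain ⟨c, hc⟩ := exists_sub_constGerm_mem a
    refine ⟨MvPolynomial.C c, MvPolynomial.isHomogeneous_C _ _, ?_⟩
    rwa [pow_zero, Ideal.one_eq_top, Ideal.mul_top, polyGerm, MvPolynomial.eval₂Hom_C]
  | succ q ih =>
    intro a ha
    rw [pow_succ'] at ha
    refine Submodule.mul_induction_on ha (fun b hb c hc => ?_) ?_
    · obtain ⟨L, hL, hbL⟩ := exists_linear_sub_polyGerm_mem he hx hxS hb
      obtain ⟨P, hP, hcP⟩ := ih c hc
      refine ⟨L * P, add_comm 1 q ▸ hL.mul hP, ?_⟩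
      have product_split : b * c - polyGerm he hx (L * P) = (b - polyGerm he hx L) * c +
          polyGerm he hx L * (c - polyGerm he hx P) := by
        rw [map_mul]
        ring
      rw [product_split]
      refine Ideal.add_mem _ ?_ ?_
      · rw [pow_succ', ← mul_assoc]
        exact Ideal.mul_mem_mul hbL hc
      · rw [pow_succ', mul_left_comm]
        exact Ideal.mul_mem_mul (pow_one (idealStalk S x) ▸ polyGerm_mem_pow he hx hL) hcP
    · rintro b c ⟨P, hP, hbP⟩ ⟨Q, hQ, hcQ⟩
      refine ⟨P + Q, hP.add hQ, ?_⟩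
      rw [map_add, add_sub_add_comm]
      exact Ideal.add_mem _ hbP hcQ

theorem exists_correspondsTo (he : IsSubmanifoldCoord S e) (hx : x ∈ e.source) (hxS : x ∈ S)
    (p : ℕ) (f : JetFibre S p x) : ∃ P, CorrespondsTo S p e x f P := by
  obtain ⟨a, rfl⟩ := Submodule.Quotient.mk_surjective _ f
  obtain ⟨P, hP, haP⟩ := exists_sub_polyGerm_mem he hx hxS (p - 1) a.1 a.2
  refine ⟨P, hP, ⟨polyGerm he hx P, polyGerm_mem_pow he hx hP⟩, (polyGerm_val he hx P).symm, ?_⟩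
  symm
  rw [Submodule.Quotient.eq, Submodule.mem_comap]
  exact Submodule.mem_sup_right haP

end Leading

/-! ### Gram determinants and block triangular maps -/

section Determinants

variable {ι : Type} [Fintype ι] [DecidableEq ι] {V : Type*}

theorem gramDet_comp {n : ℕ} [AddCommGroup V] [Module ℂ V] (β : Module.Basis ι ℂ V)
    (M : V →ₗ[ℂ] Cn n) (B : V →ₗ[ℂ] V) :
    gramDet (fun j => M (B (β j))) = ‖LinearMap.det B‖ ^ 2 * gramDet (fun j => M (β j)) := by
  set b := LinearMap.toMatrix β β B with hb
  have expand : ∀ j, M (B (β j)) = ∑ l, b l j • M (β l) := by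
    intro j
    conv_lhs => rw [← β.sum_repr (B (β j))]
    simp only [map_sum, map_smul, hb, LinearMap.toMatrix_apply]
  have gram_eq : Matrix.gram ℂ (fun j => M (B (β j))) =
      b.conjTranspose * Matrix.gram ℂ (fun j => M (β j)) * b := by
    ext i j
    simp only [Matrix.gram_apply, expand, sum_inner, inner_sum, inner_smul_left,
      inner_smul_right, Matrix.mul_apply, Matrix.conjTranspose_apply, Finset.sum_mul,
      Finset.mul_sum, RCLike.star_def]
    exact Finset.sum_congr rfl fun l _ => Finset.sum_congr rfl fun l' _ => by ring
  unfold gramDet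
  rw [gram_eq, Matrix.det_mul, Matrix.det_mul, Matrix.det_conjTranspose,
    ← LinearMap.det_toMatrix β B, ← hb, mul_right_comm, RCLike.star_def, mul_comm (conj b.det),
    Complex.mul_conj, Complex.normSq_eq_norm_sq, Complex.re_ofReal_mul]

theorem gramDet_pos {n : ℕ} {v : ι → Cn n} (hv : LinearIndependent ℂ v) : 0 < gramDet v :=
  (Complex.lt_def.1 (Matrix.posDef_gram_of_linearIndependent hv).det_pos).1

/-- The standard basis of `ℂᵏ × ℂᵐ`. -/
def prodBasis (k m : ℕ) : Module.Basis (Fin k ⊕ Fin m) ℂ (Cn k × Cn m) :=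
  (EuclideanSpace.basisFun (Fin k) ℂ).toBasis.prod (EuclideanSpace.basisFun (Fin m) ℂ).toBasis

theorem prodBasis_apply {k m : ℕ} (s : Fin k ⊕ Fin m) : prodBasis k m s =
    Sum.elim (fun i => (EuclideanSpace.single i (1 : ℂ), (0 : Cn m)))
      (fun j => ((0 : Cn k), EuclideanSpace.single j (1 : ℂ))) s := by
  rcases s with i | j <;> simp [prodBasis]

theorem det_eq_mul_of_fst_inr_eq_zero {k m : ℕ} (D : (Cn k × Cn m) →ₗ[ℂ] (Cn k × Cn m))
    (h : ∀ v, (D (0, v)).1 = 0) : LinearMap.det D =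
      LinearMap.det (LinearMap.fst ℂ (Cn k) (Cn m) ∘ₗ D ∘ₗ LinearMap.inl ℂ (Cn k) (Cn m)) *
      LinearMap.det (LinearMap.snd ℂ (Cn k) (Cn m) ∘ₗ D ∘ₗ LinearMap.inr ℂ (Cn k) (Cn m)) := by
  set βk := (EuclideanSpace.basisFun (Fin k) ℂ).toBasis
  set βm := (EuclideanSpace.basisFun (Fin m) ℂ).toBasis
  rw [← LinearMap.det_toMatrix (βk.prod βm), ← LinearMap.det_toMatrix βk,
    ← LinearMap.det_toMatrix βm, ← Matrix.det_fromBlocks_zero₁₂ _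
      (LinearMap.toMatrix βk βm (LinearMap.snd ℂ (Cn k) (Cn m) ∘ₗ D ∘ₗ LinearMap.inl ℂ _ _))]
  congr 1
  ext i j
  rcases i with i | i <;> rcases j with j | j <;> simp [LinearMap.toMatrix_apply, h]

theorem abs_det_restrictScalars [NormedAddCommGroup V] [NormedSpace ℂ V] [FiniteDimensional ℂ V]
    (B : V →L[ℂ] V) :
    |(B.restrictScalars ℝ).det| = ‖LinearMap.det (B : V →ₗ[ℂ] V)‖ ^ 2 := by
  have det_eq : (B.restrictScalars ℝ).det = ‖LinearMap.det (B : V →ₗ[ℂ] V)‖ ^ 2 := by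
    rw [← Complex.normSq_eq_norm_sq, ← Algebra.norm_complex_apply,
      ← LinearMap.det_restrictScalars]
    rfl
  rw [det_eq, abs_of_nonneg (sq_nonneg _)]

end Determinants

/-! ### Change of coordinates -/

section Transition

variable {n k m : ℕ} {S : Set (Cn n)} {e e' : Coord n k m} {x : Cn n}

theorem IsSubmanifoldCoord.hasFDerivAt (he : IsSubmanifoldCoord S e) (hx : x ∈ e.source) :
    HasFDerivAt e (fderiv ℂ e x) x :=
  (he.analyticAt hx).differentiableAt.hasFDerivAt

theorem IsSubmanifoldCoord.hasFDerivAt_symm (he : IsSubmanifoldCoord S e) {z : Cn k × Cn m}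
    (hz : z ∈ e.target) : HasFDerivAt e.symm (fderiv ℂ e.symm z) z :=
  (he.analyticAt_symm hz).differentiableAt.hasFDerivAt

theorem IsSubmanifoldCoord.fderiv_symm_fderiv (he : IsSubmanifoldCoord S e) (hx : x ∈ e.source)
    (u : Cn n) : fderiv ℂ e.symm (e x) (fderiv ℂ e x u) = u := by
  have comp_eq_id : e.symm ∘ e =ᶠ[𝓝 x] id := e.eventually_left_inverse hx
  have hcomp := (he.hasFDerivAt_symm (e.map_source hx)).comp x (he.hasFDerivAt hx)
  exact DFunLike.congr_fun
    (hcomp.unique ((hasFDerivAt_id x).congr_of_eventuallyEq comp_eq_id)) u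

theorem IsSubmanifoldCoord.fderiv_fderiv_symm (he : IsSubmanifoldCoord S e) {z : Cn k × Cn m}
    (hz : z ∈ e.target) (u : Cn k × Cn m) :
    fderiv ℂ e (e.symm z) (fderiv ℂ e.symm z u) = u := by
  have comp_eq_id : e ∘ e.symm =ᶠ[𝓝 z] id := e.eventually_right_inverse hz
  have hcomp := (he.hasFDerivAt (e.map_target hz)).comp z (he.hasFDerivAt_symm hz)
  exact DFunLike.congr_fun
    (hcomp.unique ((hasFDerivAt_id z).congr_of_eventuallyEq comp_eq_id)) u

theorem IsSubmanifoldCoord.linearIndependent_fderiv_symm (he : IsSubmanifoldCoord S e)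
    {z : Cn k × Cn m} (hz : z ∈ e.target) :
    LinearIndependent ℂ fun s => fderiv ℂ e.symm z (prodBasis k m s) :=
  (prodBasis k m).linearIndependent.map' (fderiv ℂ e.symm z : (Cn k × Cn m) →ₗ[ℂ] Cn n)
    (LinearMap.ker_eq_bot.2 (Function.LeftInverse.injective (he.fderiv_fderiv_symm hz)))

theorem IsSubmanifoldCoord.ambientDensity_pos (he : IsSubmanifoldCoord S e)
    {z : Cn k × Cn m} (hz : z ∈ e.target) : 0 < ambientDensity e z := by
  have := gramDet_pos (he.linearIndependent_fderiv_symm hz)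
  simpa only [ambientDensity, prodBasis_apply] using this

theorem IsSubmanifoldCoord.subDensity_pos (he : IsSubmanifoldCoord S e)
    {w : Cn m} (hw : ((0 : Cn k), w) ∈ e.target) : 0 < subDensity e w := by
  have := gramDet_pos ((he.linearIndependent_fderiv_symm hw).comp Sum.inr Sum.inr_injective)
  simpa only [subDensity, Function.comp_def, prodBasis_apply, Sum.elim_inr] using this

/-- The derivative of the change of coordinates from `e` to `e'` at `x`. -/
def transD (e e' : Coord n k m) (x : Cn n) : (Cn k × Cn m) →L[ℂ] (Cn k × Cn m) :=
  (fderiv ℂ e' x).comp (fderiv ℂ e.symm (e x))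

/-- The normal block `ℂᵏ → ℂᵏ` of the derivative of the change of coordinates. -/
def normalD (e e' : Coord n k m) (x : Cn n) : Cn k →L[ℂ] Cn k :=
  (ContinuousLinearMap.fst ℂ (Cn k) (Cn m)).comp
    ((transD e e' x).comp (ContinuousLinearMap.inl ℂ (Cn k) (Cn m)))

/-- The tangential block `ℂᵐ → ℂᵐ` of the derivative of the change of coordinates. -/
def tangentD (e e' : Coord n k m) (x : Cn n) : Cn m →L[ℂ] Cn m :=
  (ContinuousLinearMap.snd ℂ (Cn k) (Cn m)).comp
    ((transD e e' x).comp (ContinuousLinearMap.inr ℂ (Cn k) (Cn m)))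

theorem hasFDerivAt_trans (he : IsSubmanifoldCoord S e) (he' : IsSubmanifoldCoord S e')
    (hx : x ∈ e.source) (hx' : x ∈ e'.source) :
    HasFDerivAt (fun z => e' (e.symm z)) (transD e e' x) (e x) := by
  have he'_deriv := he'.hasFDerivAt hx'
  rw [← e.left_inv hx] at he'_deriv
  simpa only [e.left_inv hx] using! he'_deriv.comp (e x) (he.hasFDerivAt_symm (e.map_source hx))

theorem transD_inr (he : IsSubmanifoldCoord S e) (he' : IsSubmanifoldCoord S e')
    (hx : x ∈ e.source) (hx' : x ∈ e'.source) (hxS : x ∈ S) (v : Cn m) :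
    transD e e' x (0, v) = (0, tangentD e e' x v) := by
  refine Prod.ext ?_ rfl
  have htrans := hasFDerivAt_trans he he' hx hx'
  rw [he.apply_eq hx hxS] at htrans
  have along_S :=
    (htrans.comp (e x).2 (hasFDerivAt_prodMk_right (𝕜 := ℂ) (0 : Cn k) (e x).2)).fst
  have fst_eq_zero : (fun w : Cn m => (e' (e.symm ((0 : Cn k), w))).1) =ᶠ[𝓝 (e x).2] 0 := by
    refine eventually_comp_symm_eq_zero he hx hxS (F := fun y => (e' y).1) ?_
    filter_upwards [e'.open_source.mem_nhds hx'] with y hy hyS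
    exact (he'.mem_iff y hy).1 hyS
  exact DFunLike.congr_fun
    (along_S.unique ((hasFDerivAt_const (0 : Cn k) (e x).2).congr_of_eventuallyEq fst_eq_zero)) v

theorem fderiv_symm_eq_comp_transD (he' : IsSubmanifoldCoord S e') (hx' : x ∈ e'.source)
    (u : Cn k × Cn m) : fderiv ℂ e.symm (e x) u = fderiv ℂ e'.symm (e' x) (transD e e' x u) :=
  (he'.fderiv_symm_fderiv hx' _).symm

theorem det_transD (he : IsSubmanifoldCoord S e) (he' : IsSubmanifoldCoord S e')
    (hx : x ∈ e.source) (hx' : x ∈ e'.source) (hxS : x ∈ S) :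
    LinearMap.det (transD e e' x : (Cn k × Cn m) →ₗ[ℂ] (Cn k × Cn m)) =
      LinearMap.det (normalD e e' x : Cn k →ₗ[ℂ] Cn k) *
      LinearMap.det (tangentD e e' x : Cn m →ₗ[ℂ] Cn m) :=
  det_eq_mul_of_fst_inr_eq_zero _ fun v =>
    congrArg Prod.fst (transD_inr he he' hx hx' hxS v)

theorem ambientDensity_trans (he' : IsSubmanifoldCoord S e') (hx' : x ∈ e'.source) :
    ambientDensity e (e x) =
      ‖LinearMap.det (transD e e' x : (Cn k × Cn m) →ₗ[ℂ] (Cn k × Cn m))‖ ^ 2 *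
        ambientDensity e' (e' x) := by
  have hgram := gramDet_comp (prodBasis k m)
    (fderiv ℂ e'.symm (e' x) : (Cn k × Cn m) →ₗ[ℂ] Cn n) (transD e e' x)
  simp only [prodBasis_apply, ContinuousLinearMap.coe_coe] at hgram
  unfold ambientDensity
  rw [← hgram]
  simp only [fderiv_symm_eq_comp_transD (e := e) he' hx']

theorem subDensity_trans (he : IsSubmanifoldCoord S e) (he' : IsSubmanifoldCoord S e')
    (hx : x ∈ e.source) (hx' : x ∈ e'.source) (hxS : x ∈ S) :
    subDensity e (e x).2 =
      ‖LinearMap.det (tangentD e e' x : Cn m →ₗ[ℂ] Cn m)‖ ^ 2 * subDensity e' (e' x).2 := by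
  have hgram := gramDet_comp (EuclideanSpace.basisFun (Fin m) ℂ).toBasis
    ((fderiv ℂ e'.symm (e' x) : (Cn k × Cn m) →ₗ[ℂ] Cn n) ∘ₗ LinearMap.inr ℂ (Cn k) (Cn m))
    (tangentD e e' x)
  simp only [OrthonormalBasis.coe_toBasis, EuclideanSpace.basisFun_apply, LinearMap.comp_apply,
    LinearMap.inr_apply, ContinuousLinearMap.coe_coe] at hgram
  unfold subDensity
  rw [← he.apply_eq hx hxS, ← he'.apply_eq hx' hxS, ← hgram]
  simp only [fderiv_symm_eq_comp_transD (e := e) he' hx', transD_inr he he' hx hx' hxS]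

theorem density_ratio_trans (he : IsSubmanifoldCoord S e) (he' : IsSubmanifoldCoord S e')
    (hx : x ∈ e.source) (hx' : x ∈ e'.source) (hxS : x ∈ S) :
    ambientDensity e (e x) / subDensity e (e x).2 =
      ‖LinearMap.det (normalD e e' x : Cn k →ₗ[ℂ] Cn k)‖ ^ 2 *
        (ambientDensity e' (e' x) / subDensity e' (e' x).2) := by
  have sub_pos := he.subDensity_pos (he.zero_mem_target hx hxS)
  rw [subDensity_trans he he' hx hx' hxS] at sub_pos ⊢
  have det_tangent_ne : ‖LinearMap.det (tangentD e e' x : Cn m →ₗ[ℂ] Cn m)‖ ^ 2 ≠ 0 :=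
    left_ne_zero_of_mul sub_pos.ne'
  rw [ambientDensity_trans he' hx', det_transD he he' hx hx' hxS, norm_mul, mul_pow,
    mul_right_comm, mul_comm (_ * _) (‖_‖ ^ 2), mul_div_mul_left _ _ det_tangent_ne,
    mul_div_assoc]

end Transition

/-! ### Comparing two adapted coordinate systems along transverse curves -/

theorem eval_mul_left_of_isHomogeneous {R σ : Type*} [CommSemiring R] {q : ℕ}
    {P : MvPolynomial σ R} (hP : P.IsHomogeneous q) (c : R) (v : σ → R) :
    MvPolynomial.eval (fun i => c * v i) P = c ^ q * MvPolynomial.eval v P := by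
  rw [MvPolynomial.eval_eq, MvPolynomial.eval_eq, Finset.mul_sum]
  refine Finset.sum_congr rfl fun α hα => ?_
  have degree_eq : ∑ i ∈ α.support, α i = q := by
    have := hP (MvPolynomial.mem_support_iff.1 hα)
    rwa [Pi.one_def, ← Finsupp.degree_eq_weight_one] at this
  simp only [mul_pow, Finset.prod_mul_distrib, Finset.prod_pow_eq_pow_sum, degree_eq]
  ring

theorem continuous_eval_euclidean {k : ℕ} (P : MvPolynomial (Fin k) ℂ) :
    Continuous fun v : Cn k => MvPolynomial.eval (fun i => v i) P :=
  (MvPolynomial.continuous_eval P).comp (by fun_prop)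

section Compare

variable {n k m : ℕ} {S : Set (Cn n)} {G : Cn n → EReal} {e e' : Coord n k m} {x : Cn n}

/-- The curve with coordinates `(s v, z''(x))`; for `x ∈ S` it passes through `x` at `s = 0`. -/
def transverseCurve (e : Coord n k m) (x : Cn n) (v : Cn k) (s : ℝ) : Cn n :=
  e.symm ((s : ℂ) • v, (e x).2)

theorem transverseCurve_zero (he : IsSubmanifoldCoord S e) (hx : x ∈ e.source) (hxS : x ∈ S)
    (v : Cn k) : transverseCurve e x v 0 = x := by
  rw [transverseCurve, Complex.ofReal_zero, zero_smul, he.symm_zero hx hxS]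

theorem hasDerivAt_transverseCurve (he : IsSubmanifoldCoord S e) (hx : x ∈ e.source)
    (hxS : x ∈ S) (v : Cn k) :
    HasDerivAt (transverseCurve e x v) (fderiv ℂ e.symm (e x) (v, 0)) 0 := by
  have hline : HasDerivAt (fun s : ℝ => ((s : ℂ) • v, (e x).2)) (v, 0) 0 := by
    have := (Complex.ofRealCLM.hasDerivAt (x := 0)).smul_const v
    rw [Complex.ofRealCLM_apply, Complex.ofReal_one, one_smul] at this
    exact this.prodMk (hasDerivAt_const 0 (e x).2)
  have start_eq : e x = (((0 : ℝ) : ℂ) • v, (e x).2) := by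
    rw [Complex.ofReal_zero, zero_smul, ← he.apply_eq hx hxS]
  exact ((he.hasFDerivAt_symm (e.map_source hx)).restrictScalars ℝ).comp_hasDerivAt_of_eq 0 hline
    start_eq

theorem tendsto_transverseCurve (he : IsSubmanifoldCoord S e) (hx : x ∈ e.source)
    (hxS : x ∈ S) (v : Cn k) : Tendsto (transverseCurve e x v) (𝓝 0) (𝓝 x) := by
  have := (hasDerivAt_transverseCurve he hx hxS v).continuousAt.tendsto
  rwa [transverseCurve_zero he hx hxS] at this

theorem eventually_transverse_mem_target (he : IsSubmanifoldCoord S e) (hx : x ∈ e.source)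
    (hxS : x ∈ S) (v : Cn k) :
    ∀ᶠ s : ℝ in 𝓝 0, ((s : ℂ) • v, (e x).2) ∈ e.target := by
  have hcont : Continuous fun s : ℝ => ((s : ℂ) • v, (e x).2) := by fun_prop
  refine (hcont.tendsto 0).eventually (e.open_target.mem_nhds ?_)
  simpa only [Complex.ofReal_zero, zero_smul] using he.zero_mem_target hx hxS

theorem tendsto_inv_smul_transverseCurve (he : IsSubmanifoldCoord S e)
    (he' : IsSubmanifoldCoord S e') (hx : x ∈ e.source) (hx' : x ∈ e'.source) (hxS : x ∈ S)
    (v : Cn k) :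
    Tendsto (fun s : ℝ => (s : ℂ)⁻¹ • (e' (transverseCurve e x v s)).1) (𝓝[≠] 0)
      (𝓝 (normalD e e' x v)) := by
  have curve_zero := transverseCurve_zero he hx hxS v
  have hderiv := ((he'.hasFDerivAt hx').restrictScalars ℝ).comp_hasDerivAt_of_eq (0 : ℝ)
    (hasDerivAt_transverseCurve he hx hxS v) curve_zero.symm
  have fst_zero : (e' (transverseCurve e x v 0)).1 = 0 := by
    rw [curve_zero]
    exact (he'.mem_iff x hx').1 hxS
  refine (hasDerivAt_iff_tendsto_slope_zero.1 hderiv.fst).congr fun s => ?_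
  simp only [Function.comp, zero_add, fst_zero, sub_zero]
  rw [← Complex.ofReal_inv]
  exact (Complex.coe_smul _ _).symm

theorem coordPoly_transverseCurve {q : ℕ} {P : MvPolynomial (Fin k) ℂ} (hP : P.IsHomogeneous q)
    {v : Cn k} {s : ℝ} (hs : ((s : ℂ) • v, (e x).2) ∈ e.target) :
    coordPoly e P (transverseCurve e x v s) =
      (s : ℂ) ^ q * MvPolynomial.eval (fun i => v i) P := by
  rw [coordPoly, transverseCurve, e.right_inv hs]
  exact eval_mul_left_of_isHomogeneous hP _ _

/-- Dividing by `s ^ q` along the transverse curve turns agreement to order `q + 1` of the two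
functions into equality of their leading terms. -/
theorem eval_eq_eval_normalD (he : IsSubmanifoldCoord S e) (he' : IsSubmanifoldCoord S e')
    (hx : x ∈ e.source) (hx' : x ∈ e'.source) (hxS : x ∈ S) {q : ℕ}
    {P P' : MvPolynomial (Fin k) ℂ} (hP : P.IsHomogeneous q) (hP' : P'.IsHomogeneous q)
    (h : (fun y => coordPoly e P y - coordPoly e' P' y) =O[𝓝 x] fun y => ‖y - x‖ ^ (q + 1))
    (v : Cn k) : MvPolynomial.eval (fun i => v i) P =
      MvPolynomial.eval (fun i => normalD e e' x v i) P' := by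
  let blowup : ℝ → Cn k := fun s => (s : ℂ)⁻¹ • (e' (transverseCurve e x v s)).1
  have curve_sub_isBigO : (fun s => transverseCurve e x v s - x) =O[𝓝 0] fun s : ℝ => s := by
    simpa only [transverseCurve_zero he hx hxS, sub_zero] using
      (hasDerivAt_transverseCurve he hx hxS v).isBigO_sub
  have diff_isBigO := (h.comp_tendsto (tendsto_transverseCurve he hx hxS v)).trans
    (curve_sub_isBigO.norm_left.pow (q + 1))
  have diff_tendsto : Tendsto (fun s : ℝ => MvPolynomial.eval (fun i => v i) P -
      MvPolynomial.eval (fun i => blowup s i) P') (𝓝[≠] 0) (𝓝 _) :=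
    tendsto_const_nhds.sub (((continuous_eval_euclidean P').tendsto _).comp
      (tendsto_inv_smul_transverseCurve he he' hx hx' hxS v))
  have inv_pow_isBigO : (fun s : ℝ => ((s : ℂ)⁻¹) ^ q) =O[𝓝[≠] 0] fun s : ℝ => (s⁻¹) ^ q :=
    IsBigO.of_bound 1 (Eventually.of_forall fun s => by simp)
  have blowup_isBigO : (fun s : ℝ => MvPolynomial.eval (fun i => v i) P -
      MvPolynomial.eval (fun i => blowup s i) P') =O[𝓝[≠] 0] fun s : ℝ => s := by
    refine (inv_pow_isBigO.mul (diff_isBigO.mono (nhdsWithin_le_nhds (s := {0}ᶜ)))).congr' ?_ ?_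
    · filter_upwards [self_mem_nhdsWithin,
        nhdsWithin_le_nhds (eventually_transverse_mem_target he hx hxS v)] with s hs hmem
      have hsC : (s : ℂ) ≠ 0 := Complex.ofReal_ne_zero.2 hs
      have scale_P' := eval_mul_left_of_isHomogeneous hP' (s : ℂ)⁻¹
        (fun i => (e' (transverseCurve e x v s)).1 i)
      simp only [blowup, PiLp.smul_apply, smul_eq_mul, Function.comp]
      rw [scale_P', coordPoly_transverseCurve hP hmem, coordPoly, mul_sub, ← mul_assoc,
        ← mul_pow, inv_mul_cancel₀ hsC, one_pow, one_mul]
    · filter_upwards [self_mem_nhdsWithin] with s hs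
      rw [pow_succ, ← mul_assoc, ← mul_pow, inv_mul_cancel₀ hs, one_pow, one_mul]
  exact sub_eq_zero.1 (tendsto_nhds_unique diff_tendsto
    (blowup_isBigO.trans_tendsto (tendsto_id.mono_left nhdsWithin_le_nhds)))

theorem normalD_self (he : IsSubmanifoldCoord S e) (hx : x ∈ e.source) (v : Cn k) :
    normalD e e x v = v := by
  have := he.fderiv_fderiv_symm (e.map_source hx) (v, 0)
  rw [e.left_inv hx] at this
  exact congrArg Prod.fst this

theorem CorrespondsTo.eval_trans (he : IsSubmanifoldCoord S e) (he' : IsSubmanifoldCoord S e')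
    (hx : x ∈ e.source) (hx' : x ∈ e'.source) (hxS : x ∈ S)
    {p : ℕ} (hp : 1 ≤ p) {f : JetFibre S p x} {P P' : MvPolynomial (Fin k) ℂ}
    (hP : CorrespondsTo S p e x f P) (hP' : CorrespondsTo S p e' x f P') (v : Cn k) :
    MvPolynomial.eval (fun i => v i) P =
      MvPolynomial.eval (fun i => normalD e e' x v i) P' := by
  have agree := Represents.sub_isBigO hxS hp hP.2 hP'.2
  nth_rewrite 1 [← Nat.sub_add_cancel hp] at agree
  exact eval_eq_eval_normalD he he' hx hx' hxS hP.1 hP'.1 agree v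

theorem CorrespondsTo.unique (he : IsSubmanifoldCoord S e) (hx : x ∈ e.source) (hxS : x ∈ S)
    {p : ℕ} (hp : 1 ≤ p) {f : JetFibre S p x} {P Q : MvPolynomial (Fin k) ℂ}
    (hP : CorrespondsTo S p e x f P) (hQ : CorrespondsTo S p e x f Q) : P = Q := by
  refine MvPolynomial.funext fun v => ?_
  simpa only [normalD_self he hx] using hP.eval_trans he he hx hx hxS hp hQ (WithLp.toLp 2 v)

/-- `γ` is the continuous part `G - log |z'|²` of `G` in the coordinates `e`. -/
def IsGreenPart (G : Cn n → EReal) (e : Coord n k m) (γ : Cn n → ℝ) : Prop :=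
  ContinuousOn γ e.source ∧ ∀ y ∈ e.source,
    G y = ENNReal.log (ENNReal.ofReal (‖(e y).1‖ ^ 2)) + (γ y : EReal)

theorem IsGreenPart.eq_coe {γ : Cn n → ℝ} (hγ : IsGreenPart G e γ) {y : Cn n}
    (hy : y ∈ e.source) (h0 : (e y).1 ≠ 0) :
    G y = ((2 * Real.log ‖(e y).1‖ + γ y : ℝ) : EReal) := by
  rw [hγ.2 y hy, ENNReal.log_ofReal_of_pos (pow_pos (norm_pos_iff.2 h0) 2), Real.log_pow,
    EReal.coe_add, Nat.cast_ofNat]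

theorem IsGreenPart.eq_bot {γ : Cn n → ℝ} (hγ : IsGreenPart G e γ) {y : Cn n}
    (hy : y ∈ e.source) (h0 : (e y).1 = 0) : G y = ⊥ := by
  simp [hγ.2 y hy, h0]

theorem IsGreenPart.norm_eq_exp_mul_norm {γ γ' : Cn n → ℝ} (hγ : IsGreenPart G e γ)
    (hγ' : IsGreenPart G e' γ') {y : Cn n} (hy : y ∈ e.source) (hy' : y ∈ e'.source)
    (h0 : (e y).1 ≠ 0) (h0' : (e' y).1 ≠ 0) :
    ‖(e' y).1‖ = Real.exp ((γ y - γ' y) / 2) * ‖(e y).1‖ := by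
  have two_logs := (hγ.eq_coe hy h0).symm.trans (hγ'.eq_coe hy' h0')
  rw [EReal.coe_eq_coe_iff] at two_logs
  have log_eq : Real.log ‖(e' y).1‖ = (γ y - γ' y) / 2 + Real.log ‖(e y).1‖ := by linarith
  rw [← Real.exp_log (norm_pos_iff.2 h0'), log_eq, Real.exp_add, Real.exp_log (norm_pos_iff.2 h0)]

theorem norm_normalD (he : IsSubmanifoldCoord S e) (he' : IsSubmanifoldCoord S e')
    (hx : x ∈ e.source) (hx' : x ∈ e'.source) (hxS : x ∈ S) {γ γ' : Cn n → ℝ}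
    (hγ : IsGreenPart G e γ) (hγ' : IsGreenPart G e' γ') (v : Cn k) :
    ‖normalD e e' x v‖ = Real.exp ((γ x - γ' x) / 2) * ‖v‖ := by
  rcases eq_or_ne v 0 with rfl | hv
  · simp only [map_zero, norm_zero, mul_zero]
  have hcurve : Tendsto (transverseCurve e x v) (𝓝[≠] 0) (𝓝 x) :=
    (tendsto_transverseCurve he hx hxS v).mono_left nhdsWithin_le_nhds
  have diff_tendsto : Tendsto (fun s => γ (transverseCurve e x v s) -
      γ' (transverseCurve e x v s)) (𝓝[≠] 0) (𝓝 (γ x - γ' x)) :=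
    ((hγ.1.continuousAt (e.open_source.mem_nhds hx)).tendsto.comp hcurve).sub
      ((hγ'.1.continuousAt (e'.open_source.mem_nhds hx')).tendsto.comp hcurve)
  have exp_tendsto :=
    ((Real.continuous_exp.tendsto _).comp (diff_tendsto.div_const 2)).mul_const ‖v‖
  refine tendsto_nhds_unique (tendsto_inv_smul_transverseCurve he he' hx hx' hxS v).norm
    (exp_tendsto.congr' ?_)
  filter_upwards [self_mem_nhdsWithin,
    nhdsWithin_le_nhds (eventually_transverse_mem_target he hx hxS v),
    hcurve.eventually (e'.open_source.mem_nhds hx')] with s (hs : s ≠ 0) hmem hsource'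
  have hsource : transverseCurve e x v s ∈ e.source := e.map_target hmem
  have coord_eq : (e (transverseCurve e x v s)).1 = (s : ℂ) • v := by
    rw [transverseCurve, e.right_inv hmem]
  have coord_ne : (e (transverseCurve e x v s)).1 ≠ 0 :=
    coord_eq ▸ smul_ne_zero (Complex.ofReal_ne_zero.2 hs) hv
  have coord'_ne : (e' (transverseCurve e x v s)).1 ≠ 0 := fun h =>
    coord_ne ((he.mem_iff _ hsource).1 ((he'.mem_iff _ hsource').2 h))
  have norm_s_ne : ‖(s : ℂ)‖ ≠ 0 := norm_ne_zero_iff.2 (Complex.ofReal_ne_zero.2 hs)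
  rw [norm_smul, hγ.norm_eq_exp_mul_norm hγ' hsource hsource' coord_ne coord'_ne, coord_eq,
    norm_smul, norm_inv]
  simp only [Function.comp]
  field_simp

end Compare

/-! ### The limit form on the normal space -/

/-- The function `F H̄ e^{-(p+k-1)g}` on the normal space `ℂᵏ`: the integrand of `(*)` without its
factor `e^{-φ}`, with `g` in the place of `G`. -/
def shellIntegrand (k p : ℕ) (g : Cn k → ℝ) (F H : Cn k → ℂ) (w : Cn k) : ℂ :=
  F w * conj (H w) * (Real.exp (-((p : ℝ) + k - 1) * g w) : ℂ)

/-- The integral of `P Q̄ N^{-(p+k-1)}` over `{1 < N < e}`, where `N = e^γ |u|²`. -/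
def normalForm (k p : ℕ) (γ : ℝ) (P Q : MvPolynomial (Fin k) ℂ) : ℂ :=
  ∫ u in vshell Set.univ (fun u : Cn k => 2 * Real.log ‖u‖ + γ) 0,
    shellIntegrand k p (fun u => 2 * Real.log ‖u‖ + γ) (fun u => MvPolynomial.eval (fun i => u i) P)
      (fun u => MvPolynomial.eval (fun i => u i) Q) u

section Similarity

variable {k : ℕ} {γ γ' : ℝ} {a : Cn k →L[ℂ] Cn k}

theorem injective_of_norm_eq_exp_mul {c : ℝ} (ha : ∀ v, ‖a v‖ = Real.exp c * ‖v‖) :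
    Function.Injective a :=
  (injective_iff_map_eq_zero a).2 fun v hv => by simpa [hv] using ha v

theorem two_mul_log_norm_add_of_norm_eq (ha : ∀ v, ‖a v‖ = Real.exp ((γ - γ') / 2) * ‖v‖)
    {v : Cn k} (hv : v ≠ 0) : 2 * Real.log ‖a v‖ + γ' = 2 * Real.log ‖v‖ + γ := by
  rw [ha, Real.log_mul (Real.exp_ne_zero _) (norm_ne_zero_iff.2 hv), Real.log_exp]
  ring

theorem image_vshell_log (ha : ∀ v, ‖a v‖ = Real.exp ((γ - γ') / 2) * ‖v‖) :
    a '' vshell Set.univ (fun u : Cn k => 2 * Real.log ‖u‖ + γ) 0 =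
      vshell Set.univ (fun u : Cn k => 2 * Real.log ‖u‖ + γ') 0 := by
  have hinj := injective_of_norm_eq_exp_mul ha
  have hsurj : Function.Surjective a :=
    LinearMap.surjective_of_injective (f := (a : Cn k →ₗ[ℂ] Cn k)) hinj
  ext u
  obtain ⟨v, rfl⟩ := hsurj u
  rw [hinj.mem_set_image]
  simp only [vshell, Set.mem_ofPred_eq, map_ne_zero_iff a hinj]
  refine and_congr_right fun _ => and_congr_right fun hv => ?_
  rw [two_mul_log_norm_add_of_norm_eq ha hv]

theorem normalForm_eq_of_norm_eq {p : ℕ} {P Q P' Q' : MvPolynomial (Fin k) ℂ}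
    (ha : ∀ v, ‖a v‖ = Real.exp ((γ - γ') / 2) * ‖v‖)
    (hP : ∀ v : Cn k, MvPolynomial.eval (fun i => v i) P = MvPolynomial.eval (fun i => a v i) P')
    (hQ : ∀ v : Cn k, MvPolynomial.eval (fun i => v i) Q = MvPolynomial.eval (fun i => a v i) Q') :
    normalForm k p γ' P' Q' =
      ((‖LinearMap.det (a : Cn k →ₗ[ℂ] Cn k)‖ ^ 2 : ℝ) : ℂ) * normalForm k p γ P Q := by
  have hmeas := measurableSet_vshell_log (E := Cn k) γ 0
  unfold normalForm
  rw [← image_vshell_log ha, integral_image_eq_integral_abs_det_fderiv_smul volume hmeas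
    (f := a) (f' := fun _ => a.restrictScalars ℝ)
    (fun v _ => (a.restrictScalars ℝ).hasFDerivAt.hasFDerivWithinAt)
    (injective_of_norm_eq_exp_mul ha).injOn,
    abs_det_restrictScalars, integral_smul, Complex.real_smul]
  congr 1
  refine setIntegral_congr_fun hmeas fun v hv => ?_
  simp only [shellIntegrand, two_mul_log_norm_add_of_norm_eq ha hv.2.1, hP, hQ]

end Similarity

/-! ### The limit over a slice, in coordinates -/

theorem finrank_real_Cn (k : ℕ) : Module.finrank ℝ (Cn k) = 2 * k := by
  rw [← Module.finrank_mul_finrank ℝ ℂ (Cn k), Complex.finrank_real_complex,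
    finrank_euclideanSpace_fin]

theorem isBigO_eval_of_isHomogeneous {k q : ℕ} {P : MvPolynomial (Fin k) ℂ}
    (hP : P.IsHomogeneous q) (l : Filter (Cn k)) :
    (fun w : Cn k => MvPolynomial.eval (fun i => w i) P) =O[l] fun w => ‖w‖ ^ q := by
  obtain ⟨M, hM⟩ := (isCompact_closedBall (0 : Cn k) 1).exists_bound_of_continuousOn
    (continuous_eval_euclidean P).continuousOn
  refine IsBigO.of_bound M (Eventually.of_forall fun w => ?_)
  obtain ⟨u, hu, hw⟩ : ∃ u : Cn k, ‖u‖ ≤ 1 ∧ ∀ i, w i = (‖w‖ : ℂ) * u i := by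
    rcases eq_or_ne w 0 with rfl | hw0
    · exact ⟨0, by simp, by simp⟩
    · exact ⟨(‖w‖ : ℂ)⁻¹ • w, by simp [norm_smul, hw0], by simp [hw0]⟩
  have eval_eq : MvPolynomial.eval (fun i => w i) P =
      (‖w‖ : ℂ) ^ q * MvPolynomial.eval (fun i => u i) P := by
    rw [funext hw, eval_mul_left_of_isHomogeneous hP]
  rw [eval_eq, norm_mul, norm_pow, Complex.norm_real, norm_norm, mul_comm, norm_pow, norm_norm]
  gcongr
  exact hM u (by simpa using hu)

section VShell

variable {k p : ℕ} {γ : Cn k → ℝ} {F H : Cn k → ℂ} {P Q : MvPolynomial (Fin k) ℂ} {w : Cn k}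

theorem shellIntegrand_eq_inv_norm_pow_mul (hp : 1 ≤ p) (hw : w ≠ 0) :
    shellIntegrand k p (fun w => 2 * Real.log ‖w‖ + γ w) F H w =
      ((‖w‖ ^ (2 * (k + (p - 1))) : ℝ) : ℂ)⁻¹ *
        ((Real.exp (-((p : ℝ) + k - 1) * γ w) : ℂ) * (F w * conj (H w))) := by
  have exponent_eq : (p : ℝ) + k - 1 = ((k + (p - 1) : ℕ) : ℝ) := by
    push_cast [Nat.cast_sub hp]
    ring
  have exp_eq : Real.exp (-((p : ℝ) + k - 1) * (2 * Real.log ‖w‖ + γ w)) =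
      (‖w‖ ^ (2 * (k + (p - 1))))⁻¹ * Real.exp (-((p : ℝ) + k - 1) * γ w) := by
    rw [mul_add, Real.exp_add]
    congr 1
    rw [exponent_eq, ← Real.exp_log (pow_pos (norm_pos_iff.2 hw) _), Real.log_pow, ← Real.exp_neg]
    congr 1
    push_cast
    ring
  rw [shellIntegrand, exp_eq]
  push_cast
  ring

theorem continuousOn_shellIntegrand {s : Set (Cn k)} {g : Cn k → ℝ} (hg : ContinuousOn g s)
    (hF : ContinuousOn F s) (hH : ContinuousOn H s) : ContinuousOn (shellIntegrand k p g F H) s :=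
  (hF.mul (Complex.continuous_conj.comp_continuousOn hH)).mul
    (Complex.continuous_ofReal.comp_continuousOn (continuousOn_const.mul hg).rexp)

theorem aestronglyMeasurable_shellIntegrand {s : Set (Cn k)} {g : Cn k → ℝ}
    (hg : ContinuousOn g s) (hs : MeasurableSet s)
    (hF : AEStronglyMeasurable F (volume.restrict s))
    (hH : AEStronglyMeasurable H (volume.restrict s)) :
    AEStronglyMeasurable (shellIntegrand k p g F H) (volume.restrict s) :=
  (hF.mul (Complex.continuous_conj.comp_aestronglyMeasurable hH)).mul
    ((Complex.continuous_ofReal.comp_continuousOn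
      (continuousOn_const.mul hg).rexp).aestronglyMeasurable hs)

theorem continuousOn_two_mul_log_norm_add {W : Set (Cn k)} (hγ : ContinuousOn γ W) :
    ContinuousOn (fun w => 2 * Real.log ‖w‖ + γ w) (W \ {0}) :=
  (continuousOn_const.mul
    (continuous_norm.continuousOn.log fun _ hw => norm_ne_zero_iff.2 hw.2)).add
      (hγ.mono Set.sdiff_subset)

theorem vshell_subset (W : Set (Cn k)) (g : Cn k → ℝ) (t : ℝ) : vshell W g t ⊆ W \ {0} :=
  fun _ hw => ⟨hw.1, hw.2.1⟩

theorem isOpen_vshell {W : Set (Cn k)} (hW : IsOpen W) {g : Cn k → ℝ}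
    (hg : ContinuousOn g (W \ {0})) (t : ℝ) : IsOpen (vshell W g t) := by
  have shell_eq : vshell W g t = W \ {0} ∩ g ⁻¹' Set.Ioo t (t + 1) := by
    ext w
    simp only [vshell, Set.mem_ofPred_eq, Set.mem_inter_iff, Set.mem_sdiff, Set.mem_singleton_iff,
      Set.mem_preimage, Set.mem_Ioo, and_assoc, ne_eq]
  rw [shell_eq]
  exact hg.isOpen_inter_preimage (hW.sdiff isClosed_singleton) isOpen_Ioo

theorem pow_smul_shellIntegrand_smul (hp : 1 ≤ p) (c : ℝ) (hP : P.IsHomogeneous (p - 1))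
    (hQ : Q.IsHomogeneous (p - 1)) {s : ℝ} (hs : 0 < s) (hw : w ≠ 0) :
    (s ^ (2 * k) : ℝ) • shellIntegrand k p (fun u => 2 * Real.log ‖u‖ + c)
        (fun u => MvPolynomial.eval (fun i => u i) P)
        (fun u => MvPolynomial.eval (fun i => u i) Q) (s • w) =
      shellIntegrand k p (fun u => 2 * Real.log ‖u‖ + c)
        (fun u => MvPolynomial.eval (fun i => u i) P)
        (fun u => MvPolynomial.eval (fun i => u i) Q) w := by
  have eval_smul : ∀ R : MvPolynomial (Fin k) ℂ, R.IsHomogeneous (p - 1) →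
      MvPolynomial.eval (fun i => (s • w) i) R =
        (s : ℂ) ^ (p - 1) * MvPolynomial.eval (fun i => w i) R := by
    intro R hR
    rw [← eval_mul_left_of_isHomogeneous hR]
    rfl
  rw [shellIntegrand_eq_inv_norm_pow_mul hp (smul_ne_zero hs.ne' hw),
    shellIntegrand_eq_inv_norm_pow_mul hp hw, eval_smul P hP, eval_smul Q hQ, norm_smul,
    Real.norm_of_nonneg hs.le, Complex.real_smul, map_mul, map_pow, Complex.conj_ofReal]
  have hsC : (s : ℂ) ≠ 0 := Complex.ofReal_ne_zero.2 hs.ne'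
  have hwC : (‖w‖ : ℂ) ≠ 0 := Complex.ofReal_ne_zero.2 (norm_ne_zero_iff.2 hw)
  push_cast
  rw [mul_pow, mul_add, pow_add, pow_mul' _ 2 (p - 1)]
  field_simp

end VShell

theorem isBigO_conj {α : Type*} {l : Filter α} {u : α → ℂ} {r : α → ℝ} (hu : u =O[l] r) :
    (fun w => conj (u w)) =O[l] r :=
  (isBigO_of_le l fun w => (RCLike.norm_conj (u w)).le).trans hu

theorem isLittleO_conj {α : Type*} {l : Filter α} {u : α → ℂ} {r : α → ℝ} (hu : u =o[l] r) :
    (fun w => conj (u w)) =o[l] r :=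
  (isBigO_of_le l fun w => (RCLike.norm_conj (u w)).le).trans_isLittleO hu

theorem isLittleO_mul_mul_conj_sub {α : Type*} {l : Filter α} {A F H P Q : α → ℂ} {A₀ : ℂ}
    {r : α → ℝ} (hA : Tendsto A l (𝓝 A₀)) (hFP : (fun w => F w - P w) =o[l] r)
    (hHQ : (fun w => H w - Q w) =o[l] r) (hP : P =O[l] r) (hQ : Q =O[l] r) :
    (fun w => A w * (F w * conj (H w)) - A₀ * (P w * conj (Q w))) =o[l] fun w => r w * r w := by
  have hF : F =O[l] r := by simpa using hFP.isBigO.add hP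
  have hH : H =O[l] r := by simpa using hHQ.isBigO.add hQ
  have change_A := ((isLittleO_one_iff ℝ).2 (tendsto_sub_nhds_zero_iff.2 hA)).mul_isBigO
    (hF.mul (isBigO_conj hH))
  have change_F := (hFP.mul_isBigO (isBigO_conj hH)).const_mul_left A₀
  have change_H := (hP.mul_isLittleO (isLittleO_conj hHQ)).const_mul_left A₀
  refine (((change_A.congr_right fun w => one_mul _).add change_F).add change_H).congr_left
    fun w => ?_
  rw [map_sub]
  ring

section SliceLimit

variable {k p : ℕ} {γ A : Cn k → ℝ} {F H : Cn k → ℂ} {P Q : MvPolynomial (Fin k) ℂ}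

theorem tendsto_norm_pow_smul_shellIntegrand_sub (hp : 1 ≤ p) (hγ : ContinuousAt γ 0)
    (hA : ContinuousAt A 0) (hP : P.IsHomogeneous (p - 1)) (hQ : Q.IsHomogeneous (p - 1))
    (hFP : (fun w => F w - MvPolynomial.eval (fun i => w i) P)
      =o[𝓝[≠] 0] fun w => ‖w‖ ^ (p - 1))
    (hHQ : (fun w => H w - MvPolynomial.eval (fun i => w i) Q)
      =o[𝓝[≠] 0] fun w => ‖w‖ ^ (p - 1)) :
    Tendsto (fun w => (‖w‖ ^ (2 * k) : ℝ) •
      ((A w : ℂ) * shellIntegrand k p (fun w => 2 * Real.log ‖w‖ + γ w) F H w -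
        (A 0 : ℂ) * shellIntegrand k p (fun w => 2 * Real.log ‖w‖ + γ 0)
          (fun w => MvPolynomial.eval (fun i => w i) P)
          (fun w => MvPolynomial.eval (fun i => w i) Q) w)) (𝓝[≠] 0) (𝓝 0) := by
  set B : Cn k → ℂ := fun w => (A w * Real.exp (-((p : ℝ) + k - 1) * γ w) : ℝ)
  have hB : Tendsto B (𝓝[≠] 0) (𝓝 (B 0)) :=
    (Complex.continuous_ofReal.continuousAt.comp
      (hA.mul (continuousAt_const.mul hγ).rexp)).tendsto.mono_left nhdsWithin_le_nhds
  have quotient_tendsto := (isLittleO_mul_mul_conj_sub hB hFP hHQ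
    (isBigO_eval_of_isHomogeneous hP _)
    (isBigO_eval_of_isHomogeneous hQ _)).norm_left.tendsto_div_nhds_zero
  rw [tendsto_zero_iff_norm_tendsto_zero]
  refine quotient_tendsto.congr' ?_
  filter_upwards [self_mem_nhdsWithin] with w hw
  have norm_ne : ‖w‖ ≠ 0 := norm_ne_zero_iff.2 hw
  have diff_eq : ∀ I I₀ E E₀ N : ℂ, (A w : ℂ) * (N⁻¹ * (E * I)) - A 0 * (N⁻¹ * (E₀ * I₀)) =
      N⁻¹ * (A w * E * I - A 0 * E₀ * I₀) := fun _ _ _ _ _ => by ring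
  rw [shellIntegrand_eq_inv_norm_pow_mul hp hw, shellIntegrand_eq_inv_norm_pow_mul hp hw, diff_eq,
    norm_smul, norm_mul, norm_inv, Complex.norm_real, norm_pow, norm_norm, norm_pow, norm_norm,
    mul_add, pow_add, mul_inv, mul_assoc, mul_inv_cancel_left₀ (pow_ne_zero _ norm_ne),
    div_eq_inv_mul, two_mul (p - 1), pow_add]
  simp only [B, Complex.ofReal_mul]

theorem tendsto_integral_shellIntegrand (hk : 1 ≤ k) (hp : 1 ≤ p) {W : Set (Cn k)}
    (hW : IsOpen W) (hW0 : 0 ∈ W) (hγ : ContinuousOn γ W) {C : ℝ} (hlow : ∀ w ∈ W, -C ≤ γ w)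
    (hA : ContinuousOn A W) (hF : AEStronglyMeasurable F (volume.restrict W))
    (hH : AEStronglyMeasurable H (volume.restrict W))
    (hP : P.IsHomogeneous (p - 1)) (hQ : Q.IsHomogeneous (p - 1))
    (hFP : (fun w => F w - MvPolynomial.eval (fun i => w i) P)
      =o[𝓝[≠] 0] fun w => ‖w‖ ^ (p - 1))
    (hHQ : (fun w => H w - MvPolynomial.eval (fun i => w i) Q)
      =o[𝓝[≠] 0] fun w => ‖w‖ ^ (p - 1)) :
    (∀ᶠ t in atBot, IntegrableOn
      (fun w => (A w : ℂ) * shellIntegrand k p (fun w => 2 * Real.log ‖w‖ + γ w) F H w)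
      (vshell W (fun w => 2 * Real.log ‖w‖ + γ w) t)) ∧
    Tendsto (fun t => ∫ w in vshell W (fun w => 2 * Real.log ‖w‖ + γ w) t,
      (A w : ℂ) * shellIntegrand k p (fun w => 2 * Real.log ‖w‖ + γ w) F H w) atBot
      (𝓝 ((A 0 : ℂ) * normalForm k p (γ 0) P Q)) := by
  have hW_nhds : W ∈ 𝓝 (0 : Cn k) := hW.mem_nhds hW0
  have : Nonempty (Fin k) := ⟨⟨0, hk⟩⟩
  have log_continuousOn := continuousOn_two_mul_log_norm_add hγ
  have hmeas := fun t => (isOpen_vshell hW log_continuousOn t).measurableSet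
  rw [normalForm, ← integral_const_mul]
  refine tendsto_integral_vshell volume (C := C) hW_nhds hmeas (fun t => ?_) (fun w hw _ => ?_)
    ?_ ?_ (fun s hs w hw => ?_) ?_
  · have restrict_le : volume.restrict (vshell W (fun w => 2 * Real.log ‖w‖ + γ w) t) ≤
        (volume : Measure (Cn k)).restrict W := Measure.restrict_mono (fun w hw => hw.1) le_rfl
    exact (Complex.continuous_ofReal.comp_aestronglyMeasurable
      ((hA.mono fun w hw => hw.1).aestronglyMeasurable (hmeas t))).mul
        (aestronglyMeasurable_shellIntegrand (log_continuousOn.mono (vshell_subset _ _ _))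
          (hmeas t) (hF.mono_measure restrict_le) (hH.mono_measure restrict_le))
  · linarith [hlow w hw]
  · simpa only [add_sub_cancel_left] using
      (hγ.continuousAt hW_nhds).tendsto.mono_left nhdsWithin_le_nhds
  · refine continuousOn_const.mul (continuousOn_shellIntegrand ?_
      (continuous_eval_euclidean P).continuousOn (continuous_eval_euclidean Q).continuousOn)
    exact (continuousOn_two_mul_log_norm_add (W := Set.univ) continuousOn_const).mono
      fun w hw => ⟨trivial, hw⟩
  · rw [finrank_real_Cn, ← mul_smul_comm, pow_smul_shellIntegrand_smul hp _ hP hQ hs hw]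
  · rw [finrank_real_Cn]
    exact tendsto_norm_pow_smul_shellIntegrand_sub hp (hγ.continuousAt hW_nhds)
      (hA.continuousAt hW_nhds) hP hQ hFP hHQ

end SliceLimit

section GreenSlice

variable {n k m : ℕ} {S : Set (Cn n)} {G : Cn n → EReal} {e : Coord n k m}
  {γ : Cn n → ℝ} {v : Cn m}

theorem preimage_shell_eq_vshell (hγ : IsGreenPart G e γ) {W : Set (Cn k)}
    (hWT : ∀ w ∈ W, (w, v) ∈ e.target) (t : ℝ) :
    W ∩ (fun w => e.symm (w, v)) ⁻¹' shell G t =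
      vshell W (fun w => 2 * Real.log ‖w‖ + γ (e.symm (w, v))) t := by
  ext w
  simp only [vshell, shell, Set.mem_inter_iff, Set.mem_preimage, Set.mem_ofPred_eq]
  refine and_congr_right fun hw => ?_
  have hsrc := e.map_target (hWT w hw)
  have coord_eq : (e (e.symm (w, v))).1 = w := by rw [e.right_inv (hWT w hw)]
  rcases eq_or_ne w 0 with rfl | hw0
  · rw [hγ.eq_bot hsrc coord_eq]
    simp
  · rw [hγ.eq_coe hsrc (by rwa [coord_eq]), coord_eq]
    simp only [EReal.coe_lt_coe_iff, ne_eq, hw0, not_false_eq_true, true_and]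

theorem integrand_symm_eq_shellIntegrand (hγ : IsGreenPart G e γ) {p : ℕ} {φ : Cn n → ℝ}
    {F H : Cn n → ℂ} {w : Cn k} (hT : (w, v) ∈ e.target) (hw : w ≠ 0) :
    integrand k p G φ F H (e.symm (w, v)) =
      (Real.exp (-φ (e.symm (w, v))) : ℂ) *
        shellIntegrand k p (fun w => 2 * Real.log ‖w‖ + γ (e.symm (w, v)))
          (fun w => F (e.symm (w, v))) (fun w => H (e.symm (w, v))) w := by
  have coord_eq : (e (e.symm (w, v))).1 = w := by rw [e.right_inv hT]
  rw [integrand, shellIntegrand, hγ.eq_coe (e.map_target hT) (by rwa [coord_eq]), coord_eq,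
    EReal.toReal_coe, sub_eq_add_neg, ← neg_mul, Real.exp_add, Complex.ofReal_mul]
  ring

theorem tendsto_integral_slice {x : Cn n} (he : IsSubmanifoldCoord S e) (hx : x ∈ e.source)
    (hxS : x ∈ S) (hk : 1 ≤ k) {p : ℕ} (hp : 1 ≤ p) (hγ : IsGreenPart G e γ) {φ : Cn n → ℝ}
    (hφ : ContinuousOn φ e.source) {W : Set (Cn k)} (hW : IsOpen W) (hW0 : 0 ∈ W)
    (hWT : ∀ w ∈ W, (w, (e x).2) ∈ e.target) {C : ℝ}
    (hlow : ∀ w ∈ W, -C ≤ γ (e.symm (w, (e x).2)))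
    {a : Cn k → ℝ} (ha : ContinuousOn a W) {F H : Cn n → ℂ}
    (hF : AEStronglyMeasurable (fun w => F (e.symm (w, (e x).2))) (volume.restrict W))
    (hH : AEStronglyMeasurable (fun w => H (e.symm (w, (e x).2))) (volume.restrict W))
    {P Q : MvPolynomial (Fin k) ℂ} (hP : P.IsHomogeneous (p - 1)) (hQ : Q.IsHomogeneous (p - 1))
    (hFP : (fun w => F (e.symm (w, (e x).2)) - MvPolynomial.eval (fun i => w i) P)
      =o[𝓝[≠] 0] fun w => ‖w‖ ^ (p - 1))
    (hHQ : (fun w => H (e.symm (w, (e x).2)) - MvPolynomial.eval (fun i => w i) Q)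
      =o[𝓝[≠] 0] fun w => ‖w‖ ^ (p - 1)) :
    (∀ᶠ t in atBot, IntegrableOn (fun w => a w • integrand k p G φ F H (e.symm (w, (e x).2)))
      (W ∩ (fun w => e.symm (w, (e x).2)) ⁻¹' shell G t)) ∧
    Tendsto (fun t => ∫ w in W ∩ (fun w => e.symm (w, (e x).2)) ⁻¹' shell G t,
      a w • integrand k p G φ F H (e.symm (w, (e x).2))) atBot
      (𝓝 (((a 0 * Real.exp (-φ x) : ℝ) : ℂ) * normalForm k p (γ x) P Q)) := by
  have symm_continuousOn : ContinuousOn (fun w => e.symm (w, (e x).2)) W :=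
    e.continuousOn_symm.comp (by fun_prop) hWT
  have symm_mem : ∀ w ∈ W, e.symm (w, (e x).2) ∈ e.source := fun w hw => e.map_target (hWT w hw)
  have hγW := hγ.1.comp symm_continuousOn symm_mem
  have hφW := hφ.comp symm_continuousOn symm_mem
  have limit := tendsto_integral_shellIntegrand
    (A := fun w => a w * Real.exp (-φ (e.symm (w, (e x).2)))) hk hp hW hW0 hγW hlow
    (ha.mul hφW.neg.rexp) hF hH hP hQ hFP hHQ
  simp only [Function.comp_apply, he.symm_zero hx hxS] at limit
  have hmeas := fun t =>
    (isOpen_vshell hW (continuousOn_two_mul_log_norm_add hγW) t).measurableSet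
  have integrand_eq : ∀ w ∈ W, w ≠ 0 → a w • integrand k p G φ F H (e.symm (w, (e x).2)) =
      ((a w * Real.exp (-φ (e.symm (w, (e x).2))) : ℝ) : ℂ) *
        shellIntegrand k p (fun w => 2 * Real.log ‖w‖ + γ (e.symm (w, (e x).2)))
          (fun w => F (e.symm (w, (e x).2))) (fun w => H (e.symm (w, (e x).2))) w := by
    intro w hw hw0
    rw [integrand_symm_eq_shellIntegrand hγ (hWT w hw) hw0, Complex.real_smul, ← mul_assoc,
      ← Complex.ofReal_mul]
  simp only [preimage_shell_eq_vshell hγ hWT]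
  constructor
  · exact limit.1.mono fun t ht =>
      (integrableOn_congr_fun (fun w hw => integrand_eq w hw.1 hw.2.1) (hmeas t)).2 ht
  · exact limit.2.congr fun t =>
      (setIntegral_congr_fun (hmeas t) fun w hw => integrand_eq w hw.1 hw.2.1).symm

end GreenSlice

/-! ### Integration against densities on parametrized sets -/

section Push

variable {X Y : Type*} [MeasurableSpace X] {μ : Measure X} {W : Set X} {ι : X → Y} {a : X → ℝ}

/-- The image under `ι` of the measure `a dμ` on `W`: the common form of `chartVolume` and
`sliceVolume`. -/
def pushDensity [MeasurableSpace Y] (μ : Measure X) (W : Set X) (ι : X → Y) (a : X → ℝ) :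
    Measure Y :=
  Measure.map ι ((μ.restrict W).withDensity fun w => ENNReal.ofReal (a w))

variable [TopologicalSpace X] [BorelSpace X] [TopologicalSpace Y] [MeasurableSpace Y] [BorelSpace Y]

theorem aemeasurable_restrict_withDensity (hW : MeasurableSet W) (hι : ContinuousOn ι W) :
    AEMeasurable ι ((μ.restrict W).withDensity fun w => ENNReal.ofReal (a w)) :=
  (hι.aemeasurable hW).mono_ac (withDensity_absolutelyContinuous _ _)

theorem ae_pushDensity_mem (hW : MeasurableSet W) (hι : ContinuousOn ι W) {s : Set Y}
    (hs : MeasurableSet s) (hιs : Set.MapsTo ι W s) : ∀ᵐ y ∂pushDensity μ W ι a, y ∈ s := by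
  rw [pushDensity, ae_map_iff (p := (· ∈ s)) (aemeasurable_restrict_withDensity hW hι) hs]
  refine (withDensity_absolutelyContinuous _ _).ae_le ?_
  filter_upwards [ae_restrict_mem hW] with w hw using hιs hw

theorem aestronglyMeasurable_comp_of_pushDensity [TopologicalSpace.PseudoMetrizableSpace Y]
    (hW : MeasurableSet W) (hι : ContinuousOn ι W) (ha : AEMeasurable a (μ.restrict W))
    (ha0 : ∀ w ∈ W, 0 < a w) {h : Y → ℂ} (hh : AEStronglyMeasurable h (pushDensity μ W ι a)) :
    AEStronglyMeasurable (fun w => h (ι w)) (μ.restrict W) := by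
  refine (hh.comp_aemeasurable (aemeasurable_restrict_withDensity hW hι)).mono_ac
    (withDensity_absolutelyContinuous' ha.ennreal_ofReal ?_)
  filter_upwards [ae_restrict_mem hW] with w hw
  simpa using ha0 w hw

theorem measurableSet_inter_preimage (hW : MeasurableSet W) (hι : ContinuousOn ι W) {s : Set Y}
    (hs : MeasurableSet s) : MeasurableSet (W ∩ ι ⁻¹' s) := by
  rw [← Subtype.image_preimage_coe]
  exact hW.subtype_image (hι.domRestrict.measurable hs)

theorem pushDensity_apply [SFinite μ] (hW : MeasurableSet W) (hι : ContinuousOn ι W) {s : Set Y}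
    (hs : MeasurableSet s) :
    pushDensity μ W ι a s = ∫⁻ w in W ∩ ι ⁻¹' s, ENNReal.ofReal (a w) ∂μ := by
  rw [pushDensity, Measure.map_apply_of_aemeasurable (aemeasurable_restrict_withDensity hW hι) hs,
    withDensity_apply', Measure.restrict_restrict' hW, Set.inter_comm]

variable [PolishSpace X] [T2Space Y] [SFinite μ]

theorem exists_map_eq_pushDensity (hW : MeasurableSet W) (hι : ContinuousOn ι W)
    (hinj : Set.InjOn ι W) :
    ∃ ν : Measure W, MeasurableEmbedding (W.domRestrict ι) ∧
      pushDensity μ W ι a = ν.map (W.domRestrict ι) ∧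
      ∀ s : Set X, (ν.restrict (Subtype.val ⁻¹' s)).map Subtype.val =
        (μ.restrict (W ∩ s)).withDensity fun w => ENNReal.ofReal (a w) := by
  set ρ := (μ.restrict W).withDensity fun w => ENNReal.ofReal (a w) with hρ
  have map_val : (ρ.comap Subtype.val : Measure W).map Subtype.val = ρ := by
    rw [map_comap_subtype_coe hW]
    refine Measure.restrict_eq_self_of_ae_mem ?_
    exact (withDensity_absolutelyContinuous _ _).ae_le (ae_restrict_mem hW)
  refine ⟨ρ.comap Subtype.val, hι.measurableEmbedding hW hinj, ?_, fun s => ?_⟩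
  · have hι_ae : AEMeasurable ι ((ρ.comap Subtype.val : Measure W).map Subtype.val) := by
      rw [map_val]
      exact aemeasurable_restrict_withDensity hW hι
    have map_map := hι_ae.map_map_of_aemeasurable measurable_subtype_coe.aemeasurable
    rw [map_val] at map_map
    exact map_map
  · rw [← (MeasurableEmbedding.subtype_coe hW).restrict_map, map_val, hρ, restrict_withDensity',
      Measure.restrict_restrict' hW, Set.inter_comm]

theorem integrableOn_pushDensity (hW : MeasurableSet W) (hι : ContinuousOn ι W)
    (hinj : Set.InjOn ι W) (ha : AEMeasurable a (μ.restrict W)) (ha0 : ∀ w ∈ W, 0 ≤ a w)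
    (h : Y → ℂ) (s : Set Y) :
    IntegrableOn h s (pushDensity μ W ι a) ↔
      IntegrableOn (fun w => a w • h (ι w)) (W ∩ ι ⁻¹' s) μ := by
  obtain ⟨ν, hemb, push_eq, map_val⟩ := exists_map_eq_pushDensity (μ := μ) (a := a) hW hι hinj
  have restrict_le : μ.restrict (W ∩ ι ⁻¹' s) ≤ μ.restrict W :=
    Measure.restrict_mono Set.inter_subset_left le_rfl
  rw [IntegrableOn, push_eq, hemb.restrict_map, hemb.integrable_map_iff]
  change Integrable ((h ∘ ι) ∘ Subtype.val) (ν.restrict (Subtype.val ⁻¹' (ι ⁻¹' s))) ↔ _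
  rw [← (MeasurableEmbedding.subtype_coe hW).integrable_map_iff, map_val,
    integrable_withDensity_iff_integrable_smul₀' (ha.mono_measure restrict_le).ennreal_ofReal
      (Eventually.of_forall fun _ => ENNReal.ofReal_lt_top)]
  refine integrable_congr ?_
  filter_upwards [ae_mono restrict_le (ae_restrict_mem hW)] with w hw
  rw [ENNReal.toReal_ofReal (ha0 w hw), Function.comp_apply]

theorem setIntegral_pushDensity (hW : MeasurableSet W) (hι : ContinuousOn ι W)
    (hinj : Set.InjOn ι W) (ha : AEMeasurable a (μ.restrict W)) (ha0 : ∀ w ∈ W, 0 ≤ a w)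
    (h : Y → ℂ) (s : Set Y) :
    ∫ y in s, h y ∂(pushDensity μ W ι a) = ∫ w in W ∩ ι ⁻¹' s, a w • h (ι w) ∂μ := by
  obtain ⟨ν, hemb, push_eq, map_val⟩ := exists_map_eq_pushDensity (μ := μ) (a := a) hW hι hinj
  have restrict_le : μ.restrict (W ∩ ι ⁻¹' s) ≤ μ.restrict W :=
    Measure.restrict_mono Set.inter_subset_left le_rfl
  rw [push_eq, hemb.restrict_map, hemb.integral_map]
  change ∫ w, (h ∘ ι) (Subtype.val w) ∂(ν.restrict (Subtype.val ⁻¹' (ι ⁻¹' s))) = _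
  rw [← (MeasurableEmbedding.subtype_coe hW).integral_map, map_val,
    integral_withDensity_eq_integral_toReal_smul₀ (ha.mono_measure restrict_le).ennreal_ofReal
      (Eventually.of_forall fun _ => ENNReal.ofReal_lt_top)]
  refine integral_congr_ae ?_
  filter_upwards [ae_mono restrict_le (ae_restrict_mem hW)] with w hw
  rw [ENNReal.toReal_ofReal (ha0 w hw), Function.comp_apply]

end Push

/-! ### The limit over a slice -/

section Slice

variable {n k m : ℕ} {D S : Set (Cn n)} {G : Cn n → EReal} {φ : Cn n → ℝ} {e e' : Coord n k m}
  {U U' : Set (Cn n)} {x : Cn n} {p : ℕ}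

theorem IsAdaptedNhd.mem_source (hU : IsAdaptedNhd D S G e U x) : x ∈ e.source :=
  hU.closure_subset (subset_closure hU.mem)

theorem continuousOn_gramDet {X : Type*} {ι : Type} [TopologicalSpace X] [Fintype ι] [DecidableEq ι]
    {s : Set X} {v : X → ι → Cn n} (hv : ∀ i, ContinuousOn (fun z => v z i) s) :
    ContinuousOn (fun z => gramDet (v z)) s :=
  Complex.continuous_re.comp_continuousOn
    ((Continuous.matrix_det continuous_id).comp_continuousOn
      (continuousOn_pi.2 fun i => continuousOn_pi.2 fun j => (hv i).inner (hv j)))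

theorem IsSubmanifoldCoord.continuousOn_fderiv_symm (he : IsSubmanifoldCoord S e) :
    ContinuousOn (fderiv ℂ e.symm) e.target := fun _ hz =>
  (he.analyticAt_symm hz).fderiv.continuousAt.continuousWithinAt

theorem IsSubmanifoldCoord.continuousOn_ambientDensity (he : IsSubmanifoldCoord S e) :
    ContinuousOn (ambientDensity e) e.target :=
  continuousOn_gramDet fun _ => he.continuousOn_fderiv_symm.clm_apply continuousOn_const

theorem IsSubmanifoldCoord.continuousOn_subDensity (he : IsSubmanifoldCoord S e) :
    ContinuousOn (subDensity e) {w : Cn m | ((0 : Cn k), w) ∈ e.target} :=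
  continuousOn_gramDet fun _ => (he.continuousOn_fderiv_symm.comp (f := fun w => (0, w))
    (by fun_prop) fun _ hw => hw).clm_apply continuousOn_const

/-- The coordinates `z'` of the points of the slice `U_x`. -/
def sliceDomain (e : Coord n k m) (U : Set (Cn n)) (x : Cn n) : Set (Cn k) :=
  {w : Cn k | (w, (e x).2) ∈ e.target ∧ e.symm (w, (e x).2) ∈ U}

/-- The density of `dV_{U_x}` with respect to `dλ(z')`. -/
def sliceDensity (e : Coord n k m) (x : Cn n) (w : Cn k) : ℝ :=
  ambientDensity e (w, (e x).2) / subDensity e (e x).2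

theorem sliceVolume_eq (e : Coord n k m) (U : Set (Cn n)) (x : Cn n) :
    sliceVolume e U x = pushDensity volume (sliceDomain e U x) (fun w => e.symm (w, (e x).2))
      (sliceDensity e x) := rfl

theorem isOpen_sliceDomain (hU : IsOpen U) : IsOpen (sliceDomain e U x) :=
  (e.symm.isOpen_inter_preimage hU).preimage (f := fun w : Cn k => (w, (e x).2)) (by fun_prop)

theorem continuousOn_symm_sliceDomain :
    ContinuousOn (fun w => e.symm (w, (e x).2)) (sliceDomain e U x) :=
  e.continuousOn_symm.comp (by fun_prop) fun _ hw => hw.1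

theorem injOn_symm_sliceDomain :
    Set.InjOn (fun w => e.symm (w, (e x).2)) (sliceDomain e U x) := fun _ hw _ hw' h =>
  congrArg Prod.fst (e.symm.injOn hw.1 hw'.1 h)

theorem IsAdaptedNhd.zero_mem_sliceDomain (hU : IsAdaptedNhd D S G e U x) :
    (0 : Cn k) ∈ sliceDomain e U x :=
  ⟨hU.adapted.zero_mem_target hU.mem_source hU.mem_S,
    (hU.adapted.symm_zero hU.mem_source hU.mem_S).symm ▸ hU.mem⟩

theorem IsAdaptedNhd.sliceDomain_mem_nhds (hU : IsAdaptedNhd D S G e U x) :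
    sliceDomain e U x ∈ 𝓝 0 :=
  (isOpen_sliceDomain hU.isOpen).mem_nhds hU.zero_mem_sliceDomain

theorem IsSubmanifoldCoord.continuousOn_sliceDensity (he : IsSubmanifoldCoord S e) :
    ContinuousOn (sliceDensity e x) (sliceDomain e U x) :=
  (he.continuousOn_ambientDensity.comp (by fun_prop) fun _ hw => hw.1).div_const _

theorem IsAdaptedNhd.sliceDensity_pos (hU : IsAdaptedNhd D S G e U x) {w : Cn k}
    (hw : w ∈ sliceDomain e U x) : 0 < sliceDensity e x w :=
  div_pos (hU.adapted.ambientDensity_pos hw.1)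
    (hU.adapted.subDensity_pos (hU.adapted.zero_mem_target hU.mem_source hU.mem_S))

theorem IsAdaptedNhd.tendsto_symm_slice (hU : IsAdaptedNhd D S G e U x) :
    Tendsto (fun w => e.symm (w, (e x).2)) (𝓝[≠] 0) (𝓝[slice e U x \ {x}] x) := by
  have symm_zero := hU.adapted.symm_zero hU.mem_source hU.mem_S
  refine tendsto_nhdsWithin_iff.2 ⟨?_, ?_⟩
  · have symm_tendsto :=
      (continuousOn_symm_sliceDomain.continuousAt hU.sliceDomain_mem_nhds).tendsto
    rw [symm_zero] at symm_tendsto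
    exact symm_tendsto.mono_left nhdsWithin_le_nhds
  · filter_upwards [nhdsWithin_le_nhds hU.sliceDomain_mem_nhds, self_mem_nhdsWithin] with w hw hw0
    refine ⟨⟨hw.2, by rw [e.right_inv hw.1]⟩, fun h => hw0 ?_⟩
    exact injOn_symm_sliceDomain hw hU.zero_mem_sliceDomain (h.trans symm_zero.symm)

theorem IsAdaptedNhd.isLittleO_comp_symm (hU : IsAdaptedNhd D S G e U x) {q : ℕ} {F : Cn n → ℂ}
    {P : MvPolynomial (Fin k) ℂ}
    (hFP : (fun y => F y - coordPoly e P y) =o[𝓝[slice e U x \ {x}] x] fun y => ‖(e y).1‖ ^ q) :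
    (fun w => F (e.symm (w, (e x).2)) - MvPolynomial.eval (fun i => w i) P) =o[𝓝[≠] 0]
      fun w => ‖w‖ ^ q := by
  refine (hFP.comp_tendsto hU.tendsto_symm_slice).congr' ?_ ?_ <;>
  filter_upwards [nhdsWithin_le_nhds hU.sliceDomain_mem_nhds] with w hw
  · simp only [Function.comp, coordPoly, e.right_inv hw.1]
  · simp only [Function.comp, e.right_inv hw.1]

/-- The value of the limit `(*)` for the polynomials `P` and `Q`, where `γ` is the continuous part
of `G` in the coordinates `e`. -/
def sliceForm (e : Coord n k m) (φ γ : Cn n → ℝ) (p : ℕ) (x : Cn n)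
    (P Q : MvPolynomial (Fin k) ℂ) : ℂ :=
  ((sliceDensity e x 0 * Real.exp (-φ x) : ℝ) : ℂ) * normalForm k p (γ x) P Q

theorem hasShellLimit_slice (hk : 1 ≤ k) (hp : 1 ≤ p) (hφ : ContinuousOn φ D)
    (hU : IsAdaptedNhd D S G e U x) {γ : Cn n → ℝ} (hγ : IsGreenPart G e γ)
    {P Q : MvPolynomial (Fin k) ℂ} (hP : P.IsHomogeneous (p - 1)) (hQ : Q.IsHomogeneous (p - 1))
    {F H : Cn n → ℂ} (hF : AEStronglyMeasurable F (sliceVolume e U x))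
    (hH : AEStronglyMeasurable H (sliceVolume e U x))
    (hFP : (fun y => F y - coordPoly e P y) =o[𝓝[slice e U x \ {x}] x]
      (fun y => ‖(e y).1‖ ^ (p - 1)))
    (hHQ : (fun y => H y - coordPoly e Q y) =o[𝓝[slice e U x \ {x}] x]
      (fun y => ‖(e y).1‖ ^ (p - 1))) :
    HasShellLimit k p G φ (sliceVolume e U x) F H (sliceForm e φ γ p x P Q) := by
  have he := hU.adapted.toIsSubmanifoldCoord
  have hW := isOpen_sliceDomain (e := e) (x := x) hU.isOpen
  have density_ae := he.continuousOn_sliceDensity.aemeasurable (μ := volume) hW.measurableSet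
  have density_pos : ∀ w ∈ sliceDomain e U x, 0 < sliceDensity e x w :=
    fun _ => hU.sliceDensity_pos
  obtain ⟨C, hC⟩ := hU.compact_closure.exists_bound_of_continuousOn (hγ.1.mono hU.closure_subset)
  have pull_measurable : ∀ {F : Cn n → ℂ}, AEStronglyMeasurable F (sliceVolume e U x) → _ :=
    fun hF => aestronglyMeasurable_comp_of_pushDensity hW.measurableSet
      continuousOn_symm_sliceDomain density_ae density_pos hF
  unfold HasShellLimit
  simp only [sliceVolume_eq, integrableOn_pushDensity hW.measurableSet
      continuousOn_symm_sliceDomain injOn_symm_sliceDomain density_ae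
      (fun w hw => (density_pos w hw).le),
    setIntegral_pushDensity hW.measurableSet continuousOn_symm_sliceDomain injOn_symm_sliceDomain
      density_ae (fun w hw => (density_pos w hw).le)]
  exact tendsto_integral_slice he hU.mem_source hU.mem_S hk hp hγ
    (hφ.mono hU.adapted.source_subset) hW hU.zero_mem_sliceDomain (fun w hw => hw.1)
    (fun w hw => (abs_le.1 (hC _ (subset_closure hw.2))).1) he.continuousOn_sliceDensity
    (pull_measurable hF) (pull_measurable hH) hP hQ (hU.isLittleO_comp_symm hFP)
    (hU.isLittleO_comp_symm hHQ)

theorem aestronglyMeasurable_sliceVolume (hU : IsAdaptedNhd D S G e U x) {F : Cn n → ℂ}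
    (hF : ContinuousOn F e.source) : AEStronglyMeasurable F (sliceVolume e U x) := by
  have mem_U : ∀ᵐ y ∂sliceVolume e U x, y ∈ U := ae_pushDensity_mem
    (isOpen_sliceDomain hU.isOpen).measurableSet continuousOn_symm_sliceDomain
    hU.isOpen.measurableSet fun w hw => hw.2
  rw [← Measure.restrict_eq_self_of_ae_mem mem_U]
  exact (hF.mono (subset_closure.trans hU.closure_subset)).aestronglyMeasurable
    hU.isOpen.measurableSet

theorem continuousOn_coordPoly (P : MvPolynomial (Fin k) ℂ) :
    ContinuousOn (coordPoly e P) e.source :=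
  (continuous_eval_euclidean P).comp_continuousOn (continuous_fst.comp_continuousOn e.continuousOn)

theorem hasShellLimit_coordPoly (hk : 1 ≤ k) (hp : 1 ≤ p) (hφ : ContinuousOn φ D)
    (hU : IsAdaptedNhd D S G e U x) {γ : Cn n → ℝ} (hγ : IsGreenPart G e γ)
    {P Q : MvPolynomial (Fin k) ℂ} (hP : P.IsHomogeneous (p - 1)) (hQ : Q.IsHomogeneous (p - 1)) :
    HasShellLimit k p G φ (sliceVolume e U x) (coordPoly e P) (coordPoly e Q)
      (sliceForm e φ γ p x P Q) := by
  refine hasShellLimit_slice hk hp hφ hU hγ hP hQ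
    (aestronglyMeasurable_sliceVolume hU (continuousOn_coordPoly P))
    (aestronglyMeasurable_sliceVolume hU (continuousOn_coordPoly Q)) ?_ ?_ <;>
  simpa only [sub_self] using isLittleO_zero _ _

theorem HasShellLimit.unique {μ : Measure (Cn n)} {F H : Cn n → ℂ} {c c' : ℂ}
    (h : HasShellLimit k p G φ μ F H c) (h' : HasShellLimit k p G φ μ F H c') : c = c' :=
  tendsto_nhds_unique h.2 h'.2

theorem sliceForm_eq_of_correspondsTo (hp : 1 ≤ p) (he : IsSubmanifoldCoord S e)
    (he' : IsSubmanifoldCoord S e') (hx : x ∈ e.source) (hx' : x ∈ e'.source) (hxS : x ∈ S)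
    {γ γ' : Cn n → ℝ} (hγ : IsGreenPart G e γ) (hγ' : IsGreenPart G e' γ') {f g : JetFibre S p x}
    {P Q P' Q' : MvPolynomial (Fin k) ℂ} (hP : CorrespondsTo S p e x f P)
    (hQ : CorrespondsTo S p e x g Q) (hP' : CorrespondsTo S p e' x f P')
    (hQ' : CorrespondsTo S p e' x g Q') :
    sliceForm e φ γ p x P Q = sliceForm e' φ γ' p x P' Q' := by
  unfold sliceForm sliceDensity
  rw [normalForm_eq_of_norm_eq (norm_normalD he he' hx hx' hxS hγ hγ')
    (hP.eval_trans he he' hx hx' hxS hp hP') (hQ.eval_trans he he' hx hx' hxS hp hQ'),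
    ← he.apply_eq hx hxS, ← he'.apply_eq hx' hxS, density_ratio_trans he he' hx hx' hxS]
  push_cast
  ring

theorem jetInner_eq_sliceForm (hk : 1 ≤ k) (hp : 1 ≤ p) (hφ : ContinuousOn φ D)
    (hU : IsAdaptedNhd D S G e U x) {γ : Cn n → ℝ} (hγ : IsGreenPart G e γ) {f g : JetFibre S p x}
    {P Q : MvPolynomial (Fin k) ℂ} (hP : CorrespondsTo S p e x f P)
    (hQ : CorrespondsTo S p e x g Q) :
    jetInner k m D S G φ p x f g = sliceForm e φ γ p x P Q := by
  have exists_limit : ∃ c : ℂ, ∃ (e : Coord n k m) (U : Set (Cn n))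
      (P Q : MvPolynomial (Fin k) ℂ),
      IsAdaptedNhd D S G e U x ∧ CorrespondsTo S p e x f P ∧ CorrespondsTo S p e x g Q ∧
      HasShellLimit k p G φ (sliceVolume e U x) (coordPoly e P) (coordPoly e Q) c :=
    ⟨_, e, U, P, Q, hU, hP, hQ, hasShellLimit_coordPoly hk hp hφ hU hγ hP.1 hQ.1⟩
  obtain ⟨e', U', P', Q', hU', hP', hQ', limit'⟩ := Classical.epsilon_spec exists_limit
  obtain ⟨γ', hγ'⟩ := hU'.adapted.green
  calc jetInner k m D S G φ p x f g = sliceForm e' φ γ' p x P' Q' :=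
        limit'.unique (hasShellLimit_coordPoly hk hp hφ hU' hγ' hP'.1 hQ'.1)
    _ = sliceForm e φ γ p x P Q :=
        sliceForm_eq_of_correspondsTo hp hU'.adapted.toIsSubmanifoldCoord
          hU.adapted.toIsSubmanifoldCoord hU'.mem_source hU.mem_source hU.mem_S hγ' hγ hP' hQ' hP hQ

end Slice

/-! ### The volume of the submanifold -/

section SubVolume

variable {n k m : ℕ} {S : Set (Cn n)} {e e' : Coord n k m} {v : Cn m}

/-- The coordinates `z''` of the points of `S` in the domain of `e`. -/
def subDomain (e : Coord n k m) : Set (Cn m) := {v : Cn m | ((0 : Cn k), v) ∈ e.target}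

theorem chartVolume_eq (e : Coord n k m) : chartVolume e =
    pushDensity volume (subDomain e) (fun v => e.symm (0, v)) (subDensity e) := rfl

theorem isOpen_subDomain : IsOpen (subDomain e) :=
  e.open_target.preimage (f := fun v : Cn m => ((0 : Cn k), v)) (by fun_prop)

theorem continuousOn_symm_subDomain : ContinuousOn (fun v => e.symm (0, v)) (subDomain e) :=
  e.continuousOn_symm.comp (by fun_prop) fun _ hv => hv

theorem injOn_symm_subDomain : Set.InjOn (fun v => e.symm (0, v)) (subDomain e) :=
  fun _ hv _ hv' h => congrArg Prod.snd (e.symm.injOn hv hv' h)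

theorem IsSubmanifoldCoord.symm_mem_of_mem_subDomain (he : IsSubmanifoldCoord S e)
    (hv : v ∈ subDomain e) : e.symm (0, v) ∈ S :=
  (he.symm_mem_iff hv).2 rfl

/-- The change of the coordinates `z''` on `S` from `e` to `e'`. -/
def subTrans (e e' : Coord n k m) (v : Cn m) : Cn m := (e' (e.symm (0, v))).2

theorem symm_subTrans (he : IsSubmanifoldCoord S e) (he' : IsSubmanifoldCoord S e')
    (hv : v ∈ subDomain e) (hv' : e.symm (0, v) ∈ e'.source) :
    e'.symm (0, subTrans e e' v) = e.symm (0, v) :=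
  he'.symm_zero hv' (he.symm_mem_of_mem_subDomain hv)

theorem subTrans_mem_subDomain (he : IsSubmanifoldCoord S e) (he' : IsSubmanifoldCoord S e')
    (hv : v ∈ subDomain e) (hv' : e.symm (0, v) ∈ e'.source) : subTrans e e' v ∈ subDomain e' :=
  he'.zero_mem_target hv' (he.symm_mem_of_mem_subDomain hv)

theorem injOn_subTrans (he : IsSubmanifoldCoord S e) (he' : IsSubmanifoldCoord S e') :
    Set.InjOn (subTrans e e') (subDomain e ∩ (fun v => e.symm (0, v)) ⁻¹' e'.source) := by
  intro v hv w hw h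
  refine injOn_symm_subDomain hv.1 hw.1 ?_
  simpa only [symm_subTrans he he' hv.1 hv.2, symm_subTrans he he' hw.1 hw.2]
    using congrArg (fun u => e'.symm (0, u)) h

theorem hasFDerivAt_subTrans (he : IsSubmanifoldCoord S e) (he' : IsSubmanifoldCoord S e')
    (hv : v ∈ subDomain e) (hv' : e.symm (0, v) ∈ e'.source) :
    HasFDerivAt (subTrans e e') (tangentD e e' (e.symm (0, v))) v := by
  have trans_deriv := hasFDerivAt_trans he he' (e.map_target hv) hv'
  rw [e.right_inv hv] at trans_deriv
  exact (trans_deriv.comp v (hasFDerivAt_prodMk_right (𝕜 := ℂ) (0 : Cn k) v)).snd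

theorem chartVolume_restrict_le (he : IsSubmanifoldCoord S e) (he' : IsSubmanifoldCoord S e') :
    (chartVolume e).restrict e'.source ≤ chartVolume e' := by
  refine Measure.le_iff.2 fun A hA => ?_
  rw [Measure.restrict_apply hA, chartVolume_eq, chartVolume_eq,
    pushDensity_apply isOpen_subDomain.measurableSet continuousOn_symm_subDomain
      (hA.inter e'.open_source.measurableSet),
    pushDensity_apply isOpen_subDomain.measurableSet continuousOn_symm_subDomain hA]
  set B := subDomain e ∩ (fun v => e.symm (0, v)) ⁻¹' (A ∩ e'.source)
  have hB : MeasurableSet B := measurableSet_inter_preimage isOpen_subDomain.measurableSet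
    continuousOn_symm_subDomain (hA.inter e'.open_source.measurableSet)
  have image_subset : subTrans e e' '' B ⊆ subDomain e' ∩ (fun v => e'.symm (0, v)) ⁻¹' A := by
    rintro _ ⟨v, hv, rfl⟩
    refine ⟨subTrans_mem_subDomain he he' hv.1 hv.2.2, ?_⟩
    simpa only [Set.mem_preimage, symm_subTrans he he' hv.1 hv.2.2] using hv.2.1
  have subDensity_eq : ∀ v ∈ B, subDensity e v =
      |((tangentD e e' (e.symm (0, v))).restrictScalars ℝ).det| *
        subDensity e' (subTrans e e' v) := by
    intro v hv
    rw [abs_det_restrictScalars, subTrans]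
    simpa only [e.right_inv hv.1] using subDensity_trans he he' (e.map_target hv.1) hv.2.2
      (he.symm_mem_of_mem_subDomain hv.1)
  calc ∫⁻ v in B, ENNReal.ofReal (subDensity e v)
      = ∫⁻ v in B, ENNReal.ofReal |((tangentD e e' (e.symm (0, v))).restrictScalars ℝ).det| *
          ENNReal.ofReal (subDensity e' (subTrans e e' v)) :=
        setLIntegral_congr_fun hB fun v hv => by
          rw [subDensity_eq v hv, ENNReal.ofReal_mul (abs_nonneg _)]
    _ = ∫⁻ v in subTrans e e' '' B, ENNReal.ofReal (subDensity e' v) :=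
        (lintegral_image_eq_lintegral_abs_det_fderiv_mul volume hB
          (fun v hv => ((hasFDerivAt_subTrans he he' hv.1 hv.2.2).restrictScalars
            ℝ).hasFDerivWithinAt)
          ((injOn_subTrans he he').mono (Set.inter_subset_inter_right _
            fun _ h => h.2)) fun v => ENNReal.ofReal (subDensity e' v)).symm
    _ ≤ _ := lintegral_mono_set image_subset

theorem ae_chartVolume_mem (he : IsSubmanifoldCoord S e) {A : Set (Cn n)} (hA : MeasurableSet A)
    (h : e.source ∩ S ⊆ A) : ∀ᵐ y ∂chartVolume e, y ∈ A :=
  ae_pushDensity_mem isOpen_subDomain.measurableSet continuousOn_symm_subDomain hA fun _ hv =>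
    h ⟨e.map_target hv, he.symm_mem_of_mem_subDomain hv⟩

theorem subVolume_restrict_source (he : IsSubmanifoldCoord S e) :
    (subVolume k m S).restrict e.source = chartVolume e := by
  have hsource := e.open_source.measurableSet
  have chart_restrict : (chartVolume e).restrict e.source = chartVolume e :=
    Measure.restrict_eq_self_of_ae_mem (ae_chartVolume_mem he hsource Set.inter_subset_left)
  -- Off `e.source` the other `chartVolume e'` are compared with `⊤`, which the restriction kills.
  have subVolume_le : subVolume k m S ≤ chartVolume e + (⊤ : Measure (Cn n)).restrict e.sourceᶜ :=
    iSup₂_le fun e' he' => calc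
      chartVolume e' = (chartVolume e').restrict e.source + (chartVolume e').restrict e.sourceᶜ :=
        (Measure.restrict_add_restrict_compl hsource).symm
      _ ≤ _ := add_le_add (chartVolume_restrict_le he' he)
        (Measure.restrict_mono_measure le_top _)
  refine le_antisymm ((Measure.restrict_mono_measure subVolume_le _).trans_eq ?_) ?_
  · rw [Measure.restrict_add, chart_restrict, Measure.restrict_restrict hsource,
      Set.inter_compl_self, Measure.restrict_empty, add_zero]
  · rw [← chart_restrict]
    exact Measure.restrict_mono_measure (le_iSup₂_of_le e he le_rfl) _

theorem subVolume_restrict_of_subset (he : IsSubmanifoldCoord S e) {V : Set (Cn n)}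
    (hV : V ⊆ e.source) : (subVolume k m S).restrict V = (chartVolume e).restrict V := by
  rw [← subVolume_restrict_source he, Measure.restrict_restrict' e.open_source.measurableSet,
    Set.inter_eq_self_of_subset_left hV]

theorem ae_subVolume_mem (hS : MeasurableSet S) : ∀ᵐ y ∂subVolume k m S, y ∈ S := by
  have subVolume_le : subVolume k m S ≤ (⊤ : Measure (Cn n)).restrict S :=
    iSup₂_le fun e he => calc
      chartVolume e = (chartVolume e).restrict S :=
        (Measure.restrict_eq_self_of_ae_mem (ae_chartVolume_mem he hS Set.inter_subset_right)).symm
      _ ≤ _ := Measure.restrict_mono_measure le_top _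
  exact ae_mono subVolume_le (ae_restrict_mem hS)

end SubVolume

/-! ### Lebesgue measure in coordinates -/

section Ambient

variable {n k m : ℕ} {S : Set (Cn n)} {e : Coord n k m} {B : Set (Cn k × Cn m)}

/-- The isometry from the Euclidean product `ℂᵏ × ℂᵐ` onto `ℂⁿ`. -/
def prodIsometry (hn : k + m = n) : WithLp 2 (Cn k × Cn m) ≃ₗᵢ[ℂ] Cn n :=
  ((EuclideanSpace.basisFun (Fin k) ℂ).prod (EuclideanSpace.basisFun (Fin m) ℂ)).equiv
    (EuclideanSpace.basisFun (Fin n) ℂ) (finSumFinEquiv.trans (finCongr hn))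

/-- `prodIsometry` on the product `Cn k × Cn m` with its sup norm, in which coordinates take their
values. -/
def prodEquiv (hn : k + m = n) : (Cn k × Cn m) ≃L[ℂ] Cn n :=
  (WithLp.prodContinuousLinearEquiv 2 ℂ (Cn k) (Cn m)).symm.trans
    (prodIsometry hn).toContinuousLinearEquiv

theorem prodEquiv_apply (hn : k + m = n) (z : Cn k × Cn m) :
    prodEquiv hn z = prodIsometry hn (WithLp.toLp 2 z) := rfl

theorem measurePreserving_prodEquiv (hn : k + m = n) :
    MeasurePreserving (prodEquiv hn : Cn k × Cn m → Cn n) := by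
  let realIsometry : WithLp 2 (Cn k × Cn m) ≃ₗᵢ[ℝ] Cn n :=
    { toLinearEquiv := (prodIsometry hn).toLinearEquiv.restrictScalars ℝ
      norm_map' := (prodIsometry hn).norm_map }
  exact realIsometry.measurePreserving.comp (WithLp.volume_preserving_toLp (Cn k) (Cn m))

theorem measurableEmbedding_prodEquiv (hn : k + m = n) : MeasurableEmbedding (prodEquiv hn) :=
  (prodEquiv hn).toHomeomorph.measurableEmbedding

theorem gramDet_prodEquiv (hn : k + m = n) :
    gramDet (fun s => prodEquiv hn (prodBasis k m s)) = 1 := by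
  have toLp_prodBasis : ∀ s, WithLp.toLp 2 (prodBasis k m s) =
      (EuclideanSpace.basisFun (Fin k) ℂ).prod (EuclideanSpace.basisFun (Fin m) ℂ) s := by
    rintro (i | j) <;> simp [prodBasis_apply, OrthonormalBasis.prod_apply]
  have gram_eq_one : Matrix.gram ℂ (fun s => prodEquiv hn (prodBasis k m s)) = 1 := by
    rw [Matrix.gram_eq_one_iff_orthonormal]
    simp only [prodEquiv_apply, toLp_prodBasis]
    exact (OrthonormalBasis.orthonormal _).comp_linearIsometryEquiv _
  rw [gramDet, gram_eq_one, Matrix.det_one, Complex.one_re]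

theorem abs_det_symm_eq_ambientDensity (hn : k + m = n) (z : Cn k × Cn m) :
    |((((prodEquiv hn).symm : Cn n →L[ℂ] Cn k × Cn m).comp (fderiv ℂ e.symm z)).restrictScalars
      ℝ).det| = ambientDensity e z := by
  have gramDet_eq := gramDet_comp (prodBasis k m) (prodEquiv hn : (Cn k × Cn m) →ₗ[ℂ] Cn n)
    ((((prodEquiv hn).symm : Cn n →L[ℂ] Cn k × Cn m).comp (fderiv ℂ e.symm z)) :
      (Cn k × Cn m) →ₗ[ℂ] Cn k × Cn m)
  have gramDet_one := gramDet_prodEquiv (k := k) (m := m) hn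
  simp only [LinearEquiv.coe_coe, ContinuousLinearEquiv.coe_toLinearEquiv,
    ContinuousLinearMap.coe_coe, ContinuousLinearMap.comp_apply, ContinuousLinearEquiv.coe_coe,
    ContinuousLinearEquiv.apply_symm_apply, gramDet_one, mul_one] at gramDet_eq
  rw [abs_det_restrictScalars, ← gramDet_eq, ambientDensity]
  simp only [← prodBasis_apply]

theorem IsSubmanifoldCoord.hasFDerivWithinAt_prodEquiv_symm (he : IsSubmanifoldCoord S e)
    (hn : k + m = n) (hBT : B ⊆ e.target) : ∀ z ∈ B,
      HasFDerivWithinAt (fun z => (prodEquiv hn).symm (e.symm z))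
        ((((prodEquiv hn).symm : Cn n →L[ℂ] Cn k × Cn m).comp (fderiv ℂ e.symm z)).restrictScalars
          ℝ) B z := fun _ hz =>
  (((prodEquiv hn).symm.hasFDerivAt.comp _ (he.hasFDerivAt_symm (hBT hz))).restrictScalars
    ℝ).hasFDerivWithinAt

theorem injOn_prodEquiv_symm (hn : k + m = n) (hBT : B ⊆ e.target) :
    Set.InjOn (fun z => (prodEquiv hn).symm (e.symm z)) B :=
  (prodEquiv hn).symm.injective.comp_injOn (e.symm.injOn.mono hBT)

theorem prodEquiv_image_symm (hn : k + m = n) (B : Set (Cn k × Cn m)) :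
    prodEquiv hn '' ((fun z => (prodEquiv hn).symm (e.symm z)) '' B) = e.symm '' B := by
  simp only [Set.image_image, ContinuousLinearEquiv.apply_symm_apply]

instance isAddHaarMeasure_volume_prod : (volume : Measure (Cn k × Cn m)).IsAddHaarMeasure :=
  Measure.prod.instIsAddHaarMeasure volume volume

theorem integral_symm_image (he : IsSubmanifoldCoord S e) (hn : k + m = n) (hB : MeasurableSet B)
    (hBT : B ⊆ e.target) (h : Cn n → ℂ) :
    ∫ y in e.symm '' B, h y = ∫ z in B, ambientDensity e z • h (e.symm z) := by
  rw [← prodEquiv_image_symm hn B, (measurePreserving_prodEquiv hn).setIntegral_image_emb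
      (measurableEmbedding_prodEquiv hn),
    integral_image_eq_integral_abs_det_fderiv_smul volume hB
      (he.hasFDerivWithinAt_prodEquiv_symm hn hBT) (injOn_prodEquiv_symm hn hBT)]
  simp only [abs_det_symm_eq_ambientDensity, ContinuousLinearEquiv.apply_symm_apply]

theorem integrableOn_symm_image (he : IsSubmanifoldCoord S e) (hn : k + m = n)
    (hB : MeasurableSet B) (hBT : B ⊆ e.target) (h : Cn n → ℂ) :
    IntegrableOn h (e.symm '' B) ↔
      IntegrableOn (fun z => ambientDensity e z • h (e.symm z)) B := by
  rw [← prodEquiv_image_symm hn B, (measurePreserving_prodEquiv hn).integrableOn_image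
      (measurableEmbedding_prodEquiv hn),
    integrableOn_image_iff_integrableOn_abs_det_fderiv_smul volume hB
      (he.hasFDerivWithinAt_prodEquiv_symm hn hBT) (injOn_prodEquiv_symm hn hBT)]
  simp only [abs_det_symm_eq_ambientDensity, Function.comp_def,
    ContinuousLinearEquiv.apply_symm_apply]

end Ambient

/-! ### Functions vanishing to high order -/

section Taylor

variable {E F : Type*} [NormedAddCommGroup E] [NormedSpace ℝ E] [NormedAddCommGroup F]
  [NormedSpace ℝ F]

theorem eq_zero_of_pow_smul_isLittleO {c : F} {j : ℕ}
    (h : (fun s : ℝ => s ^ j • c) =o[𝓝[>] 0] fun s => s ^ j) : c = 0 := by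
  have hconst : (fun _ : ℝ => c) =o[𝓝[>] 0] fun _ : ℝ => (1 : ℝ) := by
    refine ((isBigO_refl (fun s : ℝ => (s ^ j)⁻¹) (𝓝[>] 0)).smul_isLittleO h).congr' ?_ ?_ <;>
    filter_upwards [self_mem_nhdsWithin] with s hs
    · rw [inv_smul_smul₀ (pow_ne_zero j (ne_of_gt hs))]
    · rw [smul_eq_mul, inv_mul_cancel₀ (pow_ne_zero j (ne_of_gt hs))]
  exact tendsto_nhds_unique tendsto_const_nhds ((isLittleO_one_iff ℝ).1 hconst)

theorem iteratedDerivWithin_eq_zero_of_isBigO {f : ℝ → F} {q : ℕ}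
    (hf : ContDiffOn ℝ q f (Set.Icc 0 1)) (h0 : f =O[𝓝[>] 0] fun s => s ^ (q + 1)) {j : ℕ}
    (hj : j ≤ q) : iteratedDerivWithin j f (Set.Icc 0 1) 0 = 0 := by
  induction j using Nat.strong_induction_on with
  | _ j ih =>
    have htaylor : ∀ s : ℝ, taylorWithinEval f j (Set.Icc 0 1) 0 s =
        s ^ j • ((j.factorial : ℝ)⁻¹ • iteratedDerivWithin j f (Set.Icc 0 1) 0) := fun s => by
      rw [taylor_within_apply, Finset.sum_range_succ, Finset.sum_eq_zero, zero_add, sub_zero,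
        smul_smul, mul_comm]
      intro i hi
      have hij := Finset.mem_range.1 hi
      rw [ih i hij (hij.le.trans hj), smul_zero]
    have hremainder : (fun s : ℝ => f s - taylorWithinEval f j (Set.Icc 0 1) 0 s)
        =o[𝓝[>] 0] fun s => s ^ j := by
      have := taylor_isLittleO (convex_Icc 0 1) (Set.left_mem_Icc.2 zero_le_one)
        (hf.of_le (by exact_mod_cast hj))
      simp only [sub_zero] at this
      exact this.mono (nhdsWithin_le_of_mem (Icc_mem_nhdsGT zero_lt_one))
    have hfj : f =o[𝓝[>] 0] fun s => s ^ j :=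
      h0.trans_isLittleO ((isLittleO_pow_pow (by omega)).mono nhdsWithin_le_nhds)
    have hpoly := hfj.sub hremainder
    simp only [sub_sub_cancel, htaylor] at hpoly
    exact (smul_eq_zero_iff_right (by positivity)).1 (eq_zero_of_pow_smul_isLittleO hpoly)

theorem norm_le_mul_pow_of_isBigO {f : ℝ → F} {q : ℕ} {C : ℝ}
    (hf : ContDiffOn ℝ (q + 1 : ℕ) f (Set.Icc 0 1)) (h0 : f =O[𝓝[>] 0] fun s => s ^ (q + 1))
    (hC : ∀ s ∈ Set.Icc (0 : ℝ) 1, ‖iteratedDerivWithin (q + 1) f (Set.Icc 0 1) s‖ ≤ C) {s : ℝ}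
    (hs : s ∈ Set.Icc (0 : ℝ) 1) : ‖f s‖ ≤ C * s ^ (q + 1) := by
  have hbound := taylor_mean_remainder_bound zero_le_one (by exact_mod_cast hf) hs hC
  have htaylor : taylorWithinEval f q (Set.Icc 0 1) 0 s = 0 := by
    rw [taylor_within_apply]
    refine Finset.sum_eq_zero fun j hj => ?_
    rw [iteratedDerivWithin_eq_zero_of_isBigO (hf.of_le (by exact_mod_cast q.le_succ)) h0
      (Finset.mem_range_succ_iff.1 hj), smul_zero]
  rw [htaylor, sub_zero, sub_zero] at hbound
  have hC0 : 0 ≤ C := (norm_nonneg _).trans (hC s hs)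
  refine hbound.trans (div_le_self (mul_nonneg hC0 (pow_nonneg hs.1 _)) ?_)
  exact_mod_cast q.factorial_pos

theorem norm_iteratedDeriv_comp_line_le {Φ : E → F} {O : Set E} {q : ℕ} (hO : IsOpen O)
    (hΦ : ContDiffOn ℝ q Φ O) {a w : E} {s : ℝ} (hs : a + s • w ∈ O) :
    ‖iteratedDeriv q (fun s : ℝ => Φ (a + s • w)) s‖ ≤
      ‖iteratedFDeriv ℝ q Φ (a + s • w)‖ * ‖w‖ ^ q := by
  let L : ℝ →L[ℝ] E := ContinuousLinearMap.toSpanSingleton ℝ w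
  have hOa : IsOpen ((a + ·) ⁻¹' O) := hO.preimage (by fun_prop)
  have hΦa : ContDiffOn ℝ q (fun y => Φ (a + y)) ((a + ·) ⁻¹' O) :=
    hΦ.comp (by fun_prop) fun y hy => hy
  have hLs : L s ∈ (a + ·) ⁻¹' O := hs
  have hOL : IsOpen (L ⁻¹' ((a + ·) ⁻¹' O)) := hOa.preimage L.continuous
  have hcomp := L.iteratedFDerivWithin_comp_right hΦa hOa.uniqueDiffOn hOL.uniqueDiffOn
    hLs le_rfl
  rw [iteratedFDerivWithin_of_isOpen q hOL hLs, iteratedFDerivWithin_of_isOpen q hOa hLs,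
    iteratedFDeriv_comp_add_left] at hcomp
  rw [← norm_iteratedFDeriv_eq_norm_iteratedDeriv]
  refine (congrArg norm hcomp).trans_le
    ((ContinuousMultilinearMap.norm_compContinuousLinearMap_le _ _).trans_eq ?_)
  simp [L, ContinuousLinearMap.norm_toSpanSingleton]

theorem norm_le_mul_norm_pow_of_segment {Φ : E → F} {O : Set E} {q : ℕ} {C : ℝ} {a w : E}
    (hO : IsOpen O) (hΦ : ContDiffOn ℝ q Φ O) (hseg : ∀ s ∈ Set.Icc (0 : ℝ) 1, a + s • w ∈ O)
    (hC : ∀ s ∈ Set.Icc (0 : ℝ) 1, ‖iteratedFDeriv ℝ q Φ (a + s • w)‖ ≤ C)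
    (h0 : (fun s : ℝ => Φ (a + s • w)) =O[𝓝[>] 0] fun s => s ^ q) :
    ‖Φ (a + w)‖ ≤ C * ‖w‖ ^ q := by
  have hone : (1 : ℝ) ∈ Set.Icc (0 : ℝ) 1 := Set.right_mem_Icc.2 zero_le_one
  rcases q with _ | q
  · simpa using hC 1 hone
  · have hcont : ∀ s ∈ Set.Icc (0 : ℝ) 1,
        ContDiffAt ℝ (q + 1 : ℕ) (fun s : ℝ => Φ (a + s • w)) s := fun s hs =>
      (hΦ.contDiffAt (hO.mem_nhds (hseg s hs))).comp s (by fun_prop)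
    have hline := norm_le_mul_pow_of_isBigO (fun s hs => (hcont s hs).contDiffWithinAt) h0
      (C := C * ‖w‖ ^ (q + 1)) (fun s hs => ?_) hone
    · simpa using hline
    · rw [iteratedDerivWithin_eq_iteratedDeriv (uniqueDiffOn_Icc zero_lt_one) (hcont s hs) hs]
      refine (norm_iteratedDeriv_comp_line_le hO hΦ (hseg s hs)).trans ?_
      gcongr
      exact hC s hs

theorem exists_norm_le_mul_norm_fst_pow {E' : Type*} [NormedAddCommGroup E'] [NormedSpace ℝ E']
    {Φ : E × E' → F} {O K : Set (E × E')} {q : ℕ} (hO : IsOpen O) (hΦ : ContDiffOn ℝ q Φ O)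
    (hK : IsCompact K) (hKO : K ⊆ O)
    (hstar : ∀ z ∈ K, ∀ s ∈ Set.Icc (0 : ℝ) 1, (s • z.1, z.2) ∈ K)
    (hvan : ∀ z ∈ K, (fun w => Φ (w, z.2)) =O[𝓝 0] fun w => ‖w‖ ^ q) :
    ∃ C, 0 ≤ C ∧ ∀ z ∈ K, ‖Φ z‖ ≤ C * ‖z.1‖ ^ q := by
  have hderiv : ContinuousOn (iteratedFDeriv ℝ q Φ) K :=
    ((hΦ.continuousOn_iteratedFDerivWithin le_rfl hO.uniqueDiffOn).congr fun z hz =>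
      (iteratedFDerivWithin_of_isOpen q hO hz).symm).mono hKO
  obtain ⟨C, hC⟩ := hK.exists_bound_of_continuousOn hderiv
  refine ⟨|C|, abs_nonneg C, fun z hz => ?_⟩
  have hline : ∀ s : ℝ, ((0 : E), z.2) + s • (z.1, (0 : E')) = (s • z.1, z.2) := fun s => by simp
  have hbound := norm_le_mul_norm_pow_of_segment (a := ((0 : E), z.2)) (w := (z.1, (0 : E')))
    (C := |C|) hO hΦ (fun s hs => hline s ▸ hKO (hstar z hz s hs))
    (fun s hs => hline s ▸ (hC _ (hstar z hz s hs)).trans (le_abs_self C)) ?_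
  · simpa [Prod.norm_def] using hbound
  · have htend : Tendsto (fun s : ℝ => s • z.1) (𝓝[>] 0) (𝓝 0) :=
      tendsto_nhdsWithin_of_tendsto_nhds
        (by simpa using (tendsto_id (x := 𝓝 (0 : ℝ))).smul_const z.1)
    simp only [hline]
    refine ((hvan z hz).comp_tendsto htend).trans
      (IsBigO.of_bound (‖z.1‖ ^ q) (Eventually.of_forall fun s => ?_))
    simp [norm_smul, mul_pow, mul_comm]

end Taylor

/-! ### Smooth extensions in coordinates -/

section Extension

variable {n k m p : ℕ} {D S : Set (Cn n)} {G : Cn n → EReal} {φ γ : Cn n → ℝ} {e : Coord n k m}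
  {x : Cn n} {f g : ∀ x, JetFibre S p x} {F H : Cn n → ℂ} {v₀ : Cn m} {r : ℝ}

theorem IsSubmanifoldCoord.contDiffOn_symm (he : IsSubmanifoldCoord S e) :
    ContDiffOn ℝ ∞ e.symm e.target := fun _ hz =>
  ((he.analyticAt_symm hz).contDiffAt.restrict_scalars ℝ).contDiffWithinAt

theorem IsSubmanifoldCoord.differentiableAt_symm_slice (he : IsSubmanifoldCoord S e)
    (hx : x ∈ e.source) (hxS : x ∈ S) :
    DifferentiableAt ℂ (fun w : Cn k => e.symm (w, (e x).2)) 0 :=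
  DifferentiableAt.comp (g := e.symm) (f := fun w : Cn k => (w, (e x).2)) _
    (he.analyticAt_symm (he.zero_mem_target hx hxS)).differentiableAt (by fun_prop)

theorem IsSmoothExtension.sub_coordPoly_isLittleO (hF : IsSmoothExtension D S p f F)
    (hxS : x ∈ S) (hp : 1 ≤ p) {P : MvPolynomial (Fin k) ℂ}
    (hP : CorrespondsTo S p e x (f x) P) :
    (fun y => F y - coordPoly e P y) =o[𝓝 x] fun y => ‖y - x‖ ^ (p - 1) := by
  obtain ⟨H, hH, hFH⟩ := hF.2 x hxS
  have hdist : Tendsto (fun y : Cn n => ‖y - x‖) (𝓝 x) (𝓝 0) :=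
    tendsto_norm_sub_self x
  have hrepr : (fun y => H y - coordPoly e P y) =o[𝓝 x] fun y => ‖y - x‖ ^ (p - 1) :=
    (hH.sub_isBigO hxS hp hP.2).trans_isLittleO
      ((isLittleO_pow_pow (by omega)).comp_tendsto hdist)
  simpa only [sub_add_sub_cancel] using hFH.add hrepr

theorem IsSmoothExtension.isLittleO_slice (hF : IsSmoothExtension D S p f F)
    (he : IsSubmanifoldCoord S e) (hx : x ∈ e.source) (hxS : x ∈ S) (hp : 1 ≤ p)
    {P : MvPolynomial (Fin k) ℂ} (hP : CorrespondsTo S p e x (f x) P) :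
    (fun w => F (e.symm (w, (e x).2)) - MvPolynomial.eval (fun i => w i) P)
      =o[𝓝 0] fun w => ‖w‖ ^ (p - 1) := by
  have hdiff := he.differentiableAt_symm_slice hx hxS
  have htend := hdiff.continuousAt.tendsto
  have hdist := hdiff.isBigO_sub
  simp only [he.symm_zero hx hxS, sub_zero] at htend hdist
  have hnear : ∀ᶠ w : Cn k in 𝓝 0, (w, (e x).2) ∈ e.target :=
    (by fun_prop : Continuous fun w : Cn k => (w, (e x).2)).continuousAt.eventually_mem
      (e.open_target.mem_nhds (he.zero_mem_target hx hxS))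
  refine (((hF.sub_coordPoly_isLittleO hxS hp hP).comp_tendsto htend).trans_isBigO
    (hdist.norm_norm.pow _)).congr' ?_ EventuallyEq.rfl
  filter_upwards [hnear] with w hw
  simp only [Function.comp, coordPoly, e.right_inv hw]

theorem IsSmoothExtension.isBigO_slice (hF : IsSmoothExtension D S p f F)
    (he : IsSubmanifoldCoord S e) (hx : x ∈ e.source) (hxS : x ∈ S) (hp : 1 ≤ p) :
    (fun w => F (e.symm (w, (e x).2))) =O[𝓝 0] fun w => ‖w‖ ^ (p - 1) := by
  obtain ⟨P, hP⟩ := exists_correspondsTo he hx hxS p (f x)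
  simpa using (hF.isLittleO_slice he hx hxS hp hP).isBigO.add
    (isBigO_eval_of_isHomogeneous hP.1 (𝓝 0))

theorem mem_closedBall_zero_prod {w : Cn k} {v : Cn m} :
    (w, v) ∈ Metric.closedBall ((0 : Cn k), v₀) r ↔ ‖w‖ ≤ r ∧ v ∈ Metric.closedBall v₀ r := by
  rw [← closedBall_prod_same, Set.mem_prod, mem_closedBall_zero_iff]

theorem IsSmoothExtension.exists_norm_le (hF : IsSmoothExtension D S p f F)
    (he : IsSubmanifoldCoord S e) (heD : e.source ⊆ D) (hp : 1 ≤ p)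
    (hbox : Metric.closedBall ((0 : Cn k), v₀) r ⊆ e.target) :
    ∃ C, 0 ≤ C ∧ ∀ z ∈ Metric.closedBall ((0 : Cn k), v₀) r,
      ‖F (e.symm z)‖ ≤ C * ‖z.1‖ ^ (p - 1) := by
  have hstar : ∀ z ∈ Metric.closedBall ((0 : Cn k), v₀) r, ∀ s ∈ Set.Icc (0 : ℝ) 1,
      (s • z.1, z.2) ∈ Metric.closedBall ((0 : Cn k), v₀) r := by
    rintro ⟨w, v⟩ hz s hs
    rw [mem_closedBall_zero_prod] at hz ⊢
    refine ⟨?_, hz.2⟩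
    rw [norm_smul, Real.norm_of_nonneg hs.1]
    exact (mul_le_of_le_one_left (norm_nonneg w) hs.2).trans hz.1
  refine exists_norm_le_mul_norm_fst_pow (Φ := fun z => F (e.symm z)) e.open_target
    ((hF.1.comp he.contDiffOn_symm fun z hz => heD (e.map_target hz)).of_le
      (WithTop.coe_le_coe.2 le_top)) (isCompact_closedBall _ _) hbox hstar fun z hz => ?_
  have hT : ((0 : Cn k), z.2) ∈ e.target := by
    simpa using hbox (hstar z hz 0 (Set.left_mem_Icc.2 zero_le_one))
  simpa only [e.right_inv hT] using
    hF.isBigO_slice he (e.map_target hT) ((he.symm_mem_iff hT).2 rfl) hp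

theorem norm_pow_mul_norm_integrand_symm (hγ : IsGreenPart G e γ) (hp : 1 ≤ p) {w : Cn k}
    {v : Cn m} (hT : (w, v) ∈ e.target) (hw : w ≠ 0) :
    ‖w‖ ^ (2 * k) * ‖integrand k p G φ F H (e.symm (w, v))‖ =
      Real.exp (-φ (e.symm (w, v))) * Real.exp (-((p : ℝ) + k - 1) * γ (e.symm (w, v))) *
        (‖F (e.symm (w, v))‖ / ‖w‖ ^ (p - 1) * (‖H (e.symm (w, v))‖ / ‖w‖ ^ (p - 1))) := by
  rw [integrand_symm_eq_shellIntegrand hγ hT hw, shellIntegrand_eq_inv_norm_pow_mul hp hw]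
  simp only [norm_mul, norm_inv, Complex.norm_real, RCLike.norm_conj, Real.norm_eq_abs,
    abs_pow, abs_norm, Real.abs_exp]
  field_simp
  ring

theorem exists_norm_pow_mul_norm_integrand_le (hF : IsSmoothExtension D S p f F)
    (hH : IsSmoothExtension D S p g H) (he : IsAdaptedCoord D S G e) (hγ : IsGreenPart G e γ)
    (hφ : ContinuousOn φ D) (hp : 1 ≤ p)
    (hbox : Metric.closedBall ((0 : Cn k), v₀) r ⊆ e.target) :
    ∃ M, 0 ≤ M ∧ ∀ w v, (w, v) ∈ Metric.closedBall ((0 : Cn k), v₀) r → w ≠ 0 →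
      ‖w‖ ^ (2 * k) *
        ‖ambientDensity e (w, v) • integrand k p G φ F H (e.symm (w, v))‖ ≤ M := by
  obtain ⟨CF, hCF0, hCF⟩ :=
    hF.exists_norm_le he.toIsSubmanifoldCoord he.source_subset hp hbox
  obtain ⟨CH, hCH0, hCH⟩ :=
    hH.exists_norm_le he.toIsSubmanifoldCoord he.source_subset hp hbox
  have hsymm := e.continuousOn_symm.mono hbox
  have hsource : Set.MapsTo e.symm (Metric.closedBall ((0 : Cn k), v₀) r) e.source :=
    fun z hz => e.map_target (hbox hz)
  have hweight : ContinuousOn (fun z => ambientDensity e z * (Real.exp (-φ (e.symm z)) *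
      Real.exp (-((p : ℝ) + k - 1) * γ (e.symm z)))) (Metric.closedBall ((0 : Cn k), v₀) r) :=
    (he.continuousOn_ambientDensity.mono hbox).mul
      (((hφ.mono he.source_subset).comp hsymm hsource).neg.rexp.mul
        (continuousOn_const.mul (hγ.1.comp hsymm hsource)).rexp)
  obtain ⟨B, hB⟩ := (isCompact_closedBall _ _).exists_bound_of_continuousOn hweight
  refine ⟨|B| * (CF * CH), by positivity, fun w v hz hw => ?_⟩
  have hpos : 0 < ‖w‖ ^ (p - 1) := pow_pos (norm_pos_iff.2 hw) _
  rw [norm_smul, mul_left_comm, norm_pow_mul_norm_integrand_symm hγ hp (hbox hz) hw, ← mul_assoc]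
  gcongr
  · simpa only [norm_mul, Real.norm_eq_abs, Real.abs_exp] using
      (hB _ hz).trans (le_abs_self B)
  · exact (div_le_iff₀ hpos).2 (hCF _ hz)
  · exact (div_le_iff₀ hpos).2 (hCH _ hz)

/-- The box of radius `r` around the point of `S` with coordinates `(0, v₀)`. -/
def coordBox (e : Coord n k m) (r : ℝ) (v₀ : Cn m) : Set (Cn n) :=
  e.symm '' Metric.ball ((0 : Cn k), v₀) r

theorem isOpen_coordBox (hbox : Metric.closedBall ((0 : Cn k), v₀) r ⊆ e.target) :
    IsOpen (coordBox e r v₀) :=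
  e.symm.isOpen_image_of_subset_source Metric.isOpen_ball
    (Metric.ball_subset_closedBall.trans hbox)

theorem isAdaptedNhd_coordBox (he : IsAdaptedCoord D S G e) (hr : 0 < r)
    (hbox : Metric.closedBall ((0 : Cn k), v₀) r ⊆ e.target) {v : Cn m}
    (hv : v ∈ Metric.ball v₀ r) :
    IsAdaptedNhd D S G e (coordBox e r v₀) (e.symm (0, v)) := by
  have hcompact : IsCompact (e.symm '' Metric.closedBall ((0 : Cn k), v₀) r) :=
    (isCompact_closedBall _ _).image_of_continuousOn (e.continuousOn_symm.mono hbox)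
  have hclosure : closure (coordBox e r v₀) ⊆ e.symm '' Metric.closedBall ((0 : Cn k), v₀) r :=
    closure_minimal (Set.image_mono Metric.ball_subset_closedBall) hcompact.isClosed
  have hcentre : ((0 : Cn k), v) ∈ Metric.ball ((0 : Cn k), v₀) r := by
    rw [← ball_prod_same]
    exact ⟨Metric.mem_ball_self hr, hv⟩
  exact
    { adapted := he
      isOpen := isOpen_coordBox hbox
      compact_closure := hcompact.of_isClosed_subset isClosed_closure hclosure
      closure_subset := hclosure.trans
        (Set.image_subset_iff.2 fun z hz => e.map_target (hbox hz))
      mem := ⟨_, hcentre, rfl⟩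
      mem_S := (he.symm_mem_iff (hbox (Metric.ball_subset_closedBall hcentre))).2 rfl }

end Extension

/-! ### Integration over `S` in one chart -/

section Fubini

variable {X Y : Type*} [MeasurableSpace X] [MeasurableSpace Y] {μ : Measure X} {ν : Measure Y}
  {B : Set Y} {Θ : X × Y → ℂ}

theorem integral_indicator_slice {A : Set (X × Y)} (hA : MeasurableSet A) (v : Y) :
    ∫ w, A.indicator Θ (w, v) ∂μ = ∫ w in {w | (w, v) ∈ A}, Θ (w, v) ∂μ := by
  have slice_measurable : MeasurableSet {w | (w, v) ∈ A} := measurable_prodMk_right hA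
  rw [← integral_indicator slice_measurable]
  rfl

variable [SFinite μ] [SFinite ν]

theorem integrable_setIntegral_slice {A : Set (X × Y)} (hA : MeasurableSet A)
    (hΘ : IntegrableOn Θ A (μ.prod ν)) :
    Integrable (fun v => ∫ w in {w | (w, v) ∈ A}, Θ (w, v) ∂μ) ν := by
  simpa only [integral_indicator_slice hA] using
    ((integrable_indicator_iff hA).2 hΘ).integral_prod_right

theorem setIntegral_eq_setIntegral_slice {A : Set (X × Y)} (hA : MeasurableSet A)
    (hAB : ∀ z ∈ A, z.2 ∈ B) (hΘ : IntegrableOn Θ A (μ.prod ν)) :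
    ∫ z in A, Θ z ∂(μ.prod ν) = ∫ v in B, ∫ w in {w | (w, v) ∈ A}, Θ (w, v) ∂μ ∂ν := by
  rw [← integral_indicator hA, integral_prod_symm _ ((integrable_indicator_iff hA).2 hΘ)]
  simp only [integral_indicator_slice hA]
  refine (setIntegral_eq_integral_of_forall_compl_eq_zero fun v hv => ?_).symm
  have slice_empty : {w | (w, v) ∈ A} = ∅ := Set.eq_empty_of_forall_notMem fun w hw =>
    hv (hAB _ hw)
  rw [slice_empty, setIntegral_empty]

theorem tendsto_setIntegral_of_slice {ι : Type*} {l : Filter ι} [l.NeBot]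
    [l.IsCountablyGenerated] (hB : MeasurableSet B) (hBν : ν B ≠ ⊤) {A : ι → Set (X × Y)}
    (hA : ∀ t, MeasurableSet (A t)) (hAB : ∀ t, ∀ z ∈ A t, z.2 ∈ B)
    (hΘ : ∀ t, IntegrableOn Θ (A t) (μ.prod ν)) {M : ℝ}
    (hM : ∀ t, ∀ v ∈ B, ‖∫ w in {w | (w, v) ∈ A t}, Θ (w, v) ∂μ‖ ≤ M) {L : Y → ℂ}
    (hL : ∀ v ∈ B, Tendsto (fun t => ∫ w in {w | (w, v) ∈ A t}, Θ (w, v) ∂μ) l (𝓝 (L v))) :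
    IntegrableOn L B ν ∧
      Tendsto (fun t => ∫ z in A t, Θ z ∂(μ.prod ν)) l (𝓝 (∫ v in B, L v ∂ν)) := by
  have : IsFiniteMeasure (ν.restrict B) := isFiniteMeasure_restrict.2 hBν
  have slice_measurable := fun t =>
    (integrable_setIntegral_slice (hA t) (hΘ t)).aestronglyMeasurable.restrict (s := B)
  have slice_tendsto := ae_restrict_of_forall_mem (μ := ν) hB hL
  refine ⟨Integrable.of_bound (aestronglyMeasurable_of_tendsto_ae l slice_measurable
    slice_tendsto) M (ae_restrict_of_forall_mem hB fun v hv =>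
      le_of_tendsto (hL v hv).norm (Eventually.of_forall fun t => hM t v hv)), ?_⟩
  simp only [fun t => setIntegral_eq_setIntegral_slice (hA t) (hAB t) (hΘ t)]
  exact tendsto_integral_filter_of_dominated_convergence (fun _ => M)
    (Eventually.of_forall slice_measurable)
    (Eventually.of_forall fun t => ae_restrict_of_forall_mem hB (hM t)) (integrable_const M)
    slice_tendsto

end Fubini

section Local

variable {n k m p : ℕ} {D S : Set (Cn n)} {G : Cn n → EReal} {φ γ χ : Cn n → ℝ} {e : Coord n k m}
  {U : Set (Cn n)} {x : Cn n} {f g : ∀ x, JetFibre S p x} {F H : Cn n → ℂ} {v₀ v : Cn m} {r : ℝ}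

theorem tendsto_integral_sliceDomain (hk : 1 ≤ k) (hp : 1 ≤ p) (hφ : ContinuousOn φ D)
    (hF : IsSmoothExtension D S p f F) (hH : IsSmoothExtension D S p g H)
    (hU : IsAdaptedNhd D S G e U x) (hχ : Continuous χ) :
    Tendsto (fun t => ∫ w in sliceDomain e U x ∩ (fun w => e.symm (w, (e x).2)) ⁻¹' shell G t,
      ambientDensity e (w, (e x).2) • χ (e.symm (w, (e x).2)) •
        integrand k p G φ F H (e.symm (w, (e x).2))) atBot
      (𝓝 (subDensity e (e x).2 • χ x • jetInner k m D S G φ p x (f x) (g x))) := by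
  have he := hU.adapted.toIsSubmanifoldCoord
  have heD := hU.adapted.source_subset
  obtain ⟨γ, hγ⟩ := hU.adapted.green
  obtain ⟨P, hP⟩ := exists_correspondsTo he hU.mem_source hU.mem_S p (f x)
  obtain ⟨Q, hQ⟩ := exists_correspondsTo he hU.mem_source hU.mem_S p (g x)
  obtain ⟨C, hC⟩ := hU.compact_closure.exists_bound_of_continuousOn (hγ.1.mono hU.closure_subset)
  have hW := isOpen_sliceDomain (e := e) (x := x) hU.isOpen
  have hsymm : ContinuousOn (fun w => e.symm (w, (e x).2)) (sliceDomain e U x) :=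
    continuousOn_symm_sliceDomain
  have hweight : ContinuousOn (fun w => ambientDensity e (w, (e x).2) * χ (e.symm (w, (e x).2)))
      (sliceDomain e U x) :=
    (he.continuousOn_ambientDensity.comp (by fun_prop) fun _ hw => hw.1).mul
      (hχ.comp_continuousOn hsymm)
  have hmeas : ∀ {F : Cn n → ℂ}, ContDiffOn ℝ ∞ F D → AEStronglyMeasurable
      (fun w => F (e.symm (w, (e x).2))) (volume.restrict (sliceDomain e U x)) := fun hF =>
    (hF.continuousOn.comp hsymm fun w hw =>
      heD (e.map_target hw.1)).aestronglyMeasurable hW.measurableSet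
  have limit := (tendsto_integral_slice he hU.mem_source hU.mem_S hk hp hγ (hφ.mono heD) hW
    hU.zero_mem_sliceDomain (fun w hw => hw.1)
    (fun w hw => (abs_le.1 (hC _ (subset_closure hw.2))).1) hweight (hmeas hF.1) (hmeas hH.1)
    hP.1 hQ.1 ((hF.isLittleO_slice he hU.mem_source hU.mem_S hp hP).mono nhdsWithin_le_nhds)
    ((hH.isLittleO_slice he hU.mem_source hU.mem_S hp hQ).mono nhdsWithin_le_nhds)).2
  simp only [mul_smul] at limit
  convert limit using 2
  have hpos : ((subDensity e (e x).2 : ℝ) : ℂ) ≠ 0 := Complex.ofReal_ne_zero.2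
    (he.subDensity_pos (he.zero_mem_target hU.mem_source hU.mem_S)).ne'
  rw [jetInner_eq_sliceForm hk hp hφ hU hγ hP hQ, sliceForm, sliceDensity,
    he.symm_zero hU.mem_source hU.mem_S]
  simp only [Complex.real_smul]
  push_cast
  field_simp

theorem mem_ball_zero_prod {w : Cn k} :
    (w, v) ∈ Metric.ball ((0 : Cn k), v₀) r ↔ w ∈ Metric.ball 0 r ∧ v ∈ Metric.ball v₀ r := by
  rw [← ball_prod_same, Set.mem_prod]

theorem symm_mem_coordBox_iff (hbox : Metric.closedBall ((0 : Cn k), v₀) r ⊆ e.target)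
    {z : Cn k × Cn m} (hz : z ∈ e.target) :
    e.symm z ∈ coordBox e r v₀ ↔ z ∈ Metric.ball ((0 : Cn k), v₀) r :=
  e.symm.injOn.mem_image_iff (Metric.ball_subset_closedBall.trans hbox) hz

theorem sliceDomain_coordBox (hbox : Metric.closedBall ((0 : Cn k), v₀) r ⊆ e.target)
    (hx : (e x).2 ∈ Metric.ball v₀ r) :
    sliceDomain e (coordBox e r v₀) x = Metric.ball 0 r := by
  ext w
  have hball : w ∈ Metric.ball 0 r ↔ (w, (e x).2) ∈ Metric.ball ((0 : Cn k), v₀) r :=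
    (mem_ball_zero_prod.trans (and_iff_left hx)).symm
  rw [hball]
  exact ⟨fun hw => (symm_mem_coordBox_iff hbox hw.1).1 hw.2,
    fun hw => ⟨hbox (Metric.ball_subset_closedBall hw), _, hw, rfl⟩⟩

theorem subDomain_inter_preimage_coordBox (hr : 0 < r)
    (hbox : Metric.closedBall ((0 : Cn k), v₀) r ⊆ e.target) :
    subDomain e ∩ (fun v => e.symm (0, v)) ⁻¹' coordBox e r v₀ = Metric.ball v₀ r := by
  ext v
  have hball : v ∈ Metric.ball v₀ r ↔ ((0 : Cn k), v) ∈ Metric.ball ((0 : Cn k), v₀) r :=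
    (mem_ball_zero_prod.trans (and_iff_right (Metric.mem_ball_self hr))).symm
  rw [hball]
  exact ⟨fun hv => (symm_mem_coordBox_iff hbox hv.1).1 hv.2,
    fun hv => ⟨hbox (Metric.ball_subset_closedBall hv), _, hv, rfl⟩⟩

theorem coordBox_subset_source (hbox : Metric.closedBall ((0 : Cn k), v₀) r ⊆ e.target) :
    coordBox e r v₀ ⊆ e.source :=
  Set.image_subset_iff.2 fun _ hz => e.map_target (hbox (Metric.ball_subset_closedBall hz))

theorem integrable_subVolume_iff_of_coordBox (he : IsSubmanifoldCoord S e) (hr : 0 < r)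
    (hbox : Metric.closedBall ((0 : Cn k), v₀) r ⊆ e.target) {h : Cn n → ℂ}
    (hh : ∀ y, y ∉ coordBox e r v₀ → h y = 0) :
    Integrable h (subVolume k m S) ↔
      IntegrableOn (fun v => subDensity e v • h (e.symm (0, v))) (Metric.ball v₀ r) := by
  rw [← subDomain_inter_preimage_coordBox hr hbox,
    ← integrableOn_pushDensity isOpen_subDomain.measurableSet continuousOn_symm_subDomain
      injOn_symm_subDomain
      (he.continuousOn_subDensity.aemeasurable isOpen_subDomain.measurableSet)
      fun v hv => (he.subDensity_pos hv).le,
    ← chartVolume_eq, IntegrableOn,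
    ← subVolume_restrict_of_subset he (coordBox_subset_source hbox)]
  exact (integrableOn_iff_integrable_of_support_subset
    (Function.support_subset_iff'.2 hh)).symm

theorem integral_subVolume_of_coordBox (he : IsSubmanifoldCoord S e) (hr : 0 < r)
    (hbox : Metric.closedBall ((0 : Cn k), v₀) r ⊆ e.target) {h : Cn n → ℂ}
    (hh : ∀ y, y ∉ coordBox e r v₀ → h y = 0) :
    ∫ y, h y ∂(subVolume k m S) =
      ∫ v in Metric.ball v₀ r, subDensity e v • h (e.symm (0, v)) := by
  rw [← subDomain_inter_preimage_coordBox hr hbox,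
    ← setIntegral_pushDensity isOpen_subDomain.measurableSet continuousOn_symm_subDomain
      injOn_symm_subDomain
      (he.continuousOn_subDensity.aemeasurable isOpen_subDomain.measurableSet)
      fun v hv => (he.subDensity_pos hv).le,
    ← chartVolume_eq, ← subVolume_restrict_of_subset he (coordBox_subset_source hbox)]
  exact (setIntegral_eq_integral_of_forall_compl_eq_zero hh).symm

theorem isOpen_ball_inter_preimage_shell (heD : e.source ⊆ D)
    (hbox : Metric.closedBall ((0 : Cn k), v₀) r ⊆ e.target) {t : ℝ}
    (hshell : IsOpen (shell G t ∩ D)) :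
    IsOpen (Metric.ball ((0 : Cn k), v₀) r ∩ e.symm ⁻¹' shell G t) := by
  have hball := Metric.ball_subset_closedBall.trans hbox
  have inter_D : Metric.ball ((0 : Cn k), v₀) r ∩ e.symm ⁻¹' shell G t =
      Metric.ball ((0 : Cn k), v₀) r ∩ e.symm ⁻¹' (shell G t ∩ D) := by
    ext z
    exact and_congr_right fun hz => (and_iff_left (heD (e.map_target (hball hz)))).symm
  rw [inter_D]
  exact (e.continuousOn_symm.mono hball).isOpen_inter_preimage Metric.isOpen_ball hshell

theorem symm_image_ball_inter_preimage_shell_subset (heD : e.source ⊆ D)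
    (hbox : Metric.closedBall ((0 : Cn k), v₀) r ⊆ e.target) (t : ℝ) :
    e.symm '' (Metric.ball ((0 : Cn k), v₀) r ∩ e.symm ⁻¹' shell G t) ⊆ shell G t ∩ D := by
  rw [Set.image_inter_preimage, Set.inter_comm]
  exact Set.inter_subset_inter_right _ ((coordBox_subset_source hbox).trans heD)

theorem setIntegral_shell_of_coordBox (hn : k + m = n) (he : IsSubmanifoldCoord S e)
    (heD : e.source ⊆ D) (hbox : Metric.closedBall ((0 : Cn k), v₀) r ⊆ e.target) {t : ℝ}
    (hshell : IsOpen (shell G t ∩ D)) {h : Cn n → ℂ} (hh : ∀ y, y ∉ coordBox e r v₀ → h y = 0) :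
    ∫ y in shell G t ∩ D, h y = ∫ z in Metric.ball ((0 : Cn k), v₀) r ∩ e.symm ⁻¹' shell G t,
      ambientDensity e z • h (e.symm z) := by
  rw [← integral_symm_image he hn
    (isOpen_ball_inter_preimage_shell heD hbox hshell).measurableSet
    (Set.inter_subset_left.trans (Metric.ball_subset_closedBall.trans hbox))]
  refine setIntegral_eq_of_subset_of_forall_sdiff_eq_zero hshell.measurableSet
    (symm_image_ball_inter_preimage_shell_subset heD hbox t) fun y hy => hh y fun hyV => ?_
  exact hy.2 (Set.image_inter_preimage e.symm _ _ ▸ ⟨hyV, hy.1.1⟩)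

theorem IsGreenPart.exists_abs_le (hγ : IsGreenPart G e γ)
    (hbox : Metric.closedBall ((0 : Cn k), v₀) r ⊆ e.target) :
    ∃ C, ∀ z ∈ Metric.closedBall ((0 : Cn k), v₀) r, |γ (e.symm z)| ≤ C :=
  (isCompact_closedBall _ _).exists_bound_of_continuousOn
    (hγ.1.comp (e.continuousOn_symm.mono hbox) fun _ hz => e.map_target (hbox hz))

theorem exists_norm_integral_slice_le (hF : IsSmoothExtension D S p f F)
    (hH : IsSmoothExtension D S p g H) (he : IsAdaptedCoord D S G e) (hφ : ContinuousOn φ D)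
    (hp : 1 ≤ p) (hbox : Metric.closedBall ((0 : Cn k), v₀) r ⊆ e.target) :
    ∃ M, ∀ χ : Cn n → ℝ, (∀ y, |χ y| ≤ 1) → ∀ t, ∀ v ∈ Metric.ball v₀ r,
      ‖∫ w in Metric.ball 0 r ∩ (fun w => e.symm (w, v)) ⁻¹' shell G t,
        ambientDensity e (w, v) • χ (e.symm (w, v)) •
          integrand k p G φ F H (e.symm (w, v))‖ ≤ M := by
  obtain ⟨γ, hγ⟩ := he.green
  obtain ⟨M, hM0, hM⟩ := exists_norm_pow_mul_norm_integrand_le hF hH he hγ hφ hp hbox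
  obtain ⟨C, hC⟩ := IsGreenPart.exists_abs_le hγ hbox
  refine ⟨M * Real.exp (C + 1 / 2) ^ (2 * k) *
    (volume : Measure (Cn k)).real (Metric.closedBall 0 1), fun χ hχ1 t v hv => ?_⟩
  have hball : ∀ w ∈ Metric.ball (0 : Cn k) r, (w, v) ∈ Metric.closedBall ((0 : Cn k), v₀) r :=
    fun w hw => Metric.ball_subset_closedBall (mem_ball_zero_prod.2 ⟨hw, hv⟩)
  have hγv : ContinuousOn (fun w => γ (e.symm (w, v))) (Metric.ball 0 r) :=
    (hγ.1.comp e.continuousOn_symm fun _ hz => e.map_target hz).comp (by fun_prop)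
      fun w hw => hbox (hball w hw)
  rw [preimage_shell_eq_vshell hγ (fun w hw => hbox (hball w hw)), ← finrank_real_Cn k]
  refine norm_integral_vshell_le volume (isOpen_vshell Metric.isOpen_ball
    (continuousOn_two_mul_log_norm_add hγv) t).measurableSet hM0 (fun w hw => ?_) fun w hw => ?_
  · rw [add_sub_cancel_left]
    exact hC _ (hball w hw.1)
  · rw [finrank_real_Cn, smul_comm, norm_smul]
    refine (mul_le_mul_of_nonneg_left ?_ (by positivity)).trans (hM w v (hball w hw.1) hw.2.1)
    exact mul_le_of_le_one_left (norm_nonneg _) (hχ1 _)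

theorem integrableOn_ambientDensity_smul (hn : k + m = n) (he : IsSubmanifoldCoord S e)
    (heD : e.source ⊆ D) (hbox : Metric.closedBall ((0 : Cn k), v₀) r ⊆ e.target) {t : ℝ}
    (hshell : IsOpen (shell G t ∩ D)) {h : Cn n → ℂ} (hh : IntegrableOn h (shell G t ∩ D)) :
    IntegrableOn (fun z => ambientDensity e z • h (e.symm z))
      (Metric.ball ((0 : Cn k), v₀) r ∩ e.symm ⁻¹' shell G t) :=
  (integrableOn_symm_image he hn (isOpen_ball_inter_preimage_shell heD hbox hshell).measurableSet
    (Set.inter_subset_left.trans (Metric.ball_subset_closedBall.trans hbox)) h).1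
    (hh.mono_set (symm_image_ball_inter_preimage_shell_subset heD hbox t))

theorem tendsto_integral_slice_of_coordBox (hk : 1 ≤ k) (hp : 1 ≤ p) (hφ : ContinuousOn φ D)
    (hF : IsSmoothExtension D S p f F) (hH : IsSmoothExtension D S p g H)
    (he : IsAdaptedCoord D S G e) (hr : 0 < r)
    (hbox : Metric.closedBall ((0 : Cn k), v₀) r ⊆ e.target) (hχ : Continuous χ)
    (hv : v ∈ Metric.ball v₀ r) :
    Tendsto (fun t => ∫ w in Metric.ball 0 r ∩ (fun w => e.symm (w, v)) ⁻¹' shell G t,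
        ambientDensity e (w, v) • χ (e.symm (w, v)) • integrand k p G φ F H (e.symm (w, v))) atBot
      (𝓝 (subDensity e v • χ (e.symm (0, v)) •
        jetInner k m D S G φ p (e.symm (0, v)) (f (e.symm (0, v))) (g (e.symm (0, v))))) := by
  have hcoord : (e (e.symm (0, v))).2 = v := by
    rw [e.right_inv (hbox (Metric.ball_subset_closedBall
      (mem_ball_zero_prod.2 ⟨Metric.mem_ball_self hr, hv⟩)))]
  have limit := tendsto_integral_sliceDomain hk hp hφ hF hH (isAdaptedNhd_coordBox he hr hbox hv) hχ
  rwa [sliceDomain_coordBox hbox (by rwa [hcoord]), hcoord] at limit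

theorem integrable_and_tendsto_of_coordBox (hn : k + m = n) (hk : 1 ≤ k) (hp : 1 ≤ p)
    (hφ : ContinuousOn φ D) (hF : IsSmoothExtension D S p f F) (hH : IsSmoothExtension D S p g H)
    (he : IsAdaptedCoord D S G e) (hshell : ∀ t, IsOpen (shell G t ∩ D))
    (hint : ∀ t, IntegrableOn (integrand k p G φ F H) (shell G t ∩ D)) (hr : 0 < r)
    (hbox : Metric.closedBall ((0 : Cn k), v₀) r ⊆ e.target) (hχ : Continuous χ)
    (hχ1 : ∀ y, |χ y| ≤ 1) (hχV : ∀ y, y ∉ coordBox e r v₀ → χ y = 0) :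
    Integrable (fun x => χ x • jetInner k m D S G φ p x (f x) (g x)) (subVolume k m S) ∧
    Tendsto (fun t => ∫ y in shell G t ∩ D, χ y • integrand k p G φ F H y) atBot
      (𝓝 (∫ x, χ x • jetInner k m D S G φ p x (f x) (g x) ∂(subVolume k m S))) := by
  have he' := he.toIsSubmanifoldCoord
  have heD := he.source_subset
  have hsmul : ∀ h : Cn n → ℂ, ∀ y, y ∉ coordBox e r v₀ → χ y • h y = 0 := fun h y hy => by
    rw [hχV y hy, zero_smul]
  have hχint : ∀ t, IntegrableOn (fun y => χ y • integrand k p G φ F H y) (shell G t ∩ D) :=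
    fun t => (hint t).bdd_smul 1 hχ.aestronglyMeasurable (Eventually.of_forall hχ1)
  have slice_eq : ∀ t, ∀ v ∈ Metric.ball v₀ r,
      {w : Cn k | (w, v) ∈ Metric.ball ((0 : Cn k), v₀) r ∩ e.symm ⁻¹' shell G t} =
        Metric.ball 0 r ∩ (fun w => e.symm (w, v)) ⁻¹' shell G t := fun t v hv => by
    ext w
    exact and_congr_left' (mem_ball_zero_prod.trans (and_iff_left hv))
  obtain ⟨M, hM⟩ := exists_norm_integral_slice_le hF hH he hφ hp hbox
  have limit := tendsto_setIntegral_of_slice (l := atBot) (B := Metric.ball v₀ r)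
    (L := fun v => subDensity e v • χ (e.symm (0, v)) • jetInner k m D S G φ p (e.symm (0, v))
      (f (e.symm (0, v))) (g (e.symm (0, v)))) Metric.isOpen_ball.measurableSet
    measure_ball_lt_top.ne
    (fun t => (isOpen_ball_inter_preimage_shell heD hbox (hshell t)).measurableSet)
    (fun t z hz => (mem_ball_zero_prod.1 hz.1).2)
    (fun t => integrableOn_ambientDensity_smul hn he' heD hbox (hshell t) (hχint t))
    (fun t v hv => by simpa only [slice_eq t v hv] using hM χ hχ1 t v hv)
    fun v hv => by
      simpa only [slice_eq _ v hv] using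
        tendsto_integral_slice_of_coordBox hk hp hφ hF hH he hr hbox hχ hv
  rw [integrable_subVolume_iff_of_coordBox he' hr hbox (hsmul _),
    integral_subVolume_of_coordBox he' hr hbox (hsmul _)]
  simp only [fun t => setIntegral_shell_of_coordBox hn he' heD hbox (hshell t)
    (hsmul (integrand k p G φ F H))]
  exact limit

end Local

/-! ### Integration over `S` -/

section LogPoles

variable {n k m p : ℕ} {D S A K : Set (Cn n)} {G : Cn n → EReal} {φ : Cn n → ℝ} {F H : Cn n → ℂ}
  {x y : Cn n} {t : ℝ}

/-- `G` has logarithmic poles along `S`: it is continuous and not `-∞` on `D \ S`, and near every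
point of `S` there are adapted coordinates. These are the parts of `IsGreenType` that concern the
shape of `G` near `S`. -/
structure HasLogPoles (k m : ℕ) (D S : Set (Cn n)) (G : Cn n → EReal) : Prop where
  finite : ∀ z ∈ D \ S, G z ≠ ⊥
  cont : ContinuousOn G (D \ S)
  coord : ∀ x ∈ S, ∃ e : Coord n k m, x ∈ e.source ∧ IsAdaptedCoord D S G e

theorem IsGreenType.hasLogPoles (hG : IsGreenType k m D S G) : HasLogPoles k m D S G :=
  ⟨hG.finite, hG.cont, hG.coord⟩

theorem HasLogPoles.subset (hG : HasLogPoles k m D S G) : S ⊆ D := fun x hx => by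
  obtain ⟨e, hxe, he⟩ := hG.coord x hx
  exact he.source_subset hxe

theorem HasLogPoles.eq_bot (hG : HasLogPoles k m D S G) (hx : x ∈ S) : G x = ⊥ := by
  obtain ⟨e, hxe, he⟩ := hG.coord x hx
  obtain ⟨γ, hγ⟩ := he.green
  exact IsGreenPart.eq_bot hγ hxe ((he.mem_iff x hxe).1 hx)

theorem isOpen_diff_of_relClosed (hD : IsOpen D) (hS : closure S ∩ D ⊆ S) : IsOpen (D \ S) := by
  have diff_closure : D \ S = D \ closure S :=
    Set.Subset.antisymm (fun _ hy => ⟨hy.1, fun hyS => hy.2 (hS ⟨hyS, hy.1⟩)⟩)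
      (Set.sdiff_subset_sdiff_right subset_closure)
  rw [diff_closure]
  exact hD.sdiff isClosed_closure

theorem measurableSet_of_relClosed (hD : IsOpen D) (hSD : S ⊆ D) (hS : closure S ∩ D ⊆ S) :
    MeasurableSet S := by
  rw [← Set.sdiff_sdiff_cancel_left hSD]
  exact hD.measurableSet.diff (isOpen_diff_of_relClosed hD hS).measurableSet

theorem HasLogPoles.shell_inter_subset (hG : HasLogPoles k m D S G) : shell G t ∩ D ⊆ D \ S :=
  fun _ hy => ⟨hy.2, fun hyS => not_lt_bot ((hG.eq_bot hyS).subst hy.1.1)⟩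

theorem HasLogPoles.isOpen_shell_inter (hG : HasLogPoles k m D S G) (hD : IsOpen D)
    (hS : closure S ∩ D ⊆ S) (t : ℝ) : IsOpen (shell G t ∩ D) := by
  have shell_eq : shell G t ∩ D = (D \ S) ∩ G ⁻¹' Set.Ioo (t : EReal) ((t + 1 : ℝ) : EReal) :=
    Set.Subset.antisymm (fun _ hy => ⟨hG.shell_inter_subset hy, hy.1⟩)
      fun _ hy => ⟨hy.2, hy.1.1⟩
  rw [shell_eq]
  exact hG.cont.isOpen_inter_preimage (isOpen_diff_of_relClosed hD hS) isOpen_Ioo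

theorem ne_bot_of_mem_shell (hy : y ∈ shell G t) : G y ≠ ⊥ := (bot_le.trans_lt hy.1).ne'

theorem ne_top_of_mem_shell (hy : y ∈ shell G t) : G y ≠ ⊤ := (hy.2.trans_le le_top).ne

theorem lt_toReal_of_mem_shell (hy : y ∈ shell G t) : t < (G y).toReal := by
  rw [← EReal.coe_lt_coe_iff, EReal.coe_toReal (ne_top_of_mem_shell hy) (ne_bot_of_mem_shell hy)]
  exact hy.1

theorem integrand_eq_zero (hy : F y * conj (H y) = 0) : integrand k p G φ F H y = 0 := by
  rw [integrand, hy, zero_mul]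

theorem continuousOn_integrand (hG : ContinuousOn G A) (hGbot : ∀ y ∈ A, G y ≠ ⊥)
    (hGtop : ∀ y ∈ A, G y ≠ ⊤) (hφ : ContinuousOn φ A) (hF : ContinuousOn F A)
    (hH : ContinuousOn H A) : ContinuousOn (integrand k p G φ F H) A := by
  have continuousOn_toReal : ContinuousOn (fun y => (G y).toReal) A :=
    EReal.continuousOn_toReal.comp hG fun y hy => by
      simp only [Set.mem_compl_iff, Set.mem_insert_iff, Set.mem_singleton_iff, not_or]
      exact ⟨hGbot y hy, hGtop y hy⟩
  exact (hF.mul (Complex.continuous_conj.comp_continuousOn hH)).mul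
    (Complex.continuous_ofReal.comp_continuousOn (Real.continuous_exp.comp_continuousOn
      (hφ.neg.sub (continuousOn_const.mul continuousOn_toReal))))

theorem norm_integrand_le_of_le_toReal (hp : 1 ≤ p) (ht : t ≤ (G y).toReal) :
    ‖integrand k p G φ F H y‖ ≤ ‖integrand k p (fun _ => (t : EReal)) φ F H y‖ := by
  have exponent_nonneg : 0 ≤ (p : ℝ) + k - 1 := by
    have : (1 : ℝ) ≤ p := by exact_mod_cast hp
    linarith [(Nat.cast_nonneg k : (0 : ℝ) ≤ k)]
  simp only [integrand, norm_mul, Complex.norm_real, Real.norm_eq_abs, Real.abs_exp,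
    EReal.toReal_coe]
  gcongr

theorem HasLogPoles.integrableOn_shell (hG : HasLogPoles k m D S G) (hD : IsOpen D)
    (hS : closure S ∩ D ⊆ S) (hp : 1 ≤ p) (hφ : ContinuousOn φ D) (hF : ContinuousOn F D)
    (hH : ContinuousOn H D) (hK : IsCompact K) (hKD : K ⊆ D)
    (hzero : ∀ z ∈ D \ K, F z * conj (H z) = 0) (t : ℝ) :
    IntegrableOn (integrand k p G φ F H) (shell G t ∩ D) := by
  have hshell := (hG.isOpen_shell_inter hD hS t).measurableSet
  have hshellK := hshell.inter hK.measurableSet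
  obtain ⟨C, hC⟩ := hK.exists_bound_of_continuousOn
    (continuousOn_integrand (k := k) (p := p) (G := fun _ => (t : EReal)) continuousOn_const
      (fun _ _ => EReal.coe_ne_bot t) (fun _ _ => EReal.coe_ne_top t) (hφ.mono hKD) (hF.mono hKD)
      (hH.mono hKD))
  have hcont : ContinuousOn (integrand k p G φ F H) (shell G t ∩ D) :=
    continuousOn_integrand (hG.cont.mono hG.shell_inter_subset)
      (fun _ hy => ne_bot_of_mem_shell hy.1) (fun _ hy => ne_top_of_mem_shell hy.1)
      (hφ.mono Set.inter_subset_right) (hF.mono Set.inter_subset_right)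
      (hH.mono Set.inter_subset_right)
  have integrableOn_inter_K : IntegrableOn (integrand k p G φ F H) (shell G t ∩ D ∩ K) :=
    .of_bound ((measure_mono Set.inter_subset_right).trans_lt hK.measure_lt_top)
      ((hcont.mono Set.inter_subset_left).aestronglyMeasurable hshellK) C
      (ae_restrict_of_forall_mem hshellK fun y hy =>
        (norm_integrand_le_of_le_toReal hp (lt_toReal_of_mem_shell hy.1.1).le).trans (hC y hy.2))
  exact integrableOn_inter_K.of_forall_sdiff_eq_zero hshell fun y hy =>
    integrand_eq_zero (hzero y ⟨hy.1.2, fun hyK => hy.2 ⟨hy.1, hyK⟩⟩)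

end LogPoles

section Global

variable {n k m p : ℕ} {D S K : Set (Cn n)} {G : Cn n → EReal} {φ : Cn n → ℝ} {e : Coord n k m}
  {f g : ∀ x, JetFibre S p x} {F H : Cn n → ℂ} {x : Cn n}

theorem IsSubmanifoldCoord.exists_closedBall_subset (he : IsSubmanifoldCoord S e)
    (hx : x ∈ e.source) (hxS : x ∈ S) {O : Set (Cn n)} (hO : O ∈ 𝓝 x) :
    ∃ r > 0, Metric.closedBall ((0 : Cn k), (e x).2) r ⊆ e.target ∩ e.symm ⁻¹' O := by
  have htarget := he.zero_mem_target hx hxS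
  refine Metric.nhds_basis_closedBall.mem_iff.1 (inter_mem (e.open_target.mem_nhds htarget)
    ((e.continuousAt_symm htarget).preimage_mem_nhds ?_))
  rwa [he.symm_zero hx hxS]

theorem jetInner_eq_zero (hk : 1 ≤ k) (hp : 1 ≤ p) (hφ : ContinuousOn φ D)
    (hF : IsSmoothExtension D S p f F) (hH : IsSmoothExtension D S p g H)
    (hG : HasLogPoles k m D S G) (hxS : x ∈ S) (hzero : ∀ᶠ y in 𝓝 x, F y * conj (H y) = 0) :
    jetInner k m D S G φ p x (f x) (g x) = 0 := by
  obtain ⟨e, hx, he⟩ := hG.coord x hxS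
  have hpos := he.subDensity_pos (he.zero_mem_target hx hxS)
  obtain ⟨r, hr, hbox⟩ := he.exists_closedBall_subset hx hxS hzero
  have limit := tendsto_integral_slice_of_coordBox hk hp hφ hF hH he hr
    (hbox.trans Set.inter_subset_left) (χ := fun _ => 1) continuous_const (Metric.mem_ball_self hr)
  have integral_eq_zero : ∀ t,
      ∫ w in Metric.ball 0 r ∩ (fun w => e.symm (w, (e x).2)) ⁻¹' shell G t,
        ambientDensity e (w, (e x).2) • integrand k p G φ F H (e.symm (w, (e x).2)) = 0 :=
    fun t => setIntegral_eq_zero_of_forall_eq_zero fun w hw => by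
      rw [integrand_eq_zero (hbox (Metric.ball_subset_closedBall
        (mem_ball_zero_prod.2 ⟨hw.1, Metric.mem_ball_self hr⟩))).2, smul_zero]
  rw [he.symm_zero hx hxS] at limit
  simp only [one_smul, integral_eq_zero] at limit
  exact (smul_eq_zero.1 (tendsto_nhds_unique limit tendsto_const_nhds)).resolve_left hpos.ne'

/-- The formula of part (4) holds for `χ ⟨f, g⟩` and `χ F H̄` for all continuous cut-off functions
`χ` vanishing off `V`. This form of the formula can be summed over a partition of unity. -/
def HasLocalShellLimit (k m p : ℕ) (D S : Set (Cn n)) (G : Cn n → EReal) (φ : Cn n → ℝ)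
    (f g : ∀ x, JetFibre S p x) (F H : Cn n → ℂ) (V : Set (Cn n)) : Prop :=
  ∀ χ : Cn n → ℝ, Continuous χ → (∀ y, |χ y| ≤ 1) → (∀ y, y ∉ V → χ y = 0) →
    Integrable (fun x => χ x • jetInner k m D S G φ p x (f x) (g x)) (subVolume k m S) ∧
    Tendsto (fun t => ∫ y in shell G t ∩ D, χ y • integrand k p G φ F H y) atBot
      (𝓝 (∫ x, χ x • jetInner k m D S G φ p x (f x) (g x) ∂(subVolume k m S)))

theorem hasLocalShellLimit_of_lt (hSmeas : MeasurableSet S) {V : Set (Cn n)} (hVS : Disjoint V S)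
    {c : ℝ} (hc : ∀ y ∈ V, c < G y) : HasLocalShellLimit k m p D S G φ f g F H V := by
  intro χ _ _ hχV
  have jet_eq_zero : (fun x => χ x • jetInner k m D S G φ p x (f x) (g x)) =ᵐ[subVolume k m S]
      fun _ => 0 := by
    filter_upwards [ae_subVolume_mem hSmeas] with y hy
    rw [hχV y (Set.disjoint_right.1 hVS hy), zero_smul]
  refine ⟨(integrable_zero _ _ _).congr jet_eq_zero.symm, ?_⟩
  rw [integral_congr_ae jet_eq_zero, integral_zero]
  refine tendsto_const_nhds.congr' ?_
  filter_upwards [eventually_le_atBot (c - 1)] with t ht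
  refine (setIntegral_eq_zero_of_forall_eq_zero fun y hy => ?_).symm
  have y_notMem : y ∉ V := fun hyV => ((hc y hyV).trans hy.1.2).not_ge
    (EReal.coe_le_coe_iff.2 (by linarith))
  rw [hχV y y_notMem, zero_smul]

theorem HasLogPoles.exists_hasLocalShellLimit (hG : HasLogPoles k m D S G) (hn : k + m = n)
    (hk : 1 ≤ k) (hp : 1 ≤ p) (hφ : ContinuousOn φ D) (hF : IsSmoothExtension D S p f F)
    (hH : IsSmoothExtension D S p g H) (hD : IsOpen D) (hS : closure S ∩ D ⊆ S)
    (hint : ∀ t, IntegrableOn (integrand k p G φ F H) (shell G t ∩ D)) (hx : x ∈ D) :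
    ∃ V, IsOpen V ∧ x ∈ V ∧ HasLocalShellLimit k m p D S G φ f g F H V := by
  by_cases hxS : x ∈ S
  · obtain ⟨e, hxe, he⟩ := hG.coord x hxS
    obtain ⟨r, hr, hbox⟩ := he.exists_closedBall_subset hxe hxS univ_mem
    have hbox := hbox.trans Set.inter_subset_left
    exact ⟨coordBox e r (e x).2, isOpen_coordBox hbox,
      ⟨(0, (e x).2), Metric.mem_ball_self hr, he.symm_zero hxe hxS⟩, fun χ =>
      integrable_and_tendsto_of_coordBox hn hk hp hφ hF hH he (hG.isOpen_shell_inter hD hS) hint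
        hr hbox⟩
  · obtain ⟨c, -, hcx⟩ :=
      EReal.lt_iff_exists_real_btwn.1 (bot_lt_iff_ne_bot.2 (hG.finite x ⟨hx, hxS⟩))
    exact ⟨(D \ S) ∩ G ⁻¹' Set.Ioi (c : EReal),
      hG.cont.isOpen_inter_preimage (isOpen_diff_of_relClosed hD hS) isOpen_Ioi, ⟨⟨hx, hxS⟩, hcx⟩,
      hasLocalShellLimit_of_lt (measurableSet_of_relClosed hD hG.subset hS)
        (Set.disjoint_sdiff_left.mono_left Set.inter_subset_left) fun y hy => hy.2⟩

end Global

theorem exists_continuous_partition_of_local {X : Type*} [TopologicalSpace X] [T2Space X]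
    [LocallyCompactSpace X] {K : Set X} (hK : IsCompact K) {L : Set X → Prop}
    (hL : ∀ x ∈ K, ∃ V, IsOpen V ∧ x ∈ V ∧ L V) :
    ∃ (N : ℕ) (V : Fin N → Set X) (χ : Fin N → X → ℝ), (∀ i, L (V i)) ∧
      (∀ i, Continuous (χ i)) ∧ (∀ i y, |χ i y| ≤ 1) ∧ (∀ i y, y ∉ V i → χ i y = 0) ∧
      ∀ y ∈ K, ∑ i, χ i y = 1 := by
  choose! V hV_open hV_mem hVL using hL
  obtain ⟨s, hsK, hs⟩ := hK.elim_nhds_subcover V fun x hx => (hV_open x hx).mem_nhds (hV_mem x hx)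
  let centre := s.equivFin.symm
  have cover : K ⊆ ⋃ i, V (centre i) := fun y hy => by
    obtain ⟨x, hx, hyx⟩ := Set.mem_iUnion₂.1 (hs hy)
    exact Set.mem_iUnion.2 ⟨centre.symm ⟨x, hx⟩, by rwa [Equiv.apply_symm_apply]⟩
  obtain ⟨χ, hχV, hsum, hχ01, -⟩ := exists_continuous_sum_one_of_isOpen_isCompact
    (fun i => hV_open _ (hsK _ (centre i).2)) hK cover
  refine ⟨_, fun i => V (centre i), fun i => χ i, fun i => hVL _ (hsK _ (centre i).2),
    fun i => (χ i).continuous, fun i y => ?_, fun i y hy => ?_, fun y hy => ?_⟩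
  · exact (abs_of_nonneg (hχ01 i y).1).trans_le (hχ01 i y).2
  · exact image_eq_zero_of_notMem_tsupport fun h => hy (hχV i h)
  · simpa using hsum hy

section Partition

variable {n k m p : ℕ} {D S K : Set (Cn n)} {G : Cn n → EReal} {φ : Cn n → ℝ}
  {f g : ∀ x, JetFibre S p x} {F H : Cn n → ℂ}

theorem integrable_and_tendsto_of_partition (hSmeas : MeasurableSet S) {N : ℕ}
    {V : Fin N → Set (Cn n)} (hV : ∀ i, HasLocalShellLimit k m p D S G φ f g F H (V i))
    {χ : Fin N → Cn n → ℝ} (hχ : ∀ i, Continuous (χ i)) (hχ1 : ∀ i y, |χ i y| ≤ 1)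
    (hχV : ∀ i y, y ∉ V i → χ i y = 0) (hsum : ∀ y ∈ K, ∑ i, χ i y = 1)
    (hjet : ∀ x ∈ S, x ∉ K → jetInner k m D S G φ p x (f x) (g x) = 0)
    (hshell : ∀ t, MeasurableSet (shell G t ∩ D))
    (hint : ∀ t, IntegrableOn (integrand k p G φ F H) (shell G t ∩ D))
    (hzero : ∀ y ∈ D \ K, integrand k p G φ F H y = 0) :
    Integrable (fun x => jetInner k m D S G φ p x (f x) (g x)) (subVolume k m S) ∧
      Tendsto (fun t => ∫ y in shell G t ∩ D, integrand k p G φ F H y) atBot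
        (𝓝 (∫ x, jetInner k m D S G φ p x (f x) (g x) ∂(subVolume k m S))) := by
  have sum_smul_eq : ∀ {y} {c : ℂ}, (y ∉ K → c = 0) → ∑ i, χ i y • c = c := fun {y c} hc => by
    rw [← Finset.sum_smul]
    by_cases hyK : y ∈ K
    · rw [hsum y hyK, one_smul]
    · rw [hc hyK, smul_zero]
  have hlocal := fun i => hV i (χ i) (hχ i) (hχ1 i) (hχV i)
  have sum_jet : (fun x => ∑ i, χ i x • jetInner k m D S G φ p x (f x) (g x)) =ᵐ[subVolume k m S]
      fun x => jetInner k m D S G φ p x (f x) (g x) := by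
    filter_upwards [ae_subVolume_mem hSmeas] with x hx
    exact sum_smul_eq (hjet x hx)
  have hχint : ∀ i t, IntegrableOn (fun y => χ i y • integrand k p G φ F H y) (shell G t ∩ D) :=
    fun i t => (hint t).bdd_smul 1 (hχ i).aestronglyMeasurable (Eventually.of_forall (hχ1 i))
  have sum_integral : ∀ t, ∑ i, ∫ y in shell G t ∩ D, χ i y • integrand k p G φ F H y =
      ∫ y in shell G t ∩ D, integrand k p G φ F H y := fun t => by
    rw [← integral_finsetSum _ fun i _ => hχint i t]
    exact setIntegral_congr_fun (hshell t) fun y hy =>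
      sum_smul_eq fun hyK => hzero y ⟨hy.2, hyK⟩
  refine ⟨(integrable_finsetSum _ fun i _ => (hlocal i).1).congr sum_jet, ?_⟩
  rw [← integral_congr_ae sum_jet, integral_finsetSum _ fun i _ => (hlocal i).1]
  simpa only [sum_integral] using tendsto_finsetSum Finset.univ fun i _ => (hlocal i).2

theorem HasLogPoles.integrable_jetInner_and_hasShellLimit (hG : HasLogPoles k m D S G)
    (hn : k + m = n) (hk : 1 ≤ k) (hp : 1 ≤ p) (hφ : ContinuousOn φ D)
    (hF : IsSmoothExtension D S p f F) (hH : IsSmoothExtension D S p g H) (hD : IsOpen D)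
    (hS : closure S ∩ D ⊆ S) (hK : IsCompact K) (hKD : K ⊆ D)
    (hzero : ∀ z ∈ D \ K, F z * conj (H z) = 0) :
    Integrable (fun x => jetInner k m D S G φ p x (f x) (g x)) (subVolume k m S) ∧
      HasShellLimit k p G φ (volume.restrict D) F H
        (∫ x, jetInner k m D S G φ p x (f x) (g x) ∂(subVolume k m S)) := by
  have hint := hG.integrableOn_shell hD hS hp hφ hF.1.continuousOn hH.1.continuousOn hK hKD hzero
  have jet_eq_zero : ∀ x ∈ S, x ∉ K → jetInner k m D S G φ p x (f x) (g x) = 0 := fun x hx hxK =>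
    jetInner_eq_zero hk hp hφ hF hH hG hx <| by
      filter_upwards [(hD.sdiff hK.isClosed).mem_nhds ⟨hG.subset hx, hxK⟩] using hzero
  obtain ⟨N, V, χ, hV, hχ, hχ1, hχV, hsum⟩ := exists_continuous_partition_of_local hK fun x hx =>
    hG.exists_hasLocalShellLimit hn hk hp hφ hF hH hD hS hint (hKD hx)
  have hlimit := integrable_and_tendsto_of_partition
    (measurableSet_of_relClosed hD hG.subset hS) hV hχ hχ1 hχV hsum jet_eq_zero
    (fun t => (hG.isOpen_shell_inter hD hS t).measurableSet) hint
    fun y hy => integrand_eq_zero (hzero y hy)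
  simpa only [HasShellLimit, IntegrableOn, Measure.restrict_restrict' hD.measurableSet] using
    ⟨hlimit.1, Eventually.of_forall hint, hlimit.2⟩

end Partition

end JetMetric

end

open JetMetric in
theorem mainTheorem2_general (n k m p : ℕ) (hn : k + m = n) (hk : 1 ≤ k) (hp : 1 ≤ p)
    (D S : Set (Cn n)) (hD : IsOpen D) (hS : closure S ∩ D ⊆ S)
    (φ : Cn n → ℝ) (hφ : ContinuousOn φ D) (G : Cn n → EReal) (hG : HasLogPoles k m D S G) :
    (∀ (x : Cn n) (e : Coord n k m) (U : Set (Cn n)), IsAdaptedNhd D S G e U x →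
      ∀ f : JetFibre S p x, ∃! P : MvPolynomial (Fin k) ℂ, CorrespondsTo S p e x f P) ∧
    (∀ (x : Cn n) (e : Coord n k m) (U : Set (Cn n)), IsAdaptedNhd D S G e U x →
      ∀ (f g : JetFibre S p x) (P Q : MvPolynomial (Fin k) ℂ),
        CorrespondsTo S p e x f P → CorrespondsTo S p e x g Q →
        ∃ c : ℂ, HasShellLimit k p G φ (sliceVolume e U x) (coordPoly e P) (coordPoly e Q) c) ∧
    (∀ (x : Cn n) (e : Coord n k m) (U : Set (Cn n)), IsAdaptedNhd D S G e U x →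
      ∀ (f g : JetFibre S p x) (P Q : MvPolynomial (Fin k) ℂ),
        CorrespondsTo S p e x f P → CorrespondsTo S p e x g Q →
        ∀ F H : Cn n → ℂ,
          AEStronglyMeasurable F (sliceVolume e U x) →
          AEStronglyMeasurable H (sliceVolume e U x) →
          (fun y => F y - coordPoly e P y) =o[𝓝[slice e U x \ {x}] x]
            (fun y => ‖(e y).1‖ ^ (p - 1)) →
          (fun y => H y - coordPoly e Q y) =o[𝓝[slice e U x \ {x}] x]
            (fun y => ‖(e y).1‖ ^ (p - 1)) →
          ∀ c : ℂ,
            HasShellLimit k p G φ (sliceVolume e U x) (coordPoly e P) (coordPoly e Q) c →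
            HasShellLimit k p G φ (sliceVolume e U x) F H c) ∧
    (∀ (x : Cn n) (e : Coord n k m) (U : Set (Cn n)), IsAdaptedNhd D S G e U x →
      ∀ (f g : JetFibre S p x) (P Q : MvPolynomial (Fin k) ℂ),
        CorrespondsTo S p e x f P → CorrespondsTo S p e x g Q →
        HasShellLimit k p G φ (sliceVolume e U x) (coordPoly e P) (coordPoly e Q)
          (jetInner k m D S G φ p x f g)) ∧
    (∀ f g : (∀ x, JetFibre S p x),
      ∀ F H : Cn n → ℂ, IsSmoothExtension D S p f F → IsSmoothExtension D S p g H →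
        (∃ K ⊆ D, IsCompact K ∧ ∀ z ∈ D \ K, F z * conj (H z) = 0) →
        Integrable (fun x => jetInner k m D S G φ p x (f x) (g x)) (subVolume k m S) ∧
        HasShellLimit k p G φ (volume.restrict D) F H
          (∫ x, jetInner k m D S G φ p x (f x) (g x) ∂(subVolume k m S))) := by
  refine ⟨fun x e U hU f => ?_, fun x e U hU f g P Q hP hQ => ?_,
    fun x e U hU f g P Q hP hQ F H hF hH hFP hHQ c hc => ?_,
    fun x e U hU f g P Q hP hQ => ?_, fun f g F H hF hH ⟨K, hKD, hK, hzero⟩ =>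
      hG.integrable_jetInner_and_hasShellLimit hn hk hp hφ hF hH hD hS hK hKD hzero⟩
  · have he := hU.adapted.toIsSubmanifoldCoord
    obtain ⟨P, hP⟩ := exists_correspondsTo he hU.mem_source hU.mem_S p f
    exact ⟨P, hP, fun Q hQ => CorrespondsTo.unique he hU.mem_source hU.mem_S hp hQ hP⟩
  all_goals obtain ⟨γ, hγ⟩ := hU.adapted.green
  · exact ⟨_, hasShellLimit_coordPoly hk hp hφ hU hγ hP.1 hQ.1⟩
  · rw [hc.unique (hasShellLimit_coordPoly hk hp hφ hU hγ hP.1 hQ.1)]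
    exact hasShellLimit_slice hk hp hφ hU hγ hP.1 hQ.1 hF hH hFP hHQ
  · rw [jetInner_eq_sliceForm hk hp hφ hU hγ hP hQ]
    exact hasShellLimit_coordPoly hk hp hφ hU hγ hP.1 hQ.1

open JetMetric in
theorem mainTheorem2 (n k m p : ℕ) (hn : k + m = n) (hk : 1 ≤ k) (hp : 2 ≤ p)
    (D S : Set (Cn n)) (hD : IsPseudoconvexDomain D) (hDb : Bornology.IsBounded D)
    (hSD : S ⊆ D) (hS : closure S ∩ D ⊆ S)
    (φ : Cn n → ℝ) (hφ : ContinuousOn φ D) (hφ' : IsPSHOn (fun z => (φ z : EReal)) D)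
    (G : Cn n → EReal) (hG : IsGreenType k m D S G) :
    -- in adapted coordinates, elements of the fibre correspond to homogeneous polynomials
    (∀ (x : Cn n) (e : Coord n k m) (U : Set (Cn n)), IsAdaptedNhd D S G e U x →
      ∀ f : JetFibre S p x, ∃! P : MvPolynomial (Fin k) ℂ, CorrespondsTo S p e x f P) ∧
    -- (1) the limit exists
    (∀ (x : Cn n) (e : Coord n k m) (U : Set (Cn n)), IsAdaptedNhd D S G e U x →
      ∀ (f g : JetFibre S p x) (P Q : MvPolynomial (Fin k) ℂ),
        CorrespondsTo S p e x f P → CorrespondsTo S p e x g Q →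
        ∃ c : ℂ, HasShellLimit k p G φ (sliceVolume e U x) (coordPoly e P) (coordPoly e Q) c) ∧
    -- (2) the limit does not change under perturbations of order `o(|z'|^(p-1))`
    (∀ (x : Cn n) (e : Coord n k m) (U : Set (Cn n)), IsAdaptedNhd D S G e U x →
      ∀ (f g : JetFibre S p x) (P Q : MvPolynomial (Fin k) ℂ),
        CorrespondsTo S p e x f P → CorrespondsTo S p e x g Q →
        ∀ F H : Cn n → ℂ,
          AEStronglyMeasurable F (sliceVolume e U x) →
          AEStronglyMeasurable H (sliceVolume e U x) →
          (fun y => F y - coordPoly e P y) =o[𝓝[slice e U x \ {x}] x]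
            (fun y => ‖(e y).1‖ ^ (p - 1)) →
          (fun y => H y - coordPoly e Q y) =o[𝓝[slice e U x \ {x}] x]
            (fun y => ‖(e y).1‖ ^ (p - 1)) →
          ∀ c : ℂ,
            HasShellLimit k p G φ (sliceVolume e U x) (coordPoly e P) (coordPoly e Q) c →
            HasShellLimit k p G φ (sliceVolume e U x) F H c) ∧
    -- (3) the limit is the same in all adapted coordinates
    (∀ (x : Cn n) (e : Coord n k m) (U : Set (Cn n)), IsAdaptedNhd D S G e U x →
      ∀ (f g : JetFibre S p x) (P Q : MvPolynomial (Fin k) ℂ),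
        CorrespondsTo S p e x f P → CorrespondsTo S p e x g Q →
        HasShellLimit k p G φ (sliceVolume e U x) (coordPoly e P) (coordPoly e Q)
          (jetInner k m D S G φ p x f g)) ∧
    -- (4) integration over `S`
    (∀ f g : (∀ x, JetFibre S p x), IsSmoothSection k m S p f → IsSmoothSection k m S p g →
      ∀ F H : Cn n → ℂ, IsSmoothExtension D S p f F → IsSmoothExtension D S p g H →
        (∃ K ⊆ D, IsCompact K ∧ ∀ z ∈ D \ K, F z * starRingEnd ℂ (H z) = 0) →
        Integrable (fun x => jetInner k m D S G φ p x (f x) (g x)) (subVolume k m S) ∧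
        HasShellLimit k p G φ (volume.restrict D) F H
          (∫ x, jetInner k m D S G φ p x (f x) (g x) ∂(subVolume k m S))) := by
  obtain ⟨corresponds, limit_exists, limit_perturb, limit_jetInner, integral_jetInner⟩ :=
    mainTheorem2_general n k m p hn hk (by lia) D S hD.1 hS φ hφ G hG.hasLogPoles
  exact ⟨corresponds, limit_exists, limit_perturb, limit_jetInner,
    fun f g _ _ => integral_jetInner f g⟩
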